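/- Fix the following notation. For $\theta\in\{0,1,\bot\}^n$ let $\Phi=\{i:\theta_i\neq\bot\}$ and $\Phi_b=\{i:\theta_i=b\}$ for $b\in\{0,1\}$, and for $f:\{0,1\}^{\Phi}\to\{0,1\}^*$ let $M_{\theta,f}$ be the partial ZX measurement on $n$ qubits with projectors $H^{\Phi_1}\big(\sum_{m:f(m_\Phi)=y}|m\rangle\langle m|\big)H^{\Phi_1}$, where $H^{\Phi_1}$ applies Hadamard gates to the qubits in $\Phi_1$. A linear operation $L$ is a sequence of CNOT gates on $n$ qubits. For $x,z\in(\mathbb F_2^{2\lambda+1})^n$ let $(x_L,z_L)$ be obtained by applying, for each CNOT of $L$ in turn, with control $i$ and target $j$, the update $x_j\leftarrow x_i+x_j$, $z_i\leftarrow z_i+z_j$. Coset-state authentication scheme. A key $k=(S,\Delta,x,z)\leftarrow\mathsf{Gen}(1^\lambda,n)$ consists of a uniformly random $\lambda$-dimensional subspace $S\subset\mathbb F_2^{2\lambda+1}$, a uniformly random $\Delta\in\mathbb F_2^{2\lambda+1}\setminus S$, and uniformly random $x,z\in(\mathbb F_2^{2\lambda+1})^n$. Let $S_\Delta=S\cup(S+\Delta)$,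 $\widehat S=S_\Delta^\perp$, and let $\widehat\Delta$ satisfy $S^\perp=\widehat S\cup(\widehat S+\widehat\Delta)$. Encoding is $\mathsf{Enc}_k=X^xZ^zE_{S,\Delta}^{\otimes n}$, where $E_{S,\Delta}|b\rangle=|S|^{-1/2}\sum_{s\in S}|s+b\Delta\rangle$; it maps $n$ qubits to $n$ blocks $\mathcal C=\mathcal C_1\otimes\dots\otimes\mathcal C_n$ of $2\lambda+1$ qubits. $\mathsf{Dec}_{k,L,\theta}$, on input $c=(c_i)_{i\in\Phi}$ with $c_i\in\mathbb F_2^{2\lambda+1}$, sets, for $i\in\Phi_0$, $m_i=0$ if $c_i\in S+x_{L,i}$, $m_i=1$ if $c_i\in S+\Delta+x_{L,i}$, and $m_i=\bot$ otherwise; for $i\in\Phi_1$, $m_i=0$ if $c_i\in\widehat S+z_{L,i}$, $m_i=1$ if $c_i\in\widehat S+\widehat\Delta+z_{L,i}$, and $m_i=\bot$ otherwise. It outputs $\bot$ if some $m_i=\bot$, and $(m_i)_{i\in\Phi}$ otherwise. $\mathsf{Ver}_{k,L,\theta}(c)$ is $\bot$ if $\mathsf{Dec}_{k,L,\theta}(c)=\bot$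 and $\top$ otherwise. $\widetilde M_{\theta,f,k,L}$ is the projective measurement on $\mathcal C$ that measures the blocks in $\Phi_0$ in the standard basis and those in $\Phi_1$ in the Hadamard basis, coherently, and reveals only $f(\mathsf{Dec}_{k,L,\theta}(c))$, or $\bot$ if $\mathsf{Dec}_{k,L,\theta}(c)=\bot$. Theorem. There is a constant $a>0$ such that for every polynomial $q$ there is $\lambda_0$ such that the following holds for all $\lambda\ge\lambda_0$ and all $n$. Let $L$ be a linear operation on $n$ qubits, let $\theta\in\{0,1,\bot\}^n$ and $f:\{0,1\}^{\Phi}\to\{0,1\}^*$, and let $A$ be a computationally unbounded oracle-aided quantum operation from $\mathcal C$ to $\mathcal C$ that makes at most $q(\lambda)$ superposition queries to its oracle $\mathsf{Ver}_{k,\cdot,\cdot}(\cdot)$ (whose input is $(L',\theta',c)$). Then there is $\epsilon\in[0,1]$ such that for every $n$-qubit pure state $|\psi\rangle$, the distribution of $y$ obtained by sampling $k\leftarrow\mathsf{Gen}(1^\lambda,n)$ and $y\leftarrow\widetilde M_{\theta,f,k,L}\circ A^{\mathsf{Ver}_{k,\cdot,\cdot}(\cdot)}\circ\mathsf{Enc}_k(|\psi\rangle)$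 is within total variation distance $2^{-a\lambda}$ (where $\mathsf{TV}(D_0,D_1)=\sum_y|D_0(y)-D_1(y)|$) of $$(1-\epsilon)\,\{y : y\leftarrow M_{\theta,f}\circ L(|\psi\rangle)\}+\epsilon\,\{\bot\}.$$ -/

import Mathlib

open scoped Matrix Kronecker ComplexOrder

noncomputable section

namespace CosetQAS

/-! ### Operators on registers

A register is given by the finite type `α` that labels its standard basis. Vectors are functions
`α → ℂ`, operators are complex matrices, and `[n]` is `Fin n`. Bits are elements of `ZMod 2`. -/

/-- The operator `|a⟩ ↦ |g a⟩` determined by a map of standard basis vectors. -/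
def basisMap {α β : Type*} [DecidableEq β] (g : α → β) : Matrix β α ℂ :=
  Matrix.of fun b a => if b = g a then 1 else 0

/-- The tensor product `⊗ᵢ hᵢ` of a finite family of operators. -/
def tensorMat {ι α β : Type*} [Fintype ι] (h : ι → Matrix α β ℂ) :
    Matrix (ι → α) (ι → β) ℂ :=
  Matrix.of fun a b => ∏ i, h i (a i) (b i)

/-- The sign `(-1)^b` of a bit. -/
def bitSign (b : ZMod 2) : ℂ := if b = 0 then 1 else -1

/-- The one-qubit Hadamard gate `H`. -/
def hadamardGate : Matrix (ZMod 2) (ZMod 2) ℂ :=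
  Matrix.of fun a b => ((1 / Real.sqrt 2 : ℝ) : ℂ) * bitSign (a * b)

/-- `|ψ⟩` is a (normalized) pure state. -/
def IsState {α : Type*} [Fintype α] (ψ : α → ℂ) : Prop := ∑ a, ‖ψ a‖ ^ 2 = 1

/-- The density matrix `|ψ⟩⟨ψ|`. -/
def pureDensity {α : Type*} (ψ : α → ℂ) : Matrix α α ℂ := Matrix.vecMulVec ψ (star ψ)

/-- The partial trace over the second register. -/
def partialTrace {α β : Type*} [Fintype β] (ρ : Matrix (α × β) (α × β) ℂ) : Matrix α α ℂ :=
  Matrix.of fun a a' => ∑ b, ρ (a, b) (a', b)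

/-- A quantum operation (completely positive trace-preserving map) on a register, in Kraus form. -/
structure QuantumOp (α : Type*) [Fintype α] [DecidableEq α] where
  rank : ℕ
  kraus : Fin rank → Matrix α α ℂ
  trace_preserving : ∑ i, (kraus i)ᴴ * kraus i = 1

/-- The action `ρ ↦ ∑ᵢ Kᵢ ρ Kᵢ†` of a quantum operation on density matrices. -/
def QuantumOp.apply {α : Type*} [Fintype α] [DecidableEq α] (F : QuantumOp α)
    (ρ : Matrix α α ℂ) : Matrix α α ℂ :=
  ∑ i, F.kraus i * ρ * (F.kraus i)ᴴ

/-! ### Linear operations and partial ZX measurements -/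

/-- A CNOT gate on `n` qubits. -/
structure CNOT (n : ℕ) where
  control : Fin n
  target : Fin n
  ne : control ≠ target

/-- A linear operation: a sequence of CNOT gates, the head of the list being applied first. -/
abbrev LinOp (n : ℕ) := List (CNOT n)

/-- `m_j ← m_i + m_j`, for the gate with control `i` and target `j`. -/
def CNOT.actX {n : ℕ} {G : Type*} [AddCommGroup G] (g : CNOT n) (m : Fin n → G) : Fin n → G :=
  Function.update m g.target (m g.control + m g.target)

/-- `z_i ← z_i + z_j`, for the gate with control `i` and target `j`. -/
def CNOT.actZ {n : ℕ} {G : Type*} [AddCommGroup G] (g : CNOT n) (z : Fin n → G) : Fin n → G :=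
  Function.update z g.control (z g.control + z g.target)

/-- The action of `L` on labels of standard basis vectors and on the `X`-parts of Pauli keys:
`x ↦ x_L`. -/
def LinOp.actX {n : ℕ} {G : Type*} [AddCommGroup G] (L : LinOp n) (x : Fin n → G) : Fin n → G :=
  L.foldl (fun y g => g.actX y) x

/-- The action of `L` on the `Z`-parts of Pauli keys: `z ↦ z_L`. -/
def LinOp.actZ {n : ℕ} {G : Type*} [AddCommGroup G] (L : LinOp n) (z : Fin n → G) : Fin n → G :=
  L.foldl (fun y g => g.actZ y) z

/-- A choice of bases `θ ∈ {0,1,⊥}ⁿ`: `some 0` is the standard basis, `some 1` is the Hadamard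
basis, and `none` means that the qubit is not measured. -/
abbrev Bases (n : ℕ) := Fin n → Option (ZMod 2)

/-- The index set `Φ = {i : θ_i ≠ ⊥}`. -/
abbrev Phi {n : ℕ} (θ : Bases n) := {i : Fin n // θ i ≠ none}

/-- The substring `m_Φ`. -/
def restrict {n : ℕ} {α : Type*} (θ : Bases n) (m : Fin n → α) : Phi θ → α := fun i => m i

/-- `U` applied to the `i`-th register for each `i ∈ Φ₁`, and the identity elsewhere. -/
def onHadamard {n : ℕ} {α : Type*} [DecidableEq α] (θ : Bases n) (U : Matrix α α ℂ) :
    Matrix (Fin n → α) (Fin n → α) ℂ :=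
  tensorMat fun i => if θ i = some 1 then U else 1

/-- Measurement outcomes: `some y` with `y ∈ {0,1}*`, or `none` for `⊥`. -/
abbrev Outcome := Option (List (ZMod 2))

/-- The projector of `M_{θ,f}` for the outcome `y`; it is zero for `y = ⊥`. -/
def zxProj {n : ℕ} (θ : Bases n) (f : (Phi θ → ZMod 2) → List (ZMod 2)) (y : Outcome) :
    Matrix (Fin n → ZMod 2) (Fin n → ZMod 2) ℂ :=
  onHadamard θ hadamardGate *
    Matrix.diagonal (fun m => if some (f (restrict θ m)) = y then (1 : ℂ) else 0) *
    onHadamard θ hadamardGate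

/-- The probability of `y` in the honest experiment `y ← M_{θ,f} ∘ L(|ψ⟩)`. -/
def honestProb {n : ℕ} (L : LinOp n) (θ : Bases n) (f : (Phi θ → ZMod 2) → List (ZMod 2))
    (ψ : (Fin n → ZMod 2) → ℂ) (y : Outcome) : ℝ :=
  (Matrix.trace (zxProj θ f y * pureDensity (basisMap (LinOp.actX L) *ᵥ ψ))).re

/-! ### The coset-state authentication scheme -/

/-- The space `𝔽₂^{2λ+1}`; it also labels the standard basis of a `(2λ+1)`-qubit register. -/
abbrev Vec (lam : ℕ) := Fin (2 * lam + 1) → ZMod 2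

/-- The standard basis labels of the ciphertext register, `n` blocks of `2λ+1` qubits. -/
abbrev Code (lam n : ℕ) := Fin n → Vec lam

/-- The orthogonal complement of a subspace for the standard bilinear form on `𝔽₂^d`. -/
def perp {d : ℕ} (S : Submodule (ZMod 2) (Fin d → ZMod 2)) :
    Submodule (ZMod 2) (Fin d → ZMod 2) where
  carrier := {v | ∀ s ∈ S, s ⬝ᵥ v = 0}
  zero_mem' := fun s _ => dotProduct_zero s
  add_mem' := fun {a b} ha hb s hs => by rw [dotProduct_add, ha s hs, hb s hs, add_zero]
  smul_mem' := fun r a ha s hs => by rw [dotProduct_smul, ha s hs, smul_zero]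

/-- An authentication key `k = (S, Δ, x, z)`. -/
structure Key (lam n : ℕ) where
  S : Submodule (ZMod 2) (Vec lam)
  finrank_S : Module.finrank (ZMod 2) S = lam
  Δ : Vec lam
  Δ_notMem : Δ ∉ S
  x : Fin n → Vec lam
  z : Fin n → Vec lam

instance (lam n : ℕ) : Finite (Key lam n) :=
  Finite.of_injective (fun k : Key lam n => (k.S, k.Δ, k.x, k.z)) (by
    rintro ⟨S, h, Δ, h', x, z⟩ ⟨S', g, Δ', g', x', z'⟩ e
    simp only [Prod.mk.injEq] at e
    obtain ⟨rfl, rfl, rfl, rfl⟩ := e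
    rfl)

instance (lam n : ℕ) : Fintype (Key lam n) := Fintype.ofFinite _

/-- `S_Δ = S ∪ (S + Δ)`, the subspace spanned by `S` and `Δ`. -/
def Key.SΔ {lam n : ℕ} (k : Key lam n) : Submodule (ZMod 2) (Vec lam) :=
  k.S ⊔ Submodule.span (ZMod 2) {k.Δ}

/-- The dual subspace `Ŝ = S_Δ^⊥`. -/
def Key.Shat {lam n : ℕ} (k : Key lam n) : Submodule (ZMod 2) (Vec lam) := perp k.SΔ

/-- The coset `Ŝ + Δ̂`. The vector `Δ̂` is any vector with `S^⊥ = Ŝ ∪ (Ŝ + Δ̂)`, and the coset is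
`S^⊥ ∖ Ŝ` whichever one is taken. -/
def Key.ShatCoset {lam n : ℕ} (k : Key lam n) : Set (Vec lam) :=
  {v | v ∈ perp k.S ∧ v ∉ k.Shat}

open Classical in
/-- The matrix of `E_{S,Δ}`: `|0⟩ ↦ |S⟩` and `|1⟩ ↦ |S + Δ⟩`. -/
def cosetEnc {lam : ℕ} (S : Submodule (ZMod 2) (Vec lam)) (Δ : Vec lam) :
    Matrix (Vec lam) (ZMod 2) ℂ :=
  Matrix.of fun v b => if v - b • Δ ∈ S then ((1 / Real.sqrt (Nat.card S) : ℝ) : ℂ) else 0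

/-- The Pauli operator `X^x`. -/
def pauliX {lam n : ℕ} (x : Fin n → Vec lam) : Matrix (Code lam n) (Code lam n) ℂ :=
  basisMap fun c => c + x

/-- The Pauli operator `Z^z`. -/
def pauliZ {lam n : ℕ} (z : Fin n → Vec lam) : Matrix (Code lam n) (Code lam n) ℂ :=
  Matrix.diagonal fun c => bitSign (∑ i, z i ⬝ᵥ c i)

/-- `Enc_k = X^x Z^z E_{S,Δ}^{⊗n}`. -/
def enc {lam n : ℕ} (k : Key lam n) : Matrix (Code lam n) (Fin n → ZMod 2) ℂ :=
  pauliX k.x * pauliZ k.z * tensorMat fun _ => cosetEnc k.S k.Δ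

open Classical in
/-- The decoded bit of a block measured in the standard basis with one-time pad `x`. -/
def decStd {lam n : ℕ} (k : Key lam n) (x c : Vec lam) : Option (ZMod 2) :=
  if c - x ∈ k.S then some 0 else if c - x - k.Δ ∈ k.S then some 1 else none

open Classical in
/-- The decoded bit of a block measured in the Hadamard basis with one-time pad `z`. -/
def decHad {lam n : ℕ} (k : Key lam n) (z c : Vec lam) : Option (ZMod 2) :=
  if c - z ∈ k.Shat then some 0 else if c - z ∈ k.ShatCoset then some 1 else none

/-- The decoded bit `m_i`, or `⊥`, of the block `i ∈ Φ`. -/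
def decBlock {lam n : ℕ} (k : Key lam n) (L : LinOp n) (θ : Bases n) (c : Phi θ → Vec lam)
    (i : Phi θ) : Option (ZMod 2) :=
  if θ i = some 0 then decStd k (LinOp.actX L k.x i) (c i)
  else decHad k (LinOp.actZ L k.z i) (c i)

/-- `Dec_{k,L,θ}`, with `none` for `⊥`. -/
def dec {lam n : ℕ} (k : Key lam n) (L : LinOp n) (θ : Bases n) (c : Phi θ → Vec lam) :
    Option (Phi θ → ZMod 2) :=
  if h : ∀ i, (decBlock k L θ c i).isSome then some fun i => (decBlock k L θ c i).get (h i)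
  else none

/-- `Ver_{k,L,θ}`, with `true` for `⊤` and `false` for `⊥`. -/
def ver {lam n : ℕ} (k : Key lam n) (L : LinOp n) (θ : Bases n) (c : Phi θ → Vec lam) : Bool :=
  (dec k L θ c).isSome

/-- The projector of `M̃_{θ,f,k,L}` for the outcome `y`, where the outcome is `⊥` if decoding
fails. -/
def authProj {lam n : ℕ} (k : Key lam n) (L : LinOp n) (θ : Bases n)
    (f : (Phi θ → ZMod 2) → List (ZMod 2)) (y : Outcome) :
    Matrix (Code lam n) (Code lam n) ℂ :=
  onHadamard θ (tensorMat fun _ => hadamardGate) *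
    Matrix.diagonal (fun c => if (dec k L θ (restrict θ c)).map f = y then (1 : ℂ) else 0) *
    onHadamard θ (tensorMat fun _ => hadamardGate)

/-! ### Oracle-aided adversaries and the security experiment -/

/-- An input `(L, θ, c)` of the verification oracle `Ver_{k,·,·}(·)`. -/
structure Query (lam n : ℕ) where
  L : LinOp n
  θ : Bases n
  c : Phi θ → Vec lam

/-- An oracle-aided quantum operation on the ciphertext register. It has auxiliary registers: a
query register, whose standard basis is labelled by an arbitrary finite set of oracle inputs, a
response bit, and a workspace of arbitrary finite dimension. They start in a fixed standard basis
state. It applies `first`, and then, for each entry of `rest` in order, makes one oracle query and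
applies the entry. All quantum operations are arbitrary, and act jointly on all registers. -/
structure Adversary (lam n : ℕ) where
  queries : Finset (Query lam n)
  dim : ℕ
  init : queries × Bool × Fin dim
  first : open Classical in QuantumOp (Code lam n × (queries × Bool × Fin dim))
  rest : open Classical in List (QuantumOp (Code lam n × (queries × Bool × Fin dim)))

namespace Adversary

variable {lam n : ℕ} (A : Adversary lam n)

/-- The standard basis labels of the auxiliary registers. -/
abbrev Aux : Type := A.queries × Bool × Fin A.dim

/-- The number of oracle queries. -/
def numQueries : ℕ := A.rest.length

open Classical in
/-- The oracle unitary `|q⟩|b⟩ ↦ |q⟩|b ⊕ Ver_k(q)⟩`, the identity on the other registers. -/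
def oracle (k : Key lam n) : Matrix (Code lam n × A.Aux) (Code lam n × A.Aux) ℂ :=
  basisMap fun s =>
    (s.1, s.2.1, xor s.2.2.1 (ver k s.2.1.1.L s.2.1.1.θ s.2.1.1.c), s.2.2.2)

open Classical in
/-- The quantum operation `A^{Ver_{k,·,·}(·)}` on the ciphertext register. -/
def run (k : Key lam n) (ρ : Matrix (Code lam n) (Code lam n) ℂ) :
    Matrix (Code lam n) (Code lam n) ℂ :=
  partialTrace (A.rest.foldl (fun τ F => F.apply (A.oracle k * τ * (A.oracle k)ᴴ))
    (A.first.apply (ρ ⊗ₖ pureDensity (Pi.single A.init 1))))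

end Adversary

/-- The probability of `y` in the experiment `k ← Gen(1^λ, n)`,
`y ← M̃_{θ,f,k,L} ∘ A^{Ver_k} ∘ Enc_k(|ψ⟩)`. The key is uniform over all `(S, Δ, x, z)`. -/
def realProb {lam n : ℕ} (L : LinOp n) (θ : Bases n) (f : (Phi θ → ZMod 2) → List (ZMod 2))
    (A : Adversary lam n) (ψ : (Fin n → ZMod 2) → ℂ) (y : Outcome) : ℝ :=
  (∑ k : Key lam n,
    (Matrix.trace (authProj k L θ f y * A.run k (pureDensity (enc k *ᵥ ψ)))).re) /
    Fintype.card (Key lam n)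

/-- The probability of `y` in the mixture `(1-ε) {y : y ← M_{θ,f} ∘ L(|ψ⟩)} + ε {⊥}`. -/
def mixedProb {n : ℕ} (L : LinOp n) (θ : Bases n) (f : (Phi θ → ZMod 2) → List (ZMod 2))
    (ε : ℝ) (ψ : (Fin n → ZMod 2) → ℂ) (y : Outcome) : ℝ :=
  (1 - ε) * honestProb L θ f ψ y + ε * (if y = none then 1 else 0)

/-- The total variation distance `∑_y |D₀(y) - D₁(y)|`. -/
def TV (D₀ D₁ : Outcome → ℝ) : ℝ := ∑' y, |D₀ y - D₁ y|

end CosetQAS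

end

open CosetQAS

noncomputable section

namespace CosetQAS

/-! ### Subspaces of `𝔽₂^d` -/

section LinearAlgebra

variable {d : ℕ}

/-! Reduction to errors. Evaluate `L` and then take the Hadamard transform of the blocks in Φ₁.
CNOTs act transversally on coset states, and the transform of a block exchanges (S, Δ, x, z) with
(Ŝ, Δ̂, z, x) while acting as a logical Hadamard gate. In this frame (`frame_mulVec_enc`) the
encoded state is, up to a phase, the sum over m of ±χ_m X^{X+mD} Z^Z |lo⟩. Here χ is the honest
state in its measurement basis, lo is a product of copies of S and Ŝ, D is the word of shifts Δ and
Δ̂, the pads X, Z are uniform, and the final measurement is in the standard basis.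

The oracle depends on the pads only modulo products of S_Δ and S^⊥. Adding to Z a combination of the
dual shifts is therefore invisible to it, and averaging over these shifts destroys the coherence
between different m. Adding mD to X is invisible as well, and only translates the decoded message
(`sum_pads_eq`). So m follows the honest distribution and decoding returns m + e or ⊥, where the law
of e or ⊥ depends neither on ψ nor on f. With ε the probability of ⊥, the distance is at most twice
the probability that e ≠ 0 (`TV_le`).

Undetected errors. The event e ≠ 0 forces every measured block into S_Δ (or S^⊥) and some block out
of S (or Ŝ). Take S₀ of codimension d in S, and T containing S_Δ with codimension d, and let the
oracle test membership in T and S₀^⊥ instead. (1) The oracles disagree only on a query with a block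
outside S_Δ (or S^⊥) and all blocks inside T (or S₀^⊥). Conditioned on S and S_Δ, which determine
the state of the real run for given pads, the larger spaces are random, so a fixed query does this
with probability O(2^{d-λ}) (`sum_frameOracle_ne_le`). (2) Under the new oracle, averaging over the
pads makes the coset states of S and of S₀ indistinguishable (`sum_hybridProb_eq`), so the output
depends on S₀ and T alone. A block outside S₀ then hits the random S_Δ between S₀ and T with
probability O(2^{-d}), and dually (`sum_isWrong_outProb_le`).

Randomness of the subspaces is expressed by averaging over the general linear group: transvections
move a point of B ∖ A to any other point while fixing each subspace of A and each superspace of B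
(`sum_mem_glMap_le`). No union bound over blocks is needed, because the offending block can be
selected from the known subspaces alone (`sum_event_le`).

The hybrid step (`evolve_le_evolve`) loses a factor (1+t)^q and an additive term without square
roots. With t = 1/(q+1) and d = ⌊λ/2⌋ the total is a polynomial times 2^{-λ/2}, which is eventually
below 2^{-λ/4}. -/

theorem mem_perp {S : Submodule (ZMod 2) (Fin d → ZMod 2)} {v : Fin d → ZMod 2} :
    v ∈ perp S ↔ ∀ s ∈ S, s ⬝ᵥ v = 0 := Iff.rfl

/-- The standard bilinear form on `𝔽₂^d`. -/
def dotForm (d : ℕ) : LinearMap.BilinForm (ZMod 2) (Fin d → ZMod 2) :=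
  dotProductBilin (ZMod 2) (ZMod 2)

theorem dotForm_apply (v w : Fin d → ZMod 2) : dotForm d v w = v ⬝ᵥ w := rfl

theorem perp_eq_orthogonal (S : Submodule (ZMod 2) (Fin d → ZMod 2)) :
    perp S = (dotForm d).orthogonal S := by
  ext v
  simp [mem_perp, LinearMap.BilinForm.mem_orthogonal_iff, dotForm_apply]

theorem dotForm_isSymm : (dotForm d).IsSymm :=
  ⟨fun v w => by simp [dotForm_apply, dotProduct_comm v w]⟩

theorem dotForm_nondegenerate : (dotForm d).Nondegenerate := by
  constructor
  · intro v hv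
    exact dotProduct_eq_zero v fun w => hv w
  · intro v hv
    exact dotProduct_eq_zero v fun w => by rw [dotProduct_comm]; exact hv w

theorem perp_perp (S : Submodule (ZMod 2) (Fin d → ZMod 2)) : perp (perp S) = S := by
  rw [perp_eq_orthogonal, perp_eq_orthogonal]
  exact LinearMap.BilinForm.orthogonal_orthogonal dotForm_nondegenerate
    dotForm_isSymm.isRefl S

theorem finrank_perp (S : Submodule (ZMod 2) (Fin d → ZMod 2)) :
    Module.finrank (ZMod 2) (perp S) = d - Module.finrank (ZMod 2) S := by
  rw [perp_eq_orthogonal, LinearMap.BilinForm.finrank_orthogonal dotForm_nondegenerate]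
  simp

theorem perp_anti {S T : Submodule (ZMod 2) (Fin d → ZMod 2)} (h : S ≤ T) : perp T ≤ perp S :=
  fun _ hv s hs => hv s (h hs)

theorem natCard_submodule (S : Submodule (ZMod 2) (Fin d → ZMod 2)) :
    Nat.card S = 2 ^ Module.finrank (ZMod 2) S := by
  rw [Module.natCard_eq_pow_finrank (K := ZMod 2), Nat.card_zmod]

theorem bit_eq_zero_or_one (b : ZMod 2) : b = 0 ∨ b = 1 := by
  revert b; decide

theorem bit_eq_one_of_ne_zero {b : ZMod 2} (h : b ≠ 0) : b = 1 :=
  (bit_eq_zero_or_one b).resolve_left h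

theorem exists_mem_perp_of_notMem {S : Submodule (ZMod 2) (Fin d → ZMod 2)} {v : Fin d → ZMod 2}
    (h : v ∉ S) : ∃ w ∈ perp S, w ⬝ᵥ v = 1 := by
  rw [← perp_perp S, mem_perp] at h
  push Not at h
  obtain ⟨w, hw, hv⟩ := h
  exact ⟨w, hw, bit_eq_one_of_ne_zero hv⟩

/-- Each vector has its own functional; if neither works for both vectors, their sum does. The
result φ is 1 on both vectors, so it vanishes on their sum and defines a transvection exchanging
them. -/
theorem exists_mem_perp_of_notMem₂ {S : Submodule (ZMod 2) (Fin d → ZMod 2)}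
    {v v' : Fin d → ZMod 2} (h : v ∉ S) (h' : v' ∉ S) :
    ∃ w ∈ perp S, w ⬝ᵥ v = 1 ∧ w ⬝ᵥ v' = 1 := by
  obtain ⟨w, hw, e⟩ := exists_mem_perp_of_notMem h
  obtain ⟨w', hw', e'⟩ := exists_mem_perp_of_notMem h'
  rcases bit_eq_zero_or_one (w ⬝ᵥ v') with h1 | h1
  · rcases bit_eq_zero_or_one (w' ⬝ᵥ v) with h2 | h2
    · exact ⟨w + w', add_mem hw hw', by rw [add_dotProduct, e, h2, add_zero],
        by rw [add_dotProduct, h1, e', zero_add]⟩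
    · exact ⟨w', hw', h2, e'⟩
  · exact ⟨w, hw, e, h1⟩

theorem exists_superspace {S : Submodule (ZMod 2) (Fin d → ZMod 2)} {k : ℕ}
    (h : Module.finrank (ZMod 2) S ≤ k) (hk : k ≤ d) :
    ∃ T : Submodule (ZMod 2) (Fin d → ZMod 2), S ≤ T ∧ Module.finrank (ZMod 2) T = k := by
  induction k, h using Nat.le_induction with
  | base => exact ⟨S, le_rfl, rfl⟩
  | succ k _ ih =>
    obtain ⟨T, hT, e⟩ := ih (by omega)
    have hne : T ≠ ⊤ := by
      rintro rfl
      rw [finrank_top, Module.finrank_fin_fun] at e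
      omega
    obtain ⟨v, hv⟩ : ∃ v, v ∉ T := by
      by_contra! hc
      exact hne (eq_top_iff.2 fun v _ => hc v)
    exact ⟨T ⊔ Submodule.span (ZMod 2) {v}, hT.trans le_sup_left,
      by rw [Submodule.finrank_sup_span_singleton hv, e]⟩

theorem exists_subspace {S : Submodule (ZMod 2) (Fin d → ZMod 2)} {k : ℕ}
    (h : k ≤ Module.finrank (ZMod 2) S) :
    ∃ T : Submodule (ZMod 2) (Fin d → ZMod 2), T ≤ S ∧ Module.finrank (ZMod 2) T = k := by
  have hS : Module.finrank (ZMod 2) S ≤ d := by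
    simpa only [Module.finrank_fin_fun] using Submodule.finrank_le S
  obtain ⟨T, hT, e⟩ := exists_superspace (S := perp S) (k := d - k)
    (by rw [finrank_perp]; omega) (by omega)
  exact ⟨perp T, by simpa [perp_perp] using perp_anti hT, by rw [finrank_perp, e]; omega⟩

/-! ### The action of the general linear group -/

/-- The image of a subspace under an invertible matrix. -/
def glMap (g : GL (Fin d) (ZMod 2)) (S : Submodule (ZMod 2) (Fin d → ZMod 2)) :
    Submodule (ZMod 2) (Fin d → ZMod 2) :=
  S.map (Matrix.mulVecLin (g : Matrix (Fin d) (Fin d) (ZMod 2)))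

theorem inv_mulVec_mulVec (g : GL (Fin d) (ZMod 2)) (v : Fin d → ZMod 2) :
    (g⁻¹).1 *ᵥ (g.1 *ᵥ v) = v := by
  rw [Matrix.mulVec_mulVec, ← Units.val_mul, inv_mul_cancel, Units.val_one, Matrix.one_mulVec]

theorem mulVec_inv_mulVec (g : GL (Fin d) (ZMod 2)) (v : Fin d → ZMod 2) :
    g.1 *ᵥ ((g⁻¹).1 *ᵥ v) = v := by
  simp

theorem mem_glMap {g : GL (Fin d) (ZMod 2)} {S : Submodule (ZMod 2) (Fin d → ZMod 2)}
    {v : Fin d → ZMod 2} : v ∈ glMap g S ↔ (g⁻¹).1 *ᵥ v ∈ S := by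
  constructor
  · rintro ⟨w, hw, rfl⟩
    rw [Matrix.mulVecLin_apply, inv_mulVec_mulVec]
    exact hw
  · intro h
    exact ⟨_, h, mulVec_inv_mulVec g v⟩

theorem glMap_mul (g h : GL (Fin d) (ZMod 2)) (S : Submodule (ZMod 2) (Fin d → ZMod 2)) :
    glMap (g * h) S = glMap g (glMap h S) := by
  ext v
  rw [mem_glMap, mem_glMap, mem_glMap, mul_inv_rev, Units.val_mul, Matrix.mulVec_mulVec]

theorem glMap_mono (g : GL (Fin d) (ZMod 2)) {S T : Submodule (ZMod 2) (Fin d → ZMod 2)}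
    (h : S ≤ T) : glMap g S ≤ glMap g T := Submodule.map_mono h

theorem glMap_sup (g : GL (Fin d) (ZMod 2)) (S T : Submodule (ZMod 2) (Fin d → ZMod 2)) :
    glMap g (S ⊔ T) = glMap g S ⊔ glMap g T := Submodule.map_sup _ _ _

theorem glMap_top (g : GL (Fin d) (ZMod 2)) : glMap g ⊤ = ⊤ :=
  eq_top_iff.2 fun _ _ => mem_glMap.2 trivial

theorem finrank_glMap (g : GL (Fin d) (ZMod 2)) (S : Submodule (ZMod 2) (Fin d → ZMod 2)) :
    Module.finrank (ZMod 2) (glMap g S) = Module.finrank (ZMod 2) S :=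
  (Submodule.equivMapOfInjective _ (fun v w h => by
    rw [← inv_mulVec_mulVec g v, ← inv_mulVec_mulVec g w]
    exact congrArg _ h) S).symm.finrank_eq

/-- The inverse transpose of an invertible matrix. -/
def contragredient : GL (Fin d) (ZMod 2) ≃ GL (Fin d) (ZMod 2) where
  toFun g := ⟨((g⁻¹).1)ᵀ, (g.1)ᵀ,
    by rw [← Matrix.transpose_mul, ← Units.val_mul, mul_inv_cancel, Units.val_one,
      Matrix.transpose_one],
    by rw [← Matrix.transpose_mul, ← Units.val_mul, inv_mul_cancel, Units.val_one,
      Matrix.transpose_one]⟩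
  invFun g := ⟨((g⁻¹).1)ᵀ, (g.1)ᵀ,
    by rw [← Matrix.transpose_mul, ← Units.val_mul, mul_inv_cancel, Units.val_one,
      Matrix.transpose_one],
    by rw [← Matrix.transpose_mul, ← Units.val_mul, inv_mul_cancel, Units.val_one,
      Matrix.transpose_one]⟩
  left_inv g := Units.ext (Matrix.transpose_transpose _)
  right_inv g := Units.ext (Matrix.transpose_transpose _)

theorem contragredient_inv_val (g : GL (Fin d) (ZMod 2)) :
    ((contragredient g)⁻¹).1 = (g.1)ᵀ := rfl

/-- The adjoint of g for the dot product is its transpose. This lets standard and Hadamard blocks,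
which see a subspace and its complement, share one averaging argument. -/
theorem perp_glMap (g : GL (Fin d) (ZMod 2)) (S : Submodule (ZMod 2) (Fin d → ZMod 2)) :
    perp (glMap g S) = glMap (contragredient g) (perp S) := by
  ext v
  rw [mem_glMap, contragredient_inv_val, mem_perp, mem_perp]
  constructor
  · intro h s hs
    rw [Matrix.dotProduct_mulVec, Matrix.vecMul_transpose]
    exact h _ ⟨s, hs, rfl⟩
  · rintro h _ ⟨s, hs, rfl⟩
    have := h s hs
    rwa [Matrix.dotProduct_mulVec, Matrix.vecMul_transpose] at this

/-- The transvection `w ↦ w + (φ ⬝ w) u`, for `φ ⬝ u = 0`. -/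
def transvection (u φ : Fin d → ZMod 2) (h : φ ⬝ᵥ u = 0) : GL (Fin d) (ZMod 2) :=
  have e : (1 + Matrix.vecMulVec u φ) * (1 + Matrix.vecMulVec u φ) = 1 := by
    have h2 : Matrix.vecMulVec u φ * Matrix.vecMulVec u φ = 0 := by
      rw [Matrix.vecMulVec_mul_vecMulVec, h]
      simp
    rw [add_mul, mul_add, mul_add, h2, one_mul, one_mul, mul_one, add_zero, add_assoc,
      ZModModule.add_self, add_zero]
  ⟨1 + Matrix.vecMulVec u φ, 1 + Matrix.vecMulVec u φ, e, e⟩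

theorem transvection_mulVec (u φ : Fin d → ZMod 2) (h : φ ⬝ᵥ u = 0) (w : Fin d → ZMod 2) :
    (transvection u φ h).1 *ᵥ w = w + (φ ⬝ᵥ w) • u := by
  change (1 + Matrix.vecMulVec u φ) *ᵥ w = _
  rw [Matrix.add_mulVec, Matrix.one_mulVec, Matrix.vecMulVec_mulVec]
  simp

theorem transvection_inv (u φ : Fin d → ZMod 2) (h : φ ⬝ᵥ u = 0) :
    (transvection u φ h)⁻¹ = transvection u φ h := rfl

/-- The map moves vectors only along u ∈ B, so it preserves every superspace of B; and φ vanishes on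
A, so it fixes every vector of A. -/
theorem glMap_transvection {u φ : Fin d → ZMod 2} {h : φ ⬝ᵥ u = 0}
    {A B M : Submodule (ZMod 2) (Fin d → ZMod 2)} (hu : u ∈ B) (hφ : φ ∈ perp A)
    (hM : M ≤ A ∨ B ≤ M) : glMap (transvection u φ h) M = M := by
  ext v
  rw [mem_glMap, transvection_inv, transvection_mulVec]
  rcases hM with hM | hM
  · have key : ∀ w ∈ M, w + (φ ⬝ᵥ w) • u = w := fun w hw => by
      rw [dotProduct_comm, hφ w (hM hw), zero_smul, add_zero]
    refine ⟨fun hv => ?_, fun hv => by rw [key v hv]; exact hv⟩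
    have e := key _ hv
    rw [dotProduct_add, dotProduct_smul, h, smul_zero, add_zero, add_assoc,
      ZModModule.add_self, add_zero] at e
    rw [e]
    exact hv
  · exact Submodule.add_mem_iff_left _ (Submodule.smul_mem _ _ (hM hu))

open Classical in
/-- A weight that does not see the position of `C` between `A` and `B` gives a fixed vector
outside `A` at most its fair chance to lie in `C`. -/
theorem sum_mem_glMap_le {A B C M₁ M₂ : Submodule (ZMod 2) (Fin d → ZMod 2)} (hAB : A ≤ B)
    (hM₁ : M₁ ≤ A ∨ B ≤ M₁) (hM₂ : M₂ ≤ A ∨ B ≤ M₂)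
    (w : Submodule (ZMod 2) (Fin d → ZMod 2) → Submodule (ZMod 2) (Fin d → ZMod 2) → ℝ)
    (v : Fin d → ZMod 2) (hw : ∀ P Q, 0 ≤ w P Q)
    (hv : ∀ g, w (glMap g M₁) (glMap g M₂) ≠ 0 → v ∈ glMap g B ∧ v ∉ glMap g A) :
    ((Nat.card B : ℝ) - Nat.card A) *
        ∑ g, (if v ∈ glMap g C then w (glMap g M₁) (glMap g M₂) else 0) ≤
      Nat.card C * ∑ g, w (glMap g M₁) (glMap g M₂) := by
  set W : GL (Fin d) (ZMod 2) → ℝ := fun g => w (glMap g M₁) (glMap g M₂) with hW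
  set N : (Fin d → ZMod 2) → ℝ := fun p => ∑ g, if (g⁻¹).1 *ᵥ v = p then W g else 0 with hN
  set O : Finset (Fin d → ZMod 2) := Finset.univ.filter fun p => p ∈ B ∧ p ∉ A with hO
  -- The substitution g ↦ g h, with h the transvection exchanging p and p', leaves the weight
  -- unchanged because h fixes M₁ and M₂. So the weight is spread evenly over the possible positions
  -- of g⁻¹ v in B ∖ A, and the share in C is at most |C| / |B ∖ A|.
  have hNO : ∀ p ∈ O, ∀ p' ∈ O, N p = N p' := by
    intro p hp p' hp'
    simp only [hO, Finset.mem_filter, Finset.mem_univ, true_and] at hp hp'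
    obtain ⟨φ, hφ, e, e'⟩ := exists_mem_perp_of_notMem₂ hp.2 hp'.2
    have h0 : φ ⬝ᵥ (p + p') = 0 := by rw [dotProduct_add, e, e']; decide
    set h := transvection (p + p') φ h0
    have hu : p + p' ∈ B := add_mem hp.1 hp'.1
    refine Fintype.sum_equiv (Equiv.mulRight h) _ _ fun g => ?_
    have hWg : W (g * h) = W g := by
      simp only [hW, glMap_mul, h, glMap_transvection hu hφ hM₁, glMap_transvection hu hφ hM₂]
    have hsw : ((g * h)⁻¹).1 *ᵥ v = p' ↔ (g⁻¹).1 *ᵥ v = p := by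
      have hpp : h.1 *ᵥ p = p' := by
        rw [transvection_mulVec, e, one_smul, ← add_assoc, ZModModule.add_self, zero_add]
      rw [mul_inv_rev, Units.val_mul, ← Matrix.mulVec_mulVec, ← hpp]
      constructor
      · intro hh
        have := congrArg (fun t => h.1 *ᵥ t) hh
        simp only [mulVec_inv_mulVec] at this
        rw [this]
        have h2 : h.1 *ᵥ (h.1 *ᵥ p) = (h⁻¹).1 *ᵥ (h.1 *ᵥ p) := rfl
        rw [h2, inv_mulVec_mulVec]
      · intro hh
        rw [hh]
        rfl
    simp only [Equiv.coe_mulRight, hsw, hWg]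
  have hsum : ∑ g, W g = ∑ p ∈ O, N p := by
    simp only [hN]
    rw [Finset.sum_comm]
    refine Finset.sum_congr rfl fun g _ => ?_
    rw [Finset.sum_ite_eq]
    split_ifs with h
    · rfl
    · by_contra hne
      obtain ⟨h1, h2⟩ := hv g hne
      rw [mem_glMap] at h1 h2
      exact h (Finset.mem_filter.2 ⟨Finset.mem_univ _, h1, h2⟩)
  have hsumC : ∑ g, (if v ∈ glMap g C then W g else 0) = ∑ p ∈ O.filter (· ∈ C), N p := by
    simp only [hN]
    rw [Finset.sum_comm]
    refine Finset.sum_congr rfl fun g _ => ?_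
    rw [Finset.sum_ite_eq]
    by_cases hg : W g = 0
    · simp [hg]
    · obtain ⟨h1, h2⟩ := hv g hg
      rw [mem_glMap] at h1 h2
      simp only [hO, Finset.mem_filter, Finset.mem_univ, true_and, mem_glMap, h1, h2,
        not_false_eq_true, and_self]
  have hcard : ((Nat.card B : ℝ) - Nat.card A) = O.card := by
    have h1 : Nat.card B = (Finset.univ.filter fun p => p ∈ B).card := by
      rw [Nat.card_eq_fintype_card, Fintype.card_subtype]
    have h2 : Nat.card A = (Finset.univ.filter fun p => p ∈ A).card := by
      rw [Nat.card_eq_fintype_card, Fintype.card_subtype]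
    have h3 : O = (Finset.univ.filter fun p => p ∈ B) \ (Finset.univ.filter fun p => p ∈ A) := by
      ext p; simp [hO]
    rw [h3, Finset.card_sdiff_of_subset (fun p hp => by
      simp only [Finset.mem_filter, Finset.mem_univ, true_and] at hp ⊢; exact hAB hp), ← h1, ← h2,
      Nat.cast_sub]
    exact Nat.card_mono (Set.toFinite _) hAB
  have hcardC : ((O.filter (· ∈ C)).card : ℝ) ≤ Nat.card C := by
    rw [Nat.card_eq_fintype_card, Fintype.card_subtype]
    exact_mod_cast Finset.card_le_card fun p hp => by
      simp only [Finset.mem_filter, Finset.mem_univ, true_and] at hp ⊢; exact hp.2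
  have hW0 : 0 ≤ ∑ g, W g := Finset.sum_nonneg fun g _ => hw _ _
  rw [hsumC, hcard]
  calc (O.card : ℝ) * ∑ p ∈ O.filter (· ∈ C), N p
      = ∑ p ∈ O.filter (· ∈ C), ∑ p' ∈ O, N p' := by
        rw [Finset.mul_sum]
        refine Finset.sum_congr rfl fun p hp => ?_
        rw [Finset.sum_congr rfl fun p' hp' => hNO p' hp' p (Finset.mem_filter.1 hp).1]
        simp
    _ = (O.filter (· ∈ C)).card * ∑ g, W g := by rw [hsum]; simp
    _ ≤ _ := mul_le_mul_of_nonneg_right hcardC hW0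

/-- `M`, or its orthogonal complement. -/
def dualize (t : Bool) (M : Submodule (ZMod 2) (Fin d → ZMod 2)) :
    Submodule (ZMod 2) (Fin d → ZMod 2) := if t then perp M else M

/-- The permutation of the general linear group through which it acts on `dualize t M`. -/
def dualAct (t : Bool) : GL (Fin d) (ZMod 2) ≃ GL (Fin d) (ZMod 2) :=
  if t then contragredient else Equiv.refl _

theorem dualize_glMap (t : Bool) (g : GL (Fin d) (ZMod 2))
    (M : Submodule (ZMod 2) (Fin d → ZMod 2)) :
    dualize t (glMap g M) = glMap (dualAct t g) (dualize t M) := by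
  cases t
  · rfl
  · exact perp_glMap g M

theorem dualize_dualize (t : Bool) (M : Submodule (ZMod 2) (Fin d → ZMod 2)) :
    dualize t (dualize t M) = M := by
  cases t
  · rfl
  · exact perp_perp M

-- The inverse transpose permutes the group, so reindexing by it reduces the dual case to the
-- previous lemma, with the weight precomposed with the orthogonal complement.
open Classical in
theorem sum_mem_dualAct_le (t : Bool) {A B C M₁ M₂ : Submodule (ZMod 2) (Fin d → ZMod 2)}
    (hAB : A ≤ B) (hM₁ : dualize t M₁ ≤ A ∨ B ≤ dualize t M₁)
    (hM₂ : dualize t M₂ ≤ A ∨ B ≤ dualize t M₂)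
    (w : Submodule (ZMod 2) (Fin d → ZMod 2) → Submodule (ZMod 2) (Fin d → ZMod 2) → ℝ)
    (v : Fin d → ZMod 2) (hw : ∀ P Q, 0 ≤ w P Q)
    (hv : ∀ g, w (glMap g M₁) (glMap g M₂) ≠ 0 →
      v ∈ glMap (dualAct t g) B ∧ v ∉ glMap (dualAct t g) A) :
    ((Nat.card B : ℝ) - Nat.card A) *
        ∑ g, (if v ∈ glMap (dualAct t g) C then w (glMap g M₁) (glMap g M₂) else 0) ≤
      Nat.card C * ∑ g, w (glMap g M₁) (glMap g M₂) := by
  have e : ∀ g (M : Submodule (ZMod 2) (Fin d → ZMod 2)),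
      dualize t (glMap (dualAct t g) (dualize t M)) = glMap g M := fun g M => by
    rw [← dualize_glMap, dualize_dualize]
  have h := sum_mem_glMap_le (C := C) hAB hM₁ hM₂ (fun P Q => w (dualize t P) (dualize t Q)) v
    (fun P Q => hw _ _) (fun g hg => by
      obtain ⟨g, rfl⟩ := (dualAct t).surjective g
      rw [e, e] at hg
      exact hv g hg)
  rw [← Equiv.sum_comp (dualAct t) fun g => if v ∈ glMap g C then _ else _,
    ← Equiv.sum_comp (dualAct t) fun g => w _ _] at h
  simpa only [e] using h

open Classical in
/-- The chance that all `vec i` lie in random subspaces `C`, while not all of them lie in the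
known subspaces `A`. -/
theorem sum_event_le {A B C : Bool → Submodule (ZMod 2) (Fin d → ZMod 2)}
    {M₁ M₂ : Submodule (ZMod 2) (Fin d → ZMod 2)} {r : ℝ} (hr : 0 ≤ r)
    (hAB : ∀ t, A t ≤ B t) (hCB : ∀ t, C t ≤ B t)
    (hM₁ : ∀ t, dualize t M₁ ≤ A t ∨ B t ≤ dualize t M₁)
    (hM₂ : ∀ t, dualize t M₂ ≤ A t ∨ B t ≤ dualize t M₂)
    (FA FB : Bool → Submodule (ZMod 2) (Fin d → ZMod 2) → Submodule (ZMod 2) (Fin d → ZMod 2) →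
      Submodule (ZMod 2) (Fin d → ZMod 2))
    (hFA : ∀ t g, FA t (glMap g M₁) (glMap g M₂) = glMap (dualAct t g) (A t))
    (hFB : ∀ t g, FB t (glMap g M₁) (glMap g M₂) = glMap (dualAct t g) (B t))
    (hlt : ∀ t, Nat.card (A t) < Nat.card (B t))
    (hcard : ∀ t, (Nat.card (C t) : ℝ) ≤ r * ((Nat.card (B t) : ℝ) - Nat.card (A t)))
    {I : Type*} [Fintype I] (vec : I → Fin d → ZMod 2) (ty : I → Bool)
    (w : Submodule (ZMod 2) (Fin d → ZMod 2) → Submodule (ZMod 2) (Fin d → ZMod 2) → ℝ)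
    (hw : ∀ P Q, 0 ≤ w P Q) :
    ∑ g, (if (∃ i, vec i ∉ glMap (dualAct (ty i) g) (A (ty i))) ∧
          ∀ i, vec i ∈ glMap (dualAct (ty i) g) (C (ty i))
        then w (glMap g M₁) (glMap g M₂) else 0) ≤
      r * ∑ g, w (glMap g M₁) (glMap g M₂) := by
  -- One vector outside the known subspace is selected as a function of the images of M₁ and M₂
  -- only. The weight restricted to a given choice is still a function of these images, so the bound
  -- applies to each choice. The choices are disjoint, so their weights add up to at most the
  -- original weight and no factor for the number of vectors appears.
  let pick : Submodule (ZMod 2) (Fin d → ZMod 2) → Submodule (ZMod 2) (Fin d → ZMod 2) →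
      Option I := fun P Q =>
    if h : ∃ i, vec i ∉ FA (ty i) P Q then some h.choose else none
  have hpick : ∀ P Q i, pick P Q = some i → vec i ∉ FA (ty i) P Q := by
    intro P Q i h
    simp only [pick] at h
    split_ifs at h with hex
    cases h
    exact hex.choose_spec
  let w' : I → Submodule (ZMod 2) (Fin d → ZMod 2) → Submodule (ZMod 2) (Fin d → ZMod 2) → ℝ :=
    fun i P Q => if pick P Q = some i ∧ vec i ∈ FB (ty i) P Q then w P Q else 0
  have hw' : ∀ i P Q, 0 ≤ w' i P Q := fun i P Q => by
    simp only [w']; split_ifs <;> simp [hw]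
  have hi : ∀ i, ∑ g, (if vec i ∈ glMap (dualAct (ty i) g) (C (ty i))
      then w' i (glMap g M₁) (glMap g M₂) else 0) ≤
      r * ∑ g, w' i (glMap g M₁) (glMap g M₂) := by
    intro i
    have h := sum_mem_dualAct_le (C := C (ty i)) (ty i) (hAB _) (hM₁ _) (hM₂ _) (w' i) (vec i)
      (hw' i) (fun g hg => by
        simp only [w', ne_eq, ite_eq_right_iff, Classical.not_imp] at hg
        rw [← hFA, ← hFB]
        exact ⟨hg.1.2, hpick _ _ _ hg.1.1⟩)
    have hpos : (0 : ℝ) < (Nat.card (B (ty i)) : ℝ) - Nat.card (A (ty i)) := by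
      have : (Nat.card (A (ty i)) : ℝ) < Nat.card (B (ty i)) := by exact_mod_cast hlt (ty i)
      linarith
    refine le_of_mul_le_mul_left (h.trans ?_) hpos
    calc _ ≤ r * ((Nat.card (B (ty i)) : ℝ) - Nat.card (A (ty i))) *
          ∑ g, w' i (glMap g M₁) (glMap g M₂) :=
        mul_le_mul_of_nonneg_right (hcard _) (Finset.sum_nonneg fun g _ => hw' _ _ _)
      _ = _ := by ring
  calc _ ≤ ∑ g, ∑ i, (if vec i ∈ glMap (dualAct (ty i) g) (C (ty i))
          then w' i (glMap g M₁) (glMap g M₂) else 0) := by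
        refine Finset.sum_le_sum fun g _ => ?_
        have hnn : ∀ i ∈ Finset.univ, 0 ≤ (if vec i ∈ glMap (dualAct (ty i) g) (C (ty i))
          then w' i (glMap g M₁) (glMap g M₂) else 0) := fun i _ => by
            split_ifs <;> simp [hw']
        split_ifs with h
        · obtain ⟨hex, hall⟩ := h
          have hex' : ∃ i, vec i ∉ FA (ty i) (glMap g M₁) (glMap g M₂) := by
            simpa only [hFA] using hex
          refine le_trans (le_of_eq ?_)
            (Finset.single_le_sum hnn (Finset.mem_univ hex'.choose))
          have hB := glMap_mono (dualAct (ty hex'.choose) g) (hCB (ty hex'.choose))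
            (hall hex'.choose)
          simp only [hall, if_true, w', hFB, hB, and_true]
          rw [if_pos]
          simp only [pick, dif_pos hex']
        · exact Finset.sum_nonneg hnn
    _ ≤ ∑ i, r * ∑ g, w' i (glMap g M₁) (glMap g M₂) := by
        rw [Finset.sum_comm]
        exact Finset.sum_le_sum fun i _ => hi i
    _ = r * ∑ g, ∑ i, w' i (glMap g M₁) (glMap g M₂) := by
        rw [← Finset.mul_sum, Finset.sum_comm]
    _ ≤ _ := by
        refine mul_le_mul_of_nonneg_left (Finset.sum_le_sum fun g _ => ?_) hr
        calc _ ≤ ∑ i, if pick (glMap g M₁) (glMap g M₂) = some i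
              then w (glMap g M₁) (glMap g M₂) else 0 := by
              refine Finset.sum_le_sum fun i _ => ?_
              simp only [w']
              split_ifs <;> simp_all
          _ ≤ _ := by
              cases pick (glMap g M₁) (glMap g M₂) with
              | none => simp [hw]
              | some j => simp

end LinearAlgebra

/-! ### Quantum operations with oracle calls -/

section Evolution

variable {α β : Type*}

theorem re_diag_nonneg {ρ : Matrix α α ℂ} (h : ρ.PosSemidef) (a : α) : 0 ≤ (ρ a a).re :=
  (Complex.le_def.1 h.diag_nonneg).1

variable [Fintype α]

/-- Conjugation `ρ ↦ A ρ A†`. -/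
def conjLin (A : Matrix β α ℂ) : Matrix α α ℂ →ₗ[ℂ] Matrix β β ℂ where
  toFun ρ := A * ρ * Aᴴ
  map_add' ρ σ := by rw [Matrix.mul_add, Matrix.add_mul]
  map_smul' c ρ := by rw [Matrix.mul_smul, Matrix.smul_mul, RingHom.id_apply]

theorem conjLin_apply (A : Matrix β α ℂ) (ρ : Matrix α α ℂ) : conjLin A ρ = A * ρ * Aᴴ := rfl

variable [Fintype β]

theorem conjLin_posSemidef (A : Matrix β α ℂ) {ρ : Matrix α α ℂ} (h : ρ.PosSemidef) :
    (conjLin A ρ).PosSemidef := h.mul_mul_conjTranspose_same A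

theorem trace_conjLin [DecidableEq α] {A : Matrix β α ℂ} (hA : Aᴴ * A = 1) (ρ : Matrix α α ℂ) :
    (conjLin A ρ).trace = ρ.trace := by
  rw [conjLin_apply, Matrix.trace_mul_comm, ← Matrix.mul_assoc, hA, Matrix.one_mul]

theorem re_trace_nonneg {ρ : Matrix α α ℂ} (h : ρ.PosSemidef) : 0 ≤ ρ.trace.re :=
  (Complex.le_def.1 h.trace_nonneg).1

/-- `(A + B) ρ (A + B)† ≤ (1 + t) A ρ A† + (1 + 1/t) B ρ B†` for positive `ρ`. -/
theorem conjLin_add_le (A B : Matrix β α ℂ) {ρ : Matrix α α ℂ} (h : ρ.PosSemidef) {t : ℝ}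
    (ht : 0 < t) : (((1 + t : ℝ) : ℂ) • conjLin A ρ + ((1 + 1 / t : ℝ) : ℂ) • conjLin B ρ -
      conjLin (A + B) ρ).PosSemidef := by
  have hs : (Real.sqrt t : ℂ) * Real.sqrt t = t := by
    rw [← Complex.ofReal_mul, Real.mul_self_sqrt ht.le]
  have hs0 : (Real.sqrt t : ℂ) ≠ 0 := by
    exact_mod_cast (Real.sqrt_pos.2 ht).ne'
  have ht0 : (t : ℂ) ≠ 0 := by exact_mod_cast ht.ne'
  -- The claimed difference is exactly the conjugation of ρ by √t A − B/√t: its cross terms cancel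
  -- those of A + B.
  have key := conjLin_posSemidef ((Real.sqrt t : ℂ) • A - (Real.sqrt t : ℂ)⁻¹ • B) h
  convert key using 1
  simp only [conjLin_apply, Matrix.conjTranspose_sub, Matrix.conjTranspose_add,
    Matrix.conjTranspose_smul, Matrix.sub_mul, Matrix.mul_sub, Matrix.add_mul, Matrix.mul_add,
    Matrix.smul_mul, Matrix.mul_smul, star_inv₀, Complex.star_def, Complex.conj_ofReal, smul_sub, smul_smul]
  rw [hs, mul_inv_cancel₀ hs0, inv_mul_cancel₀ hs0, ← mul_inv, hs]
  push_cast
  rw [one_div]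
  module

variable [DecidableEq α]

/-- A quantum operation as a linear map. -/
def QuantumOp.lin (F : QuantumOp α) : Matrix α α ℂ →ₗ[ℂ] Matrix α α ℂ :=
  ∑ i, conjLin (F.kraus i)

theorem QuantumOp.lin_apply (F : QuantumOp α) (ρ : Matrix α α ℂ) : F.lin ρ = F.apply ρ := by
  simp [QuantumOp.lin, QuantumOp.apply, conjLin_apply, LinearMap.sum_apply]

theorem QuantumOp.lin_posSemidef (F : QuantumOp α) {ρ : Matrix α α ℂ} (h : ρ.PosSemidef) :
    (F.lin ρ).PosSemidef := by
  rw [QuantumOp.lin, LinearMap.sum_apply]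
  exact Matrix.posSemidef_sum _ fun i _ => conjLin_posSemidef _ h

theorem QuantumOp.trace_lin (F : QuantumOp α) (ρ : Matrix α α ℂ) :
    (F.lin ρ).trace = ρ.trace := by
  rw [QuantumOp.lin, LinearMap.sum_apply, Matrix.trace_sum]
  calc ∑ i, (conjLin (F.kraus i) ρ).trace = ∑ i, ((F.kraus i)ᴴ * F.kraus i * ρ).trace :=
        Finset.sum_congr rfl fun i _ => by
          rw [conjLin_apply, Matrix.trace_mul_comm, ← Matrix.mul_assoc]
    _ = ρ.trace := by
        rw [← Matrix.trace_sum, ← Finset.sum_mul, F.trace_preserving, Matrix.one_mul]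

/-- The evolution under a list of quantum operations, each preceded by a call of `O`. -/
def evolve (O : Matrix α α ℂ) : List (QuantumOp α) → Matrix α α ℂ →ₗ[ℂ] Matrix α α ℂ
  | [] => LinearMap.id
  | F :: ops => evolve O ops ∘ₗ F.lin ∘ₗ conjLin O

theorem evolve_cons (O : Matrix α α ℂ) (F : QuantumOp α) (ops : List (QuantumOp α))
    (ρ : Matrix α α ℂ) : evolve O (F :: ops) ρ = evolve O ops (F.lin (conjLin O ρ)) := rfl

theorem evolve_eq_foldl (O : Matrix α α ℂ) (ops : List (QuantumOp α)) (ρ : Matrix α α ℂ) :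
    evolve O ops ρ = ops.foldl (fun τ F => F.apply (O * τ * Oᴴ)) ρ := by
  induction ops generalizing ρ with
  | nil => rfl
  | cons F ops ih => rw [evolve_cons, ih, List.foldl_cons, QuantumOp.lin_apply, conjLin_apply]

theorem evolve_posSemidef (O : Matrix α α ℂ) (ops : List (QuantumOp α)) {ρ : Matrix α α ℂ}
    (h : ρ.PosSemidef) : (evolve O ops ρ).PosSemidef := by
  induction ops generalizing ρ with
  | nil => exact h
  | cons F ops ih => exact ih (F.lin_posSemidef (conjLin_posSemidef O h))

theorem trace_evolve {O : Matrix α α ℂ} (hO : Oᴴ * O = 1) (ops : List (QuantumOp α))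
    (ρ : Matrix α α ℂ) : (evolve O ops ρ).trace = ρ.trace := by
  induction ops generalizing ρ with
  | nil => rfl
  | cons F ops ih => rw [evolve_cons, ih, QuantumOp.trace_lin, trace_conjLin hO]

/-- A hybrid argument: replacing the oracle `O` by `O'` in all calls. -/
theorem evolve_le_evolve {O O' : Matrix α α ℂ} (hO' : O'ᴴ * O' = 1) {t : ℝ} (ht : 0 < t)
    (Λ : Matrix α α ℂ →ₗ[ℂ] ℂ) (hΛ : ∀ ρ : Matrix α α ℂ, ρ.PosSemidef → 0 ≤ (Λ ρ).re)
    (hΛ' : ∀ ρ : Matrix α α ℂ, ρ.PosSemidef → (Λ ρ).re ≤ ρ.trace.re)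
    (ops : List (QuantumOp α)) {ρ : Matrix α α ℂ} (h : ρ.PosSemidef) :
    (Λ (evolve O ops ρ)).re ≤ (1 + t) ^ ops.length * (Λ (evolve O' ops ρ)).re +
      (1 + t) ^ ops.length * (1 + 1 / t) * ∑ j ∈ Finset.range ops.length,
        (conjLin (O - O') (evolve O (ops.take j) ρ)).trace.re := by
  induction ops generalizing ρ with
  | nil => simp [evolve]
  | cons F ops ih =>
    have h1 := ih (F.lin_posSemidef (conjLin_posSemidef O h))
    -- Only the first call is split, as O = O' + (O − O'); the induction hypothesis is applied to
    -- the state after a genuine call of O. Hence every error term is measured on a state of the run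
    -- with O. The part O − O' is followed by trace-preserving steps, so it contributes at most its
    -- trace.
    have hd := conjLin_add_le O' (O - O') h ht
    rw [add_sub_cancel] at hd
    have h2 := hΛ _ (evolve_posSemidef O' ops (F.lin_posSemidef hd))
    simp only [map_add, map_sub, map_smul, Complex.sub_re, Complex.add_re, smul_eq_mul,
      Complex.re_ofReal_mul] at h2
    have h3 := hΛ' _ (evolve_posSemidef O' ops
      (F.lin_posSemidef (conjLin_posSemidef (O - O') h)))
    rw [trace_evolve hO', QuantumOp.trace_lin] at h3
    have ht' : 0 < 1 + 1 / t := by positivity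
    have hp : 1 ≤ (1 + t) ^ ops.length := one_le_pow₀ (by linarith)
    have hd0 := re_trace_nonneg (conjLin_posSemidef (O - O') h)
    have hs0 : 0 ≤ ∑ j ∈ Finset.range ops.length,
        (conjLin (O - O') (evolve O (ops.take j) (F.lin (conjLin O ρ)))).trace.re :=
      Finset.sum_nonneg fun j _ => re_trace_nonneg (conjLin_posSemidef _
        (evolve_posSemidef _ _ (F.lin_posSemidef (conjLin_posSemidef O h))))
    rw [List.length_cons, Finset.sum_range_succ', pow_succ]
    simp only [List.take_succ_cons, List.take_zero, evolve_cons]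
    change _ ≤ _ + _ * (_ + (conjLin (O - O') ρ).trace.re)
    generalize ∑ j ∈ Finset.range ops.length,
        (conjLin (O - O') (evolve O (ops.take j) (F.lin (conjLin O ρ)))).trace.re = s at *
    generalize (conjLin (O - O') ρ).trace.re = e at *
    generalize (1 + t) ^ ops.length = p at *
    generalize (Λ (evolve O ops (F.lin (conjLin O ρ)))).re = a0 at *
    generalize (Λ (evolve O' ops (F.lin (conjLin O ρ)))).re = a1 at *
    generalize (Λ (evolve O' ops (F.lin (conjLin O' ρ)))).re = a2 at *
    generalize (Λ (evolve O' ops (F.lin (conjLin (O - O') ρ)))).re = a3 at *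
    generalize 1 + 1 / t = u at *
    have h4 : a1 ≤ (1 + t) * a2 + u * e := by
      have := mul_le_mul_of_nonneg_left h3 ht'.le
      linarith
    have hp0 : 0 ≤ p := by linarith
    have h5 := mul_le_mul_of_nonneg_left h4 hp0
    -- Slack: the error terms need only the factor p, but the uniform statement charges them (1 + t)
    -- p.
    have h6 : 0 ≤ t * (p * u * (s + e)) := by positivity
    linarith

end Evolution

/-! ### Basis maps, tensor products and partial traces -/

section Basics

theorem basisMap_mulVec {α β : Type*} [Fintype α] [DecidableEq β] (g : α ≃ β) (ψ : α → ℂ)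
    (b : β) : (basisMap g *ᵥ ψ) b = ψ (g.symm b) := by
  have h : ∀ a, (b = g a) = (g.symm b = a) := fun a => propext (g.symm_apply_eq.symm)
  classical
  simp [Matrix.mulVec, dotProduct, basisMap, h]

theorem basisMap_isometry {α β : Type*} [Fintype β] [DecidableEq α] [DecidableEq β] {g : α → β}
    (hg : Function.Injective g) : (basisMap g)ᴴ * basisMap g = 1 := by
  ext a a'
  simp only [Matrix.mul_apply, Matrix.conjTranspose_apply, basisMap, Matrix.of_apply,
    Matrix.one_apply]
  rw [Finset.sum_eq_single (g a')]
  · by_cases h : a = a'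
    · simp [h]
    · simp [h, eq_comm (a := g a'), hg.eq_iff]
  · intro b _ hb
    simp [hb]
  · simp

theorem tensorMat_mul {ι α β γ : Type*} [Fintype ι] [DecidableEq ι] [Fintype β]
    (A : ι → Matrix α β ℂ) (B : ι → Matrix β γ ℂ) :
    tensorMat A * tensorMat B = tensorMat fun i => A i * B i := by
  ext a c
  simp only [tensorMat, Matrix.mul_apply, Matrix.of_apply, Finset.prod_univ_sum,
    Fintype.piFinset_univ, Finset.prod_mul_distrib]

theorem tensorMat_conjTranspose {ι α β : Type*} [Fintype ι] (A : ι → Matrix α β ℂ) :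
    (tensorMat A)ᴴ = tensorMat fun i => (A i)ᴴ := by
  ext a b
  simp [tensorMat, Matrix.conjTranspose_apply]

theorem tensorMat_one {ι α : Type*} [Fintype ι] [DecidableEq α] :
    (tensorMat fun _ : ι => (1 : Matrix α α ℂ)) = 1 := by
  ext a b
  simp only [tensorMat, Matrix.of_apply, Matrix.one_apply]
  by_cases h : a = b
  · simp [h]
  · obtain ⟨i, hi⟩ := Function.ne_iff.1 h
    rw [if_neg h]
    exact Finset.prod_eq_zero (Finset.mem_univ i) (if_neg hi)

theorem bitSign_mul_self (b : ZMod 2) : bitSign b * bitSign b = 1 := by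
  unfold bitSign; split_ifs <;> simp

theorem bitSign_add (a b : ZMod 2) : bitSign (a + b) = bitSign a * bitSign b := by
  rcases bit_eq_zero_or_one a with rfl | rfl <;> rcases bit_eq_zero_or_one b with rfl | rfl <;>
    simp [bitSign, show (1 : ZMod 2) + 1 = 0 from rfl]

theorem star_bitSign (b : ZMod 2) : star (bitSign b) = bitSign b := by
  unfold bitSign; split_ifs <;> simp

theorem bitSign_zero : bitSign 0 = 1 := by simp [bitSign]

theorem bitSign_one : bitSign 1 = -1 := by simp [bitSign]

theorem bitSign_sum {ι : Type*} (s : Finset ι) (f : ι → ZMod 2) :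
    bitSign (∑ i ∈ s, f i) = ∏ i ∈ s, bitSign (f i) := by
  classical
  induction s using Finset.induction_on with
  | empty => simp [bitSign_zero]
  | insert i s hi ih => rw [Finset.sum_insert hi, Finset.prod_insert hi, bitSign_add, ih]

theorem sum_bits {M : Type*} [AddCommMonoid M] (f : ZMod 2 → M) : ∑ b, f b = f 0 + f 1 :=
  Fin.sum_univ_two f

theorem hadamardGate_conjTranspose : hadamardGateᴴ = hadamardGate := by
  ext a b
  simp only [hadamardGate, Matrix.conjTranspose_apply, Matrix.of_apply, star_mul', star_bitSign,
    Complex.star_def, Complex.conj_ofReal, mul_comm b a]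

theorem inv_sqrt_two_mul_self : ((1 / Real.sqrt 2 : ℝ) : ℂ) * ((1 / Real.sqrt 2 : ℝ) : ℂ) =
    1 / 2 := by
  rw [← Complex.ofReal_mul, div_mul_div_comm, Real.mul_self_sqrt (by norm_num)]
  norm_num

theorem hadamardGate_mul_self : hadamardGate * hadamardGate = 1 := by
  ext a b
  simp only [Matrix.mul_apply, hadamardGate, Matrix.of_apply, sum_bits]
  have e := inv_sqrt_two_mul_self
  generalize ((1 / Real.sqrt 2 : ℝ) : ℂ) = c at e
  rcases bit_eq_zero_or_one a with rfl | rfl <;> rcases bit_eq_zero_or_one b with rfl | rfl <;>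
    simp only [mul_zero, mul_one, bitSign_zero, bitSign_one, Matrix.one_apply,
      if_true, reduceIte, zero_ne_one, one_ne_zero]
  · linear_combination 2 * e
  · ring
  · ring
  · linear_combination 2 * e

theorem onHadamard_conjTranspose {n : ℕ} {α : Type*} [DecidableEq α] (θ : Bases n)
    {U : Matrix α α ℂ} (hU : Uᴴ = U) : (onHadamard θ U)ᴴ = onHadamard θ U := by
  rw [onHadamard, tensorMat_conjTranspose]
  congr 1
  funext i
  split_ifs <;> simp [hU]

theorem onHadamard_mul_self {n : ℕ} {α : Type*} [Fintype α] [DecidableEq α] (θ : Bases n)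
    {U : Matrix α α ℂ} (hU : U * U = 1) : onHadamard θ U * onHadamard θ U = 1 := by
  rw [onHadamard, tensorMat_mul, ← tensorMat_one]
  congr 1
  funext i
  split_ifs <;> simp [hU]

/-- The partial trace as a linear map. -/
def partialTraceLin (α β : Type*) [Fintype β] : Matrix (α × β) (α × β) ℂ →ₗ[ℂ] Matrix α α ℂ where
  toFun := partialTrace
  map_add' ρ σ := by ext; simp [partialTrace, Finset.sum_add_distrib]
  map_smul' c ρ := by ext; simp [partialTrace, Finset.mul_sum]

variable {α β : Type*}

theorem pureDensity_smul {c : ℂ} (hc : c * star c = 1) (ψ : α → ℂ) :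
    pureDensity (c • ψ) = pureDensity ψ := by
  ext a b
  simp only [pureDensity, Matrix.vecMulVec_apply, Pi.smul_apply, Pi.star_apply, smul_eq_mul,
    star_mul']
  linear_combination (ψ a * star (ψ b)) * hc

theorem partialTrace_posSemidef [Fintype β] {ρ : Matrix (α × β) (α × β) ℂ} (h : ρ.PosSemidef) :
    (partialTraceLin α β ρ).PosSemidef := by
  have e : partialTraceLin α β ρ = ∑ b, ρ.submatrix (fun a => (a, b)) (fun a => (a, b)) := by
    ext a a'
    simp [partialTraceLin, partialTrace, Matrix.sum_apply]
  rw [e]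
  exact Matrix.posSemidef_sum _ fun b _ => h.submatrix _

/-- Adjoining a second register in the state `σ`. -/
def adjoinLin (α : Type*) {β : Type*} (σ : Matrix β β ℂ) :
    Matrix α α ℂ →ₗ[ℂ] Matrix (α × β) (α × β) ℂ where
  toFun ρ := ρ ⊗ₖ σ
  map_add' _ _ := Matrix.add_kronecker _ _ _
  map_smul' _ _ := Matrix.smul_kronecker _ _ _

variable [Fintype α]

theorem conjLin_pureDensity (A : Matrix β α ℂ) (ψ : α → ℂ) :
    conjLin A (pureDensity ψ) = pureDensity (A *ᵥ ψ) := by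
  rw [conjLin_apply, pureDensity, pureDensity, Matrix.mul_vecMulVec, Matrix.vecMulVec_mul,
    Matrix.star_mulVec]

theorem pureDensity_posSemidef (ψ : α → ℂ) : (pureDensity ψ).PosSemidef :=
  Matrix.posSemidef_vecMulVec_self_star ψ

theorem trace_pureDensity (ψ : α → ℂ) :
    (pureDensity ψ).trace = ((∑ a, ‖ψ a‖ ^ 2 : ℝ) : ℂ) := by
  rw [Matrix.trace, Complex.ofReal_sum]
  refine Finset.sum_congr rfl fun a _ => ?_
  rw [Matrix.diag_apply, pureDensity, Matrix.vecMulVec_apply, Pi.star_apply, Complex.star_def,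
    Complex.mul_conj, Complex.normSq_eq_norm_sq]

theorem trace_partialTrace [Fintype β] (ρ : Matrix (α × β) (α × β) ℂ) :
    (partialTraceLin α β ρ).trace = ρ.trace := by
  simp [partialTraceLin, partialTrace, Matrix.trace, Fintype.sum_prod_type]

end Basics

/-! ### Linear operations -/

section Linear

variable {n : ℕ} {G : Type*} [AddCommGroup G]

/-- The gate with control and target exchanged. -/
def CNOT.swap (g : CNOT n) : CNOT n := ⟨g.target, g.control, g.ne.symm⟩

/-- On Z-parts control and target trade roles, so facts about `actX` transfer to `actZ`. -/
theorem CNOT.actZ_eq (g : CNOT n) (z : Fin n → G) : g.actZ z = g.swap.actX z := by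
  simp only [CNOT.actZ, CNOT.actX, CNOT.swap, add_comm]

/-- The linear operation whose action on `X`-parts is the action of `L` on `Z`-parts. -/
def LinOp.dual (L : LinOp n) : LinOp n := L.map CNOT.swap

theorem LinOp.actZ_eq (L : LinOp n) (z : Fin n → G) : LinOp.actZ L z = LinOp.actX L.dual z := by
  induction L generalizing z with
  | nil => rfl
  | cons g L ih =>
    exact (ih (g.actZ z)).trans (congrArg (LinOp.actX (LinOp.dual L)) (g.actZ_eq z))

theorem LinOp.actX_add (L : LinOp n) (x y : Fin n → G) :
    LinOp.actX L (x + y) = LinOp.actX L x + LinOp.actX L y := by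
  induction L generalizing x y with
  | nil => rfl
  | cons g L ih =>
    have h : g.actX (x + y) = g.actX x + g.actX y := by
      funext i
      by_cases hi : i = g.target
      · subst hi
        simp only [CNOT.actX, Function.update_self, Pi.add_apply]
        abel
      · simp [CNOT.actX, Function.update_of_ne hi]
    exact (congrArg _ h).trans (ih _ _)

theorem LinOp.actX_neg (L : LinOp n) (x : Fin n → G) :
    LinOp.actX L (-x) = -LinOp.actX L x := by
  have h0 : LinOp.actX L (0 : Fin n → G) = 0 := by
    have := LinOp.actX_add L (0 : Fin n → G) 0
    simpa using this
  rw [eq_neg_iff_add_eq_zero, ← LinOp.actX_add, neg_add_cancel, h0]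

theorem LinOp.actX_sub (L : LinOp n) (x y : Fin n → G) :
    LinOp.actX L (x - y) = LinOp.actX L x - LinOp.actX L y := by
  rw [sub_eq_add_neg, LinOp.actX_add, LinOp.actX_neg, ← sub_eq_add_neg]

variable [Module (ZMod 2) G]

theorem CNOT.actX_actX (g : CNOT n) (x : Fin n → G) : g.actX (g.actX x) = x := by
  funext i
  by_cases hi : i = g.target
  · subst hi
    simp [CNOT.actX, Function.update_of_ne g.ne, ← add_assoc, ZModModule.add_self]
  · simp [CNOT.actX, Function.update_of_ne hi]

theorem LinOp.actX_reverse_actX (L : LinOp n) (x : Fin n → G) :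
    LinOp.actX L.reverse (LinOp.actX L x) = x := by
  induction L generalizing x with
  | nil => rfl
  | cons g L ih =>
    have h : LinOp.actX (g :: L) x = LinOp.actX L (g.actX x) := rfl
    have h' : ∀ y : Fin n → G, LinOp.actX (L.reverse ++ [g]) y =
        g.actX (LinOp.actX L.reverse y) := fun y => by
      simp only [LinOp.actX, List.foldl_append, List.foldl_cons, List.foldl_nil]
    rw [List.reverse_cons, h, h', ih, CNOT.actX_actX]

/-- The action of a linear operation on `X`-parts as a permutation. -/
def LinOp.equivX (L : LinOp n) (G : Type*) [AddCommGroup G] [Module (ZMod 2) G] :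
    (Fin n → G) ≃ (Fin n → G) where
  toFun := LinOp.actX L
  invFun := LinOp.actX L.reverse
  left_inv x := LinOp.actX_reverse_actX L x
  right_inv x := by simpa using LinOp.actX_reverse_actX L.reverse x

theorem LinOp.actX_mem (L : LinOp n) {P : Submodule (ZMod 2) G} {x : Fin n → G}
    (h : ∀ i, x i ∈ P) (i : Fin n) : LinOp.actX L x i ∈ P := by
  induction L generalizing x with
  | nil => exact h i
  | cons g L ih =>
    refine ih (x := g.actX x) fun j => ?_
    by_cases hj : j = g.target
    · subst hj
      simpa [CNOT.actX] using P.add_mem (h _) (h _)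
    · simpa [CNOT.actX, Function.update_of_ne hj] using h j

theorem LinOp.actX_mem_iff (L : LinOp n) {P : Submodule (ZMod 2) G} {x : Fin n → G} :
    (∀ i, LinOp.actX L x i ∈ P) ↔ ∀ i, x i ∈ P := by
  refine ⟨fun h i => ?_, fun h => L.actX_mem h⟩
  have := LinOp.actX_mem L.reverse h i
  rwa [LinOp.actX_reverse_actX] at this

theorem LinOp.actX_smul (L : LinOp n) (m : Fin n → ZMod 2) (v : G) :
    LinOp.actX L (fun i => m i • v) = fun i => LinOp.actX L m i • v := by
  induction L generalizing m with
  | nil => rfl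
  | cons g L ih =>
    refine Eq.trans (congrArg (LinOp.actX L) ?_) (ih (g.actX m))
    funext i
    by_cases hi : i = g.target
    · subst hi
      simp [CNOT.actX, add_smul]
    · simp [CNOT.actX, Function.update_of_ne hi]

/-- The two actions are inverse transposes of each other: a gate adds the same cross term at its
control and at its target, and the two cancel in characteristic 2. This makes the Z-phase compatible
with `L`. -/
theorem LinOp.sum_actZ_dotProduct_actX {ι : Type*} [Fintype ι] (L : LinOp n)
    (z w : Fin n → ι → ZMod 2) :
    ∑ i, LinOp.actZ L z i ⬝ᵥ LinOp.actX L w i = ∑ i, z i ⬝ᵥ w i := by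
  induction L generalizing z w with
  | nil => rfl
  | cons g L ih =>
    refine (ih (g.actZ z) (g.actX w)).trans ?_
    have hz : ∀ i, g.actZ z i = z i + if i = g.control then z g.target else 0 := fun i => by
      by_cases hi : i = g.control
      · subst hi; simp [CNOT.actZ]
      · simp [CNOT.actZ, hi]
    have hw : ∀ i, g.actX w i = w i + if i = g.target then w g.control else 0 := fun i => by
      by_cases hi : i = g.target
      · subst hi; simp [CNOT.actX, add_comm]
      · simp [CNOT.actX, hi]
    have hd : ∀ i, g.actZ z i ⬝ᵥ g.actX w i = z i ⬝ᵥ w i +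
        ((if i = g.target then z g.target ⬝ᵥ w g.control else 0) +
          if i = g.control then z g.target ⬝ᵥ w g.control else 0) := fun i => by
      rw [hz, hw]
      by_cases h1 : i = g.control
      · subst h1
        simp [g.ne, add_dotProduct]
      · by_cases h2 : i = g.target
        · subst h2
          simp [h1, dotProduct_add]
        · simp [h1, h2]
    rw [Finset.sum_congr rfl fun i _ => hd i, Finset.sum_add_distrib, Finset.sum_add_distrib,
      Finset.sum_ite_eq', Finset.sum_ite_eq']
    simp [CharTwo.add_self_eq_zero]

end Linear

/-! ### Coset states -/

section Coset

-- Orthogonality of characters: translating by an element of W on which φ is 1 negates the sum.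
open Classical in
theorem sum_bitSign_submodule {E : Type*} [AddCommGroup E] [Module (ZMod 2) E] [Fintype E]
    (W : Submodule (ZMod 2) E) (φ : E →+ ZMod 2) :
    ∑ s, (if s ∈ W then bitSign (φ s) else 0) =
      if ∀ s ∈ W, φ s = 0 then (Nat.card W : ℂ) else 0 := by
  split_ifs with h
  · rw [Nat.card_eq_fintype_card, Fintype.card_subtype, Finset.card_filter, Nat.cast_sum]
    refine Finset.sum_congr rfl fun s _ => ?_
    split_ifs with hs
    · rw [h s hs, bitSign_zero, Nat.cast_one]
    · rw [Nat.cast_zero]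
  · push Not at h
    obtain ⟨r, hr, hφ⟩ := h
    have hφ1 := bit_eq_one_of_ne_zero hφ
    have e : ∑ s, (if s ∈ W then bitSign (φ s) else 0) =
        ∑ s, -(if s ∈ W then bitSign (φ s) else 0) := by
      refine Fintype.sum_equiv (Equiv.addRight r) _ _ fun s => ?_
      simp only [Equiv.coe_addRight, W.add_mem_iff_left hr, map_add, bitSign_add, hφ1, bitSign_one]
      split_ifs <;> ring
    rw [Finset.sum_neg_distrib] at e
    exact self_eq_neg.1 e

variable {lam n : ℕ}

/-- `Z^z X^x` applied to the encoding of bits by the cosets of `S` and `S + Δ`. -/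
def blockEnc (S : Submodule (ZMod 2) (Vec lam)) (Δ x z : Vec lam) :
    Matrix (Vec lam) (ZMod 2) ℂ :=
  Matrix.of fun v b => bitSign (z ⬝ᵥ (v - x)) * cosetEnc S Δ (v - x) b

theorem tensorMat_hadamardGate_apply (w v : Vec lam) :
    tensorMat (fun _ => hadamardGate) w v =
      ((1 / Real.sqrt 2 : ℝ) : ℂ) ^ (2 * lam + 1) * bitSign (w ⬝ᵥ v) := by
  simp only [tensorMat, hadamardGate, Matrix.of_apply, Finset.prod_mul_distrib, Finset.prod_const,
    Finset.card_univ, Fintype.card_fin, dotProduct, bitSign_sum]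

/-- Among vectors of S^⊥, the coset of S_Δ^⊥ is read off from the pairing with Δ. So Δ' plays the
part of Δ̂, and the decoded Hadamard bit is Δ ⬝ y. -/
theorem sub_smul_mem_perp_iff {S : Submodule (ZMod 2) (Vec lam)} {Δ Δ' : Vec lam}
    (hΔ' : Δ' ∈ perp S) (h1 : Δ ⬝ᵥ Δ' = 1) (y : Vec lam) (b : ZMod 2) :
    y - b • Δ' ∈ perp (S ⊔ Submodule.span (ZMod 2) {Δ}) ↔ y ∈ perp S ∧ Δ ⬝ᵥ y = b := by
  have hmem : ∀ v : Vec lam, v ∈ perp (S ⊔ Submodule.span (ZMod 2) {Δ}) ↔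
      v ∈ perp S ∧ Δ ⬝ᵥ v = 0 := by
    intro v
    constructor
    · intro h
      exact ⟨perp_anti le_sup_left h, h _ (Submodule.mem_sup_right
        (Submodule.mem_span_singleton_self Δ))⟩
    · rintro ⟨h, h'⟩ s hs
      obtain ⟨t, ht, u, hu, rfl⟩ := Submodule.mem_sup.1 hs
      obtain ⟨a, rfl⟩ := Submodule.mem_span_singleton.1 hu
      rw [add_dotProduct, smul_dotProduct, h t ht, h', smul_zero, add_zero]
  rw [hmem, Submodule.sub_mem_iff_left _ (Submodule.smul_mem _ _ hΔ'), dotProduct_sub,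
    dotProduct_smul, h1, sub_eq_zero, smul_eq_mul, mul_one]

/-- Summing characters over S restricts the transform to S^⊥, and the shift bΔ leaves the sign
(-1)^{b(Δ⬝y)}. Since Δ ⬝ y is the bit encoded by the dual code, that sign is the logical Hadamard
gate. The pads trade places at the cost of a global sign. -/
theorem hadamard_mul_blockEnc {S : Submodule (ZMod 2) (Vec lam)} {Δ Δ' : Vec lam}
    (hS : Module.finrank (ZMod 2) S = lam) (hΔ : Δ ∉ S)
    (hΔ' : Δ' ∈ perp S) (h1 : Δ ⬝ᵥ Δ' = 1) (x z : Vec lam) :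
    (tensorMat (fun _ => hadamardGate) : Matrix (Vec lam) (Vec lam) ℂ) * blockEnc S Δ x z = bitSign (x ⬝ᵥ z) •
      (blockEnc (perp (S ⊔ Submodule.span (ZMod 2) {Δ})) Δ' z x * hadamardGate) := by
  classical
  have hcard : Nat.card S = 2 ^ lam := by rw [natCard_submodule, hS]
  have hcard' : Nat.card (perp (S ⊔ Submodule.span (ZMod 2) {Δ})) = 2 ^ lam := by
    rw [natCard_submodule, finrank_perp, Submodule.finrank_sup_span_singleton hΔ, hS]
    congr 1
    omega
  ext w b
  set y := w - z with hy
  have hyw : y = w + z := by rw [hy, ZModModule.sub_eq_add]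
  have hl : ((tensorMat (fun _ => hadamardGate) : Matrix (Vec lam) (Vec lam) ℂ) * blockEnc S Δ x z) w b =
      ((1 / Real.sqrt 2 : ℝ) : ℂ) ^ (2 * lam + 1) * ((1 / Real.sqrt (2 ^ lam : ℕ) : ℝ) : ℂ) *
        (bitSign (w ⬝ᵥ x) * bitSign (b * (Δ ⬝ᵥ y))) * if y ∈ perp S then ((2 ^ lam : ℕ) : ℂ)
          else 0 := by
    have hchar := sum_bitSign_submodule S
      (φ := { toFun := fun s => s ⬝ᵥ y, map_zero' := zero_dotProduct y,
              map_add' := fun a b => add_dotProduct a b y })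
    rw [hcard] at hchar
    simp only [AddMonoidHom.coe_mk, ZeroHom.coe_mk] at hchar
    simp only [← mem_perp] at hchar
    rw [← hchar, Finset.mul_sum, Matrix.mul_apply]
    -- Translating by x + bΔ turns the sum over the coset into a character sum over S.
    refine Fintype.sum_equiv (Equiv.subRight (x + b • Δ)) _ _ fun v => ?_
    rw [tensorMat_hadamardGate_apply]
    simp only [blockEnc, cosetEnc, Matrix.of_apply, hcard, Equiv.subRight_apply, ← sub_sub]
    split_ifs with hv
    · have e : bitSign (w ⬝ᵥ v) * bitSign (z ⬝ᵥ (v - x)) =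
          bitSign (w ⬝ᵥ x) * bitSign (b * (Δ ⬝ᵥ y)) * bitSign ((v - x - b • Δ) ⬝ᵥ y) := by
        rw [← bitSign_add, ← bitSign_add, ← bitSign_add]
        congr 1
        rw [hyw, sub_dotProduct, smul_dotProduct, smul_eq_mul, sub_dotProduct]
        simp only [dotProduct_add, dotProduct_sub, dotProduct_comm _ w, dotProduct_comm _ z]
        ring
      linear_combination (((1 / Real.sqrt 2 : ℝ) : ℂ) ^ (2 * lam + 1) *
        ((1 / Real.sqrt (2 ^ lam : ℕ) : ℝ) : ℂ)) * e
    · ring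
  have hr : (bitSign (x ⬝ᵥ z) •
      (blockEnc (perp (S ⊔ Submodule.span (ZMod 2) {Δ})) Δ' z x * hadamardGate)) w b =
      if y ∈ perp S then bitSign (x ⬝ᵥ z) * (bitSign (x ⬝ᵥ y) *
        ((1 / Real.sqrt (2 ^ lam : ℕ) : ℝ) : ℂ) *
          (((1 / Real.sqrt 2 : ℝ) : ℂ) * bitSign ((Δ ⬝ᵥ y) * b))) else 0 := by
    rw [Matrix.smul_apply, Matrix.mul_apply]
    simp only [blockEnc, cosetEnc, Matrix.of_apply, hcard', sub_smul_mem_perp_iff hΔ' h1,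
      hadamardGate, ← hy]
    split_ifs with hv
    · rw [Finset.sum_eq_single (Δ ⬝ᵥ y)]
      · simp [hv]
      · intro b' _ hb'
        simp [hb'.symm]
      · simp
    · simp [hv]
  rw [hl, hr]
  split_ifs with hv
  -- In dimension 2λ + 1 both S and Ŝ have 2^λ elements, so the normalizations of the two codes
  -- agree, and what remains of the transform is the 1/√2 of a single Hadamard gate.
  · have e : ((1 / Real.sqrt 2 : ℝ) : ℂ) ^ (2 * lam + 1) * ((2 ^ lam : ℕ) : ℂ) =
        ((1 / Real.sqrt 2 : ℝ) : ℂ) := by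
      rw [pow_succ, pow_mul, pow_two, inv_sqrt_two_mul_self]
      push_cast
      rw [mul_right_comm, ← mul_pow]
      norm_num
    have e' : bitSign (w ⬝ᵥ x) = bitSign (x ⬝ᵥ z) * bitSign (x ⬝ᵥ y) := by
      rw [← bitSign_add, hyw, dotProduct_add, dotProduct_comm w x]
      congr 1
      have := CharTwo.add_self_eq_zero (x ⬝ᵥ z)
      linear_combination -this
    rw [e', mul_comm b]
    linear_combination (((1 / Real.sqrt (2 ^ lam : ℕ) : ℝ) : ℂ) *
      (bitSign (x ⬝ᵥ z) * bitSign (x ⬝ᵥ y) * bitSign ((Δ ⬝ᵥ y) * b))) * e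
  · ring

end Coset

/-! ### The encoding in the frame of the measurement -/

section Frame

variable {lam n : ℕ}

/-- The Hadamard transform of the blocks that are measured in the Hadamard basis. -/
def hadamardBlocks (lam : ℕ) (θ : Bases n) : Matrix (Code lam n) (Code lam n) ℂ :=
  onHadamard θ (tensorMat fun _ => hadamardGate)

/-- `Y i` on the blocks measured in the Hadamard basis, and `X i` on the others. -/
def blend {α : Type*} (θ : Bases n) (X Y : Fin n → α) : Fin n → α :=
  fun i => if θ i = some 1 then Y i else X i

theorem blend_blend {α : Type*} (θ : Bases n) (X Y : Fin n → α) :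
    blend θ (blend θ X Y) (blend θ Y X) = X := by
  funext i
  simp only [blend]
  split_ifs <;> rfl

/-- The words whose blocks lie in `Q` for the Hadamard basis, and in `P` otherwise. -/
def frame (θ : Bases n) (P Q : Submodule (ZMod 2) (Vec lam)) : Submodule (ZMod 2) (Code lam n) :=
  Submodule.pi Set.univ fun i => if θ i = some 1 then Q else P

theorem mem_frame {θ : Bases n} {P Q : Submodule (ZMod 2) (Vec lam)} {c : Code lam n} :
    c ∈ frame θ P Q ↔ ∀ i, c i ∈ if θ i = some 1 then Q else P := by
  simp [frame, Submodule.mem_pi]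

theorem frame_mono {θ : Bases n} {P Q P' Q' : Submodule (ZMod 2) (Vec lam)} (h : P ≤ P')
    (h' : Q ≤ Q') : frame θ P Q ≤ frame θ P' Q' := by
  intro c hc
  rw [mem_frame] at hc ⊢
  intro i
  have := hc i
  split_ifs at this ⊢
  · exact h' this
  · exact h this

theorem natCard_frame {θ : Bases n} {P Q : Submodule (ZMod 2) (Vec lam)} {k : ℕ}
    (hP : Nat.card P = k) (hQ : Nat.card Q = k) : Nat.card (frame θ P Q) = k ^ n := by
  have e : frame θ P Q ≃ ∀ i : Fin n,
      (if θ i = some 1 then Q else P : Submodule (ZMod 2) (Vec lam)) :=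
    { toFun := fun c i => ⟨c.1 i, mem_frame.1 c.2 i⟩
      invFun := fun c => ⟨fun i => (c i).1, mem_frame.2 fun i => (c i).2⟩
      left_inv := fun _ => rfl
      right_inv := fun _ => rfl }
  rw [Nat.card_congr e, Nat.card_pi, Finset.prod_congr rfl (g := fun _ => k), Finset.prod_const,
    Finset.card_univ, Fintype.card_fin]
  intro i _
  split_ifs
  · exact hQ
  · exact hP

/-- The pairing `∑ᵢ zᵢ ⬝ cᵢ` of words. -/
def pair (z c : Code lam n) : ZMod 2 := ∑ i, z i ⬝ᵥ c i

theorem pair_add (z c c' : Code lam n) : pair z (c + c') = pair z c + pair z c' := by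
  simp [pair, dotProduct_add, Finset.sum_add_distrib]

theorem pair_sub (z c c' : Code lam n) : pair z (c - c') = pair z c - pair z c' := by
  simp [pair, dotProduct_sub, Finset.sum_sub_distrib]

theorem add_pair (z z' c : Code lam n) : pair (z + z') c = pair z c + pair z' c := by
  simp [pair, add_dotProduct, Finset.sum_add_distrib]

theorem zero_pair (c : Code lam n) : pair 0 c = 0 := by simp [pair]

open Classical in
/-- The state `X^X Z^Z |W⟩`. -/
def cosetVec (W : Submodule (ZMod 2) (Code lam n)) (X Z : Code lam n) : Code lam n → ℂ := fun c =>
  if c - X ∈ W then ((1 / Real.sqrt (Nat.card W) : ℝ) : ℂ) * bitSign (pair Z (c - X)) else 0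

/-- The word with blocks `mᵢ Dᵢ`. -/
def bitsSmul (m : Fin n → ZMod 2) (D : Code lam n) : Code lam n := fun i => m i • D i

theorem enc_mulVec (k : Key lam n) (ψ : (Fin n → ZMod 2) → ℂ) (c : Code lam n) :
    (enc k *ᵥ ψ) c =
      ∑ m, bitSign (pair k.z (c - k.x)) * (∏ i, cosetEnc k.S k.Δ (c i - k.x i) (m i)) * ψ m := by
  have hX : pauliX k.x = basisMap (Equiv.addRight k.x) := rfl
  have hE : enc k = pauliX k.x * (pauliZ k.z *
      (tensorMat (fun _ => cosetEnc k.S k.Δ) : Matrix (Code lam n) (Fin n → ZMod 2) ℂ)) :=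
    Matrix.mul_assoc (pauliX k.x) (pauliZ k.z)
      (tensorMat (fun _ => cosetEnc k.S k.Δ) : Matrix (Code lam n) (Fin n → ZMod 2) ℂ)
  rw [hE, ← Matrix.mulVec_mulVec, ← Matrix.mulVec_mulVec, hX, basisMap_mulVec,
    pauliZ, Matrix.mulVec_diagonal]
  simp only [Matrix.mulVec, dotProduct, Equiv.addRight_symm, Equiv.coe_addRight, tensorMat,
    Matrix.of_apply, Finset.mul_sum, ← sub_eq_add_neg, mul_assoc]
  rfl

open Classical in
theorem prod_cosetEnc (S : Submodule (ZMod 2) (Vec lam)) (Δ : Vec lam) (w : Code lam n)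
    (m : Fin n → ZMod 2) : ∏ i, cosetEnc S Δ (w i) (m i) =
      if ∀ i, (w - fun i => m i • Δ) i ∈ S then ((1 / Real.sqrt (Nat.card S) : ℝ) : ℂ) ^ n
        else 0 := by
  split_ifs with h
  · have e : ∀ i ∈ Finset.univ, cosetEnc S Δ (w i) (m i) =
        ((1 / Real.sqrt (Nat.card S) : ℝ) : ℂ) := fun i _ => if_pos (h i)
    rw [Finset.prod_congr rfl e, Finset.prod_const, Finset.card_univ, Fintype.card_fin]
  · push Not at h
    obtain ⟨i, hi⟩ := h
    exact Finset.prod_eq_zero (Finset.mem_univ i) (if_neg hi)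

/-- The CNOTs are transversal: L preserves Sⁿ, carries the word of shifts mᵢΔ to the one for L m,
and preserves the pairing that defines the phase. So L on the blocks is L on the message with the
updated pads. -/
theorem actX_mulVec_enc (k : Key lam n) (L : LinOp n) (ψ : (Fin n → ZMod 2) → ℂ) :
    basisMap (LinOp.actX L) *ᵥ (enc k *ᵥ ψ) =
      tensorMat (fun i => blockEnc k.S k.Δ (LinOp.actX L k.x i) (LinOp.actZ L k.z i)) *ᵥ
        (basisMap (LinOp.actX L) *ᵥ ψ) := by
  have hC : (basisMap (LinOp.actX L) : Matrix (Code lam n) (Code lam n) ℂ) =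
      basisMap (L.equivX (Vec lam)) := rfl
  have hB : (basisMap (LinOp.actX L) : Matrix (Fin n → ZMod 2) (Fin n → ZMod 2) ℂ) =
      basisMap (L.equivX (ZMod 2)) := rfl
  funext c
  obtain ⟨c, rfl⟩ := (L.equivX (Vec lam)).surjective c
  rw [hC, basisMap_mulVec, Equiv.symm_apply_apply, enc_mulVec, hB, Matrix.mulVec, dotProduct]
  refine Fintype.sum_equiv (L.equivX (ZMod 2)) _ _ fun m => ?_
  rw [basisMap_mulVec, Equiv.symm_apply_apply]
  congr 1
  simp only [tensorMat, blockEnc, Matrix.of_apply, Finset.prod_mul_distrib]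
  have hsub : ∀ i, L.equivX (Vec lam) c i - LinOp.actX L k.x i = LinOp.actX L (c - k.x) i :=
    fun i => by rw [LinOp.actX_sub]; rfl
  congr 1
  · simp only [hsub, ← bitSign_sum, LinOp.sum_actZ_dotProduct_actX]
    rfl
  · simp only [hsub]
    rw [prod_cosetEnc k.S k.Δ (LinOp.actX L (c - k.x))]
    refine (prod_cosetEnc k.S k.Δ (c - k.x) m).trans ?_
    have e : (LinOp.actX L (c - k.x) - fun i => L.equivX (ZMod 2) m i • k.Δ) =
        LinOp.actX L ((c - k.x) - fun i => m i • k.Δ) := by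
      rw [LinOp.actX_sub L (c - k.x), LinOp.actX_smul]
      rfl
    have e' : (∀ i, (c - k.x - fun i => m i • k.Δ) i ∈ k.S) ↔
        ∀ i, (LinOp.actX L (c - k.x) - fun i => L.equivX (ZMod 2) m i • k.Δ) i ∈ k.S := by
      rw [e]
      exact (LinOp.actX_mem_iff L).symm
    classical
    exact if_congr e' rfl rfl

theorem sqrt_pow_eq {x : ℝ} (hx : 0 ≤ x) (k : ℕ) : Real.sqrt (x ^ k) = Real.sqrt x ^ k := by
  rw [← Real.sqrt_sq (pow_nonneg (Real.sqrt_nonneg x) k), ← pow_mul, mul_comm, pow_mul,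
    Real.sq_sqrt hx]

-- A basis message m only translates the coset state by mD. The extra sign appears because
-- `cosetVec` measures its phase from the translated base point; it matters because it is what
-- averaging over Z randomizes.
open Classical in
theorem tensorMat_blockEnc_apply (θ : Bases n) {P Q : Submodule (ZMod 2) (Vec lam)}
    (h : Nat.card P = Nat.card Q) (D X Z c : Code lam n) (m : Fin n → ZMod 2) :
    tensorMat (fun i => blockEnc (if θ i = some 1 then Q else P) (D i) (X i) (Z i)) c m =
      bitSign (pair Z (bitsSmul m D)) * cosetVec (frame θ P Q) (X + bitsSmul m D) Z c := by
  have e : ∑ i, Z i ⬝ᵥ (c i - X i) = pair Z (c - X) := rfl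
  rw [cosetVec, natCard_frame (θ := θ) h rfl]
  simp only [tensorMat, blockEnc, Matrix.of_apply, Finset.prod_mul_distrib, ← bitSign_sum,
    ← sub_sub, mem_frame]
  rw [e]
  split_ifs with hm
  · have hp : ∀ i ∈ Finset.univ, cosetEnc (if θ i = some 1 then Q else P) (D i) (c i - X i) (m i) =
        ((1 / Real.sqrt (Nat.card Q) : ℝ) : ℂ) := fun i _ => by
      refine (if_pos (hm i)).trans ?_
      split_ifs
      · rfl
      · rw [h]
    have hb : bitSign (pair Z (c - X - bitsSmul m D)) =
        bitSign (pair Z (c - X)) * bitSign (pair Z (bitsSmul m D)) := by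
      rw [pair_sub, ZModModule.sub_eq_add, bitSign_add]
    rw [Finset.prod_congr rfl hp, Finset.prod_const, Finset.card_univ, Fintype.card_fin, hb]
    have hs : ((1 / Real.sqrt ((Nat.card Q ^ n : ℕ) : ℝ) : ℝ) : ℂ) =
        ((1 / Real.sqrt (Nat.card Q) : ℝ) : ℂ) ^ n := by
      rw [← Complex.ofReal_pow, one_div_pow, Nat.cast_pow, sqrt_pow_eq (Nat.cast_nonneg _)]
    rw [hs]
    linear_combination -(bitSign (pair Z (c - X)) *
      ((1 / Real.sqrt (Nat.card Q) : ℝ) : ℂ) ^ n) * bitSign_mul_self (pair Z (bitsSmul m D))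
  · push Not at hm
    obtain ⟨i, hi⟩ := hm
    rw [Finset.prod_eq_zero (Finset.mem_univ i) (if_neg hi)]
    ring

theorem Key.finrank_Shat (k : Key lam n) : Module.finrank (ZMod 2) k.Shat = lam := by
  rw [Key.Shat, finrank_perp, Key.SΔ, Submodule.finrank_sup_span_singleton k.Δ_notMem, k.finrank_S]
  omega

/-- The encoded state, after `L` and the Hadamard transform of the blocks in `Φ₁`. -/
theorem frame_mulVec_enc (k : Key lam n) (L : LinOp n) (θ : Bases n) {Δ' : Vec lam}
    (hΔ' : Δ' ∈ perp k.S) (h1 : k.Δ ⬝ᵥ Δ' = 1) (ψ : (Fin n → ZMod 2) → ℂ)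
    {X Z D : Code lam n} (hX : X = blend θ (LinOp.actX L k.x) (LinOp.actZ L k.z))
    (hZ : Z = blend θ (LinOp.actZ L k.z) (LinOp.actX L k.x))
    (hD : D = blend θ (fun _ => k.Δ) fun _ => Δ') :
    ∃ u : ℂ, u * star u = 1 ∧
      hadamardBlocks lam θ *ᵥ (basisMap (LinOp.actX L) *ᵥ (enc k *ᵥ ψ)) =
        u • ∑ m, ((onHadamard θ hadamardGate *ᵥ (basisMap (LinOp.actX L) *ᵥ ψ)) m *
          bitSign (pair Z (bitsSmul m D))) •
            cosetVec (frame θ k.S k.Shat) (X + bitsSmul m D) Z := by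
  -- The signs from exchanging the pads in Hadamard blocks. Their product is a global phase that
  -- disappears from the density matrix.
  set s : Fin n → ℂ := fun i => if θ i = some 1 then bitSign (X i ⬝ᵥ Z i) else 1 with hs
  have hblock : ∀ i, (if θ i = some 1 then (tensorMat fun _ => hadamardGate) else 1 :
        Matrix (Vec lam) (Vec lam) ℂ) *
        blockEnc k.S k.Δ (LinOp.actX L k.x i) (LinOp.actZ L k.z i) =
      s i • (blockEnc (if θ i = some 1 then k.Shat else k.S) (D i) (X i) (Z i) *
        (if θ i = some 1 then hadamardGate else 1)) := by
    intro i
    simp only [hs, hX, hZ, hD, blend]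
    split_ifs with hi
    · rw [hadamard_mul_blockEnc k.finrank_S k.Δ_notMem hΔ' h1, dotProduct_comm]
      rfl
    · rw [Matrix.one_mul, Matrix.mul_one, one_smul]
  have hmat : hadamardBlocks lam θ * tensorMat
        (fun i => blockEnc k.S k.Δ (LinOp.actX L k.x i) (LinOp.actZ L k.z i)) =
      (∏ i, s i) • (tensorMat (fun i => blockEnc (if θ i = some 1 then k.Shat else k.S)
        (D i) (X i) (Z i)) * onHadamard θ hadamardGate) := by
    rw [hadamardBlocks, onHadamard, onHadamard, tensorMat_mul, tensorMat_mul]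
    simp only [hblock]
    ext a b
    simp [tensorMat, Finset.prod_mul_distrib]
  refine ⟨∏ i, s i, ?_, ?_⟩
  · rw [star_prod, ← Finset.prod_mul_distrib]
    refine Finset.prod_eq_one fun i _ => ?_
    simp only [hs]
    split_ifs
    · rw [star_bitSign, bitSign_mul_self]
    · simp
  · rw [actX_mulVec_enc, Matrix.mulVec_mulVec, hmat, Matrix.smul_mulVec, ← Matrix.mulVec_mulVec]
    congr 1
    funext c
    rw [Matrix.mulVec, dotProduct, Finset.sum_apply]
    refine Finset.sum_congr rfl fun m _ => ?_
    rw [tensorMat_blockEnc_apply θ (by rw [natCard_submodule, natCard_submodule, k.finrank_S,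
      k.finrank_Shat]), Pi.smul_apply, smul_eq_mul]
    ring

end Frame

/-! ### The verification oracle in terms of subspaces -/

section Oracle

variable {lam n : ℕ}

open Classical in
/-- The oracle that accepts if the blocks of the query, without the pads, lie in `P` for the
standard basis and in `Q` for the Hadamard basis. -/
def verSub (P Q : Submodule (ZMod 2) (Vec lam)) (x z : Code lam n) (q : Query lam n) : Bool :=
  decide (∀ i : Phi q.θ,
    q.c i - (if q.θ i = some 0 then LinOp.actX q.L x i else LinOp.actZ q.L z i) ∈
      if q.θ i = some 0 then P else Q)

theorem sub_mem_congr {P : Submodule (ZMod 2) (Vec lam)} {x x' : Vec lam} (h : x - x' ∈ P)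
    (c : Vec lam) : c - x ∈ P ↔ c - x' ∈ P := by
  rw [show c - x' = (c - x) + (x - x') by abel]
  exact (P.add_mem_iff_left h).symm

/-- For any L' in a query, L' maps words over P to words over P, so changing a pad by such a word
does not affect membership of any block. Hence even adaptively chosen linear operations reveal
nothing about the pads within these cosets. -/
theorem verSub_congr {P Q : Submodule (ZMod 2) (Vec lam)} {x z x' z' : Code lam n}
    (hx : ∀ i, (x - x') i ∈ P) (hz : ∀ i, (z - z') i ∈ Q) :
    verSub P Q x z = verSub P Q x' z' := by
  funext q
  simp only [verSub, decide_eq_decide, LinOp.actZ_eq]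
  refine forall_congr' fun i => ?_
  split_ifs
  · have h := LinOp.actX_mem q.L hx i
    rw [LinOp.actX_sub, Pi.sub_apply] at h
    exact sub_mem_congr h _
  · have h := LinOp.actX_mem q.L.dual hz i
    rw [LinOp.actX_sub, Pi.sub_apply] at h
    exact sub_mem_congr h _

theorem Key.Shat_le (k : Key lam n) : k.Shat ≤ perp k.S := perp_anti le_sup_left

theorem Key.S_le (k : Key lam n) : k.S ≤ k.SΔ := le_sup_left

theorem Key.Δ_mem (k : Key lam n) : k.Δ ∈ k.SΔ :=
  Submodule.mem_sup_right (Submodule.mem_span_singleton_self _)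

theorem Key.sub_Δ_mem_iff (k : Key lam n) {v : Vec lam} (hv : v ∉ k.S) :
    v - k.Δ ∈ k.S ↔ v ∈ k.SΔ := by
  constructor
  · intro h
    have := add_mem (k.S_le h) k.Δ_mem
    rwa [sub_add_cancel] at this
  · intro h
    obtain ⟨s, hs, u, hu, rfl⟩ := Submodule.mem_sup.1 h
    obtain ⟨a, rfl⟩ := Submodule.mem_span_singleton.1 hu
    rcases bit_eq_zero_or_one a with rfl | rfl
    · rw [zero_smul, add_zero] at hv
      exact absurd hs hv
    · rwa [one_smul, add_sub_cancel_right]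

open Classical in
theorem decStd_eq (k : Key lam n) (x c : Vec lam) :
    decStd k x c = if c - x ∈ k.SΔ then some (if c - x ∈ k.S then 0 else 1) else none := by
  unfold decStd
  by_cases h : c - x ∈ k.S
  · simp [h, k.S_le h]
  · simp [h, k.sub_Δ_mem_iff h]

open Classical in
theorem decHad_eq (k : Key lam n) (z c : Vec lam) :
    decHad k z c = if c - z ∈ perp k.S then some (if c - z ∈ k.Shat then 0 else 1) else none := by
  unfold decHad
  by_cases h : c - z ∈ k.Shat
  · simp [h, k.Shat_le h]
  · simp [h, Key.ShatCoset]

/-- A block decodes exactly when it lies in the union of the cosets for 0 and 1, which is S_Δ in the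
standard basis and S^⊥ in the Hadamard basis, up to the pad. -/
theorem ver_eq_verSub (k : Key lam n) (q : Query lam n) :
    ver k q.L q.θ q.c = verSub k.SΔ (perp k.S) k.x k.z q := by
  rw [Bool.eq_iff_iff, ver, dec]
  simp only [verSub, decide_eq_true_eq]
  have h : ∀ i : Phi q.θ, (decBlock k q.L q.θ q.c i).isSome = true ↔
      q.c i - (if q.θ i = some 0 then LinOp.actX q.L k.x i else LinOp.actZ q.L k.z i) ∈
        if q.θ i = some 0 then k.SΔ else perp k.S := by
    intro i
    unfold decBlock
    split_ifs with h0
    · rw [decStd_eq]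
      split_ifs <;> simp_all
    · rw [decHad_eq]
      split_ifs <;> simp_all
  by_cases h' : ∀ i, (decBlock k q.L q.θ q.c i).isSome = true
  · simpa only [dif_pos h', Option.isSome_some, true_iff, h] using h'
  · simpa only [dif_neg h', Option.isSome_none, Bool.false_eq_true, false_iff, h] using h'

open Classical in
/-- Decoding in frame coordinates: `w` is the received word without the pad, block `i` encodes `0`
in `lo i` and `1` in `hi i ∖ lo i`. -/
def frameDec (θ : Bases n) (lo hi : Fin n → Submodule (ZMod 2) (Vec lam)) (w : Code lam n) :
    Option (Phi θ → ZMod 2) :=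
  if ∀ i : Phi θ, w i ∈ hi i then some fun i => if w i ∈ lo i then 0 else 1 else none

theorem dec_eq_frameDec (k : Key lam n) (L : LinOp n) (θ : Bases n) (c : Code lam n) :
    dec k L θ (restrict θ c) =
      frameDec θ (fun i => if θ i = some 1 then k.Shat else k.S)
        (fun i => if θ i = some 1 then perp k.S else k.SΔ)
        (c - blend θ (LinOp.actX L k.x) (LinOp.actZ L k.z)) := by
  classical
  have h : ∀ i : Phi θ, decBlock k L θ (restrict θ c) i =
      if (c - blend θ (LinOp.actX L k.x) (LinOp.actZ L k.z)) i ∈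
          (if θ i = some 1 then perp k.S else k.SΔ) then
        some (if (c - blend θ (LinOp.actX L k.x) (LinOp.actZ L k.z)) i ∈
          (if θ i = some 1 then k.Shat else k.S) then 0 else 1) else none := by
    rintro ⟨i, hi⟩
    obtain ⟨b, hb⟩ := Option.ne_none_iff_exists'.1 hi
    rcases bit_eq_zero_or_one b with rfl | rfl
    · have h1 : θ i ≠ some 1 := by rw [hb]; simp
      simp only [decBlock, hb, if_true, blend, Pi.sub_apply, restrict, decStd_eq,
        Option.some.injEq, zero_ne_one, if_false]
    · simp only [decBlock, hb, if_true, blend, Pi.sub_apply, restrict, decHad_eq,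
        Option.some.injEq, one_ne_zero, if_false]
  unfold dec frameDec
  by_cases hall : ∀ i : Phi θ, (c - blend θ (LinOp.actX L k.x) (LinOp.actZ L k.z)) i ∈
      (if θ i = some 1 then perp k.S else k.SΔ)
  · have hs : ∀ i, (decBlock k L θ (restrict θ c) i).isSome = true := fun i => by
      rw [h, if_pos (hall i)]; rfl
    rw [dif_pos hs, if_pos hall]
    congr 1
    funext i
    simp only [h, if_pos (hall i), Option.get_some]
  · have hs : ¬ ∀ i, (decBlock k L θ (restrict θ c) i).isSome = true := fun hs => hall fun i => by
      have := hs i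
      rw [h] at this
      by_contra hn
      rw [if_neg hn] at this
      cases this
    rw [dif_neg hs, if_neg hall]

/-- `hi = lo ∪ (lo + D)`, a union of distinct cosets. -/
structure IsHalf (lo hi : Submodule (ZMod 2) (Vec lam)) (D : Vec lam) : Prop where
  le : lo ≤ hi
  mem : D ∈ hi
  notMem : D ∉ lo
  add_mem : ∀ w ∈ hi, w ∉ lo → w + D ∈ lo

/-- Adding D i preserves hi and exchanges lo with hi ∖ lo, so it flips the bit without affecting
validity. -/
theorem frameDec_add_bitsSmul {θ : Bases n} {lo hi : Fin n → Submodule (ZMod 2) (Vec lam)}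
    {D : Code lam n} (h : ∀ i, IsHalf (lo i) (hi i) (D i)) (w : Code lam n)
    (m : Fin n → ZMod 2) :
    frameDec θ lo hi (w + bitsSmul m D) = (frameDec θ lo hi w).map (· + restrict θ m) := by
  classical
  have hhi : ∀ i, (w + bitsSmul m D) i ∈ hi i ↔ w i ∈ hi i := fun i =>
    (hi i).add_mem_iff_left ((hi i).smul_mem _ (h i).mem)
  simp only [frameDec, hhi]
  split_ifs with hall
  · rw [Option.map_some]
    congr 1
    funext i
    rw [Pi.add_apply]
    have hw := hall i
    change (if w i + m i • D i ∈ lo i then (0 : ZMod 2) else 1) =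
      (if w i ∈ lo i then 0 else 1) + m i
    rcases bit_eq_zero_or_one (m i) with hm | hm
    · rw [hm, zero_smul, add_zero, add_zero]
    · rw [hm, one_smul]
      by_cases hl : w i ∈ lo i
      · rw [if_pos hl, if_neg, zero_add]
        rw [(lo i).add_mem_iff_right hl]
        exact (h i).notMem
      · rw [if_neg hl, if_pos ((h i).add_mem _ hw hl)]
        rfl
  · rfl

theorem Key.exists_dual (k : Key lam n) : ∃ Δ' ∈ perp k.S, k.Δ ⬝ᵥ Δ' = 1 := by
  obtain ⟨v, hv, h⟩ := exists_mem_perp_of_notMem k.Δ_notMem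
  exact ⟨v, hv, by rw [dotProduct_comm, h]⟩

theorem Key.isHalf_std (k : Key lam n) : IsHalf k.S k.SΔ k.Δ :=
  ⟨k.S_le, k.Δ_mem, k.Δ_notMem, fun w hw h => by
    rw [← ZModModule.sub_eq_add]; exact (k.sub_Δ_mem_iff h).2 hw⟩

theorem Key.mem_Shat_iff (k : Key lam n) {v : Vec lam} (hv : v ∈ perp k.S) :
    v ∈ k.Shat ↔ k.Δ ⬝ᵥ v = 0 := by
  obtain ⟨v', hv', h⟩ := k.exists_dual
  have := sub_smul_mem_perp_iff hv' h v 0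
  rw [zero_smul, sub_zero] at this
  exact this.trans (and_iff_right hv)

theorem Key.isHalf_had (k : Key lam n) {Δ' : Vec lam} (hΔ' : Δ' ∈ perp k.S)
    (h1 : k.Δ ⬝ᵥ Δ' = 1) : IsHalf k.Shat (perp k.S) Δ' :=
  ⟨k.Shat_le, hΔ', fun h => by rw [k.mem_Shat_iff hΔ', h1] at h; exact one_ne_zero h,
    fun w hw h => by
      rw [k.mem_Shat_iff hw] at h
      rw [k.mem_Shat_iff (add_mem hw hΔ'), dotProduct_add, h1, bit_eq_one_of_ne_zero h]
      rfl⟩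

end Oracle

/-! ### Adversaries in the frame of the measurement -/

section FrameAdversary

variable {lam n : ℕ}

theorem hadamardBlocks_conjTranspose (θ : Bases n) :
    (hadamardBlocks lam θ)ᴴ = hadamardBlocks lam θ :=
  onHadamard_conjTranspose θ (by simp only [tensorMat_conjTranspose, hadamardGate_conjTranspose])

theorem hadamardBlocks_mul_self (θ : Bases n) :
    hadamardBlocks lam θ * hadamardBlocks lam θ = 1 :=
  onHadamard_mul_self θ (by simp only [tensorMat_mul, hadamardGate_mul_self, tensorMat_one])

/-- The unitary that evaluates `L` and takes the Hadamard transform of the blocks in `Φ₁`. -/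
def frameUnitary (lam : ℕ) (L : LinOp n) (θ : Bases n) : Matrix (Code lam n) (Code lam n) ℂ :=
  hadamardBlocks lam θ * basisMap (LinOp.actX L)

theorem frameUnitary_isometry (L : LinOp n) (θ : Bases n) :
    (frameUnitary lam L θ)ᴴ * frameUnitary lam L θ = 1 := by
  rw [frameUnitary, Matrix.conjTranspose_mul, Matrix.mul_assoc,
    ← Matrix.mul_assoc (hadamardBlocks lam θ)ᴴ, hadamardBlocks_conjTranspose,
    hadamardBlocks_mul_self, Matrix.one_mul]
  exact basisMap_isometry (L.equivX (Vec lam)).injective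

namespace Adversary

variable (A : Adversary lam n)

open Classical in
/-- The oracle unitary for the oracle `v`. -/
def oracleMat (v : Query lam n → Bool) : Matrix (Code lam n × A.Aux) (Code lam n × A.Aux) ℂ :=
  basisMap fun s => (s.1, s.2.1, xor s.2.2.1 (v s.2.1.1), s.2.2.2)

open Classical in
theorem oracleMat_isometry (v : Query lam n → Bool) :
    (A.oracleMat v)ᴴ * A.oracleMat v = 1 := by
  refine basisMap_isometry (Function.LeftInverse.injective (g := fun s =>
    (s.1, s.2.1, xor s.2.2.1 (v s.2.1.1), s.2.2.2)) fun s => ?_)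
  simp

-- The difference of the oracles vanishes on basis states where they agree. On the remaining
-- subspace it is a difference of two isometries, so its squared norm is at most 4, here by the
-- two-term inequality at t = 1.
open Classical in
theorem trace_conjLin_oracleMat_sub_le (v v' : Query lam n → Bool)
    {ρ : Matrix (Code lam n × A.Aux) (Code lam n × A.Aux) ℂ} (h : ρ.PosSemidef) :
    (conjLin (A.oracleMat v - A.oracleMat v') ρ).trace.re ≤
      4 * ∑ s, if v s.2.1.1 ≠ v' s.2.1.1 then (ρ s s).re else 0 := by
  set D : Matrix (Code lam n × A.Aux) (Code lam n × A.Aux) ℂ :=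
    Matrix.diagonal fun s => if v s.2.1.1 ≠ v' s.2.1.1 then 1 else 0 with hD
  have hsub : A.oracleMat v - A.oracleMat v' =
      A.oracleMat v * D + (-A.oracleMat v') * D := by
    rw [← Matrix.add_mul, ← sub_eq_add_neg]
    ext b a
    rw [hD, Matrix.mul_diagonal]
    by_cases hv : v a.2.1.1 = v' a.2.1.1
    · simp [oracleMat, basisMap, hv]
    · simp [hv]
  have hO : ∀ O : Matrix (Code lam n × A.Aux) (Code lam n × A.Aux) ℂ, Oᴴ * O = 1 →
      (conjLin (O * D) ρ).trace.re = ∑ s, if v s.2.1.1 ≠ v' s.2.1.1 then (ρ s s).re else 0 := by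
    intro O hO
    have e : conjLin (O * D) ρ = conjLin O (conjLin D ρ) := by
      simp only [conjLin_apply, Matrix.conjTranspose_mul, Matrix.mul_assoc]
    rw [e, trace_conjLin hO, Matrix.trace, Complex.re_sum]
    refine Finset.sum_congr rfl fun s _ => ?_
    rw [Matrix.diag_apply, conjLin_apply, hD, Matrix.diagonal_conjTranspose, Matrix.mul_diagonal,
      Matrix.diagonal_mul, Pi.star_apply]
    split_ifs <;> simp
  have h1 := hO _ (A.oracleMat_isometry v)
  have h2 := hO (-A.oracleMat v') (by
    rw [Matrix.conjTranspose_neg, neg_mul_neg, A.oracleMat_isometry])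
  have key := re_trace_nonneg
    (conjLin_add_le (A.oracleMat v * D) (-A.oracleMat v' * D) h one_pos)
  rw [← hsub, Matrix.trace_sub, Matrix.trace_add, Matrix.trace_smul, Matrix.trace_smul,
    Complex.sub_re, Complex.add_re, smul_eq_mul, smul_eq_mul, Complex.re_ofReal_mul,
    Complex.re_ofReal_mul, h1, h2] at key
  linarith

open Classical in
/-- The state before the first oracle call, for an input given in frame coordinates. -/
def prepare (L : LinOp n) (θ : Bases n) :
    Matrix (Code lam n) (Code lam n) ℂ →ₗ[ℂ]
      Matrix (Code lam n × A.Aux) (Code lam n × A.Aux) ℂ :=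
  A.first.lin ∘ₗ adjoinLin (Code lam n) (pureDensity (Pi.single A.init 1)) ∘ₗ
    conjLin (frameUnitary lam L θ)ᴴ

/-- The final state of the ciphertext register, with a Hadamard transform of the blocks in `Φ₁`. -/
def finish (θ : Bases n) : Matrix (Code lam n × A.Aux) (Code lam n × A.Aux) ℂ →ₗ[ℂ]
    Matrix (Code lam n) (Code lam n) ℂ :=
  conjLin (hadamardBlocks lam θ) ∘ₗ partialTraceLin (Code lam n) A.Aux

open Classical in
/-- The run of the adversary with oracle `v`, in frame coordinates. -/
def frameRun (L : LinOp n) (θ : Bases n) (v : Query lam n → Bool) :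
    Matrix (Code lam n) (Code lam n) ℂ →ₗ[ℂ] Matrix (Code lam n) (Code lam n) ℂ :=
  A.finish θ ∘ₗ evolve (A.oracleMat v) A.rest ∘ₗ A.prepare L θ

open Classical in
theorem prepare_posSemidef (L : LinOp n) (θ : Bases n) {ρ : Matrix (Code lam n) (Code lam n) ℂ}
    (h : ρ.PosSemidef) : (A.prepare L θ ρ).PosSemidef :=
  A.first.lin_posSemidef ((conjLin_posSemidef _ h).kronecker (pureDensity_posSemidef _))

open Classical in
theorem trace_prepare (L : LinOp n) (θ : Bases n) (ρ : Matrix (Code lam n) (Code lam n) ℂ) :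
    (A.prepare L θ ρ).trace = ρ.trace := by
  have hU : (frameUnitary lam L θ)ᴴᴴ * (frameUnitary lam L θ)ᴴ = 1 := by
    rw [Matrix.conjTranspose_conjTranspose, mul_eq_one_comm]
    exact frameUnitary_isometry L θ
  refine (A.first.trace_lin _).trans ?_
  refine (Matrix.trace_kronecker _ _).trans ?_
  rw [trace_conjLin hU, trace_pureDensity]
  have : (∑ a, ‖(Pi.single A.init 1 : A.Aux → ℂ) a‖ ^ 2) = 1 := by
    rw [Finset.sum_eq_single A.init]
    · simp
    · intro b _ hb; simp [hb]
    · simp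
  rw [this]
  simp

theorem finish_posSemidef (θ : Bases n)
    {ρ : Matrix (Code lam n × A.Aux) (Code lam n × A.Aux) ℂ} (h : ρ.PosSemidef) :
    (A.finish θ ρ).PosSemidef := conjLin_posSemidef _ (partialTrace_posSemidef h)

theorem trace_finish (θ : Bases n) (ρ : Matrix (Code lam n × A.Aux) (Code lam n × A.Aux) ℂ) :
    (A.finish θ ρ).trace = ρ.trace := by
  refine (trace_conjLin ?_ _).trans (trace_partialTrace ρ)
  rw [hadamardBlocks_conjTranspose, hadamardBlocks_mul_self]

open Classical in
theorem frameRun_posSemidef (L : LinOp n) (θ : Bases n) (v : Query lam n → Bool)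
    {ρ : Matrix (Code lam n) (Code lam n) ℂ} (h : ρ.PosSemidef) :
    (A.frameRun L θ v ρ).PosSemidef :=
  A.finish_posSemidef θ (evolve_posSemidef _ _ (A.prepare_posSemidef L θ h))

open Classical in
theorem trace_frameRun (L : LinOp n) (θ : Bases n) (v : Query lam n → Bool)
    (ρ : Matrix (Code lam n) (Code lam n) ℂ) : (A.frameRun L θ v ρ).trace = ρ.trace :=
  (A.trace_finish θ _).trans ((trace_evolve (A.oracleMat_isometry v) _ _).trans
    (A.trace_prepare L θ ρ))

-- The frame run undoes the frame change before the adversary acts and applies the Hadamard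
-- transform afterwards. The coherent measurement is then diagonal, and only the diagonal of the
-- final state matters.
open Classical in
theorem re_trace_authProj_mul_run (k : Key lam n) (L : LinOp n) (θ : Bases n)
    (f : (Phi θ → ZMod 2) → List (ZMod 2)) (y : Outcome) (φ : Code lam n → ℂ) :
    (Matrix.trace (authProj k L θ f y * A.run k (pureDensity φ))).re =
      ∑ c, if (dec k L θ (restrict θ c)).map f = y then
        (A.frameRun L θ (verSub k.SΔ (perp k.S) k.x k.z)
          (pureDensity (frameUnitary lam L θ *ᵥ φ)) c c).re else 0 := by
  have hv : verSub k.SΔ (perp k.S) k.x k.z = fun q => ver k q.L q.θ q.c :=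
    funext fun q => (ver_eq_verSub k q).symm
  have hφ : conjLin (frameUnitary lam L θ)ᴴ (pureDensity (frameUnitary lam L θ *ᵥ φ)) =
      pureDensity φ := by
    rw [conjLin_pureDensity, Matrix.mulVec_mulVec, frameUnitary_isometry, Matrix.one_mulVec]
  have hrun : conjLin (hadamardBlocks lam θ) (A.run k (pureDensity φ)) =
      A.frameRun L θ (verSub k.SΔ (perp k.S) k.x k.z)
          (pureDensity (frameUnitary lam L θ *ᵥ φ)) := by
    rw [hv]
    simp only [frameRun, finish, prepare, LinearMap.comp_apply, hφ, QuantumOp.lin_apply,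
      evolve_eq_foldl]
    rfl
  have hproj : authProj k L θ f y = hadamardBlocks lam θ *
      Matrix.diagonal (fun c => if (dec k L θ (restrict θ c)).map f = y then (1 : ℂ) else 0) *
      hadamardBlocks lam θ := rfl
  have hmove : ∀ H D R : Matrix (Code lam n) (Code lam n) ℂ,
      (H * D * H * R).trace = (D * (H * R * H)).trace := fun H D R => by
    rw [Matrix.mul_assoc, Matrix.mul_assoc H, Matrix.trace_mul_comm, Matrix.mul_assoc D]
  rw [← hrun, hproj, hmove, conjLin_apply, hadamardBlocks_conjTranspose, Matrix.trace,
    Complex.re_sum]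
  refine Finset.sum_congr rfl fun c _ => ?_
  rw [Matrix.diag_apply, Matrix.diagonal_mul]
  split_ifs <;> simp

end Adversary

end FrameAdversary

/-! ### The experiment as a mixture over decoding errors -/

section Mixture

variable {lam n : ℕ}

/-- The first two components `(S, Δ)` of a key. -/
abbrev Base (lam : ℕ) := {p : Submodule (ZMod 2) (Vec lam) × Vec lam //
  Module.finrank (ZMod 2) p.1 = lam ∧ p.2 ∉ p.1}

instance (lam : ℕ) : Fintype (Base lam) := Fintype.ofFinite _

/-- The `X`-pad of the key with pads `X` and `Z` in frame coordinates. -/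
def padX (L : LinOp n) (θ : Bases n) (X Z : Code lam n) : Code lam n :=
  (L.equivX (Vec lam)).symm (blend θ X Z)

/-- The `Z`-pad of the key with pads `X` and `Z` in frame coordinates. -/
def padZ (L : LinOp n) (θ : Bases n) (X Z : Code lam n) : Code lam n :=
  (L.dual.equivX (Vec lam)).symm (blend θ Z X)

theorem actX_padX (L : LinOp n) (θ : Bases n) (X Z : Code lam n) :
    LinOp.actX L (padX L θ X Z) = blend θ X Z := (L.equivX (Vec lam)).apply_symm_apply _

theorem actZ_padZ (L : LinOp n) (θ : Bases n) (X Z : Code lam n) :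
    LinOp.actZ L (padZ L θ X Z) = blend θ Z X := by
  rw [LinOp.actZ_eq]
  exact (L.dual.equivX (Vec lam)).apply_symm_apply _

/-- Keys in frame coordinates. -/
def frameKey (L : LinOp n) (θ : Bases n) : Base lam × Code lam n × Code lam n ≃ Key lam n where
  toFun p := ⟨p.1.1.1, p.1.2.1, p.1.1.2, p.1.2.2, padX L θ p.2.1 p.2.2, padZ L θ p.2.1 p.2.2⟩
  invFun k := (⟨(k.S, k.Δ), k.finrank_S, k.Δ_notMem⟩,
    blend θ (LinOp.actX L k.x) (LinOp.actZ L k.z), blend θ (LinOp.actZ L k.z) (LinOp.actX L k.x))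
  left_inv p := by
    simp only [actX_padX, actZ_padZ, blend_blend]
  right_inv k := by
    simp only [padX, padZ, blend_blend, LinOp.actZ_eq]
    have h1 := (L.equivX (Vec lam)).symm_apply_apply k.x
    have h2 := (L.dual.equivX (Vec lam)).symm_apply_apply k.z
    obtain ⟨S, hS, Δ, hΔ, x, z⟩ := k
    congr 1

/-- The oracle `verSub` with pads in frame coordinates. -/
def frameOracle (L : LinOp n) (θ : Bases n) (P Q : Submodule (ZMod 2) (Vec lam))
    (X Z : Code lam n) : Query lam n → Bool := verSub P Q (padX L θ X Z) (padZ L θ X Z)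

/-- On Hadamard blocks the frame has exchanged the pads, so X is protected modulo (P, Q) and Z
modulo (Q, P). -/
theorem frameOracle_congr {L : LinOp n} {θ : Bases n} {P Q : Submodule (ZMod 2) (Vec lam)}
    {X X' Z Z' : Code lam n} (hX : X - X' ∈ frame θ P Q) (hZ : Z - Z' ∈ frame θ Q P) :
    frameOracle L θ P Q X Z = frameOracle L θ P Q X' Z' := by
  rw [mem_frame] at hX hZ
  refine verSub_congr ?_ ?_
  · rw [← LinOp.actX_mem_iff L, LinOp.actX_sub, actX_padX, actX_padX]
    intro i
    have h1 := hX i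
    have h2 := hZ i
    simp only [Pi.sub_apply, blend] at h1 h2 ⊢
    split_ifs at h1 h2 ⊢ <;> assumption
  · rw [← LinOp.actX_mem_iff L.dual, LinOp.actX_sub, ← LinOp.actZ_eq, ← LinOp.actZ_eq, actZ_padZ,
      actZ_padZ]
    intro i
    have h1 := hX i
    have h2 := hZ i
    simp only [Pi.sub_apply, blend] at h1 h2 ⊢
    split_ifs at h1 h2 ⊢ <;> assumption

/-- Independent random signs on the terms of a superposition kill its cross terms, by orthogonality
of characters. -/
theorem sum_pureDensity_bitSign (u : (Fin n → ZMod 2) → Code lam n → ℂ) :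
    ∑ b : Fin n → ZMod 2, pureDensity (∑ m, bitSign (b ⬝ᵥ m) • u m) =
      (2 ^ n : ℂ) • ∑ m, pureDensity (u m) := by
  classical
  ext c c'
  have hchar : ∀ m m' : Fin n → ZMod 2, ∑ b : Fin n → ZMod 2,
      bitSign (b ⬝ᵥ m) * bitSign (b ⬝ᵥ m') = if m = m' then (2 ^ n : ℂ) else 0 := by
    intro m m'
    have h := sum_bitSign_submodule (⊤ : Submodule (ZMod 2) (Fin n → ZMod 2))
      { toFun := fun s => s ⬝ᵥ (m - m'), map_zero' := zero_dotProduct _,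
        map_add' := fun a b => add_dotProduct a b _ }
    rw [natCard_submodule, finrank_top, Module.finrank_fin_fun] at h
    simp only [Submodule.mem_top, if_true, true_imp_iff, AddMonoidHom.coe_mk, ZeroHom.coe_mk] at h
    have h0 : (∀ s : Fin n → ZMod 2, s ⬝ᵥ (m - m') = 0) ↔ m = m' := by
      rw [← sub_eq_zero (a := m)]
      refine ⟨fun h => dotProduct_eq_zero _ fun w => by rw [dotProduct_comm]; exact h w, fun h s => ?_⟩
      rw [h, dotProduct_zero]
    simp only [h0] at h
    rw [Nat.cast_pow, Nat.cast_ofNat] at h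
    rw [← h]
    refine Finset.sum_congr rfl fun b _ => ?_
    rw [← bitSign_add, ZModModule.sub_eq_add, dotProduct_add]
  simp only [Matrix.sum_apply, Matrix.smul_apply, pureDensity, Matrix.vecMulVec_apply,
    Finset.sum_apply, Pi.smul_apply, Pi.star_apply, star_sum, smul_eq_mul, star_mul', star_bitSign,
    Finset.sum_mul_sum]
  rw [Finset.sum_comm, Finset.mul_sum]
  refine Finset.sum_congr rfl fun m _ => ?_
  rw [Finset.sum_comm]
  rw [Finset.sum_eq_single m]
  · have h := hchar m m
    rw [if_pos rfl] at h
    rw [← h, Finset.sum_mul]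
    exact Finset.sum_congr rfl fun b _ => by ring
  · intro m' _ hm'
    have h := hchar m m'
    rw [if_neg hm'.symm] at h
    calc _ = (∑ b : Fin n → ZMod 2, bitSign (b ⬝ᵥ m) * bitSign (b ⬝ᵥ m')) *
          (u m c * star (u m' c')) := by
          rw [Finset.sum_mul]
          exact Finset.sum_congr rfl fun b _ => by ring
      _ = 0 := by rw [h, zero_mul]
  · simp

theorem pureDensity_smul' {α : Type*} (a : ℂ) (ψ : α → ℂ) :
    pureDensity (a • ψ) = ((‖a‖ ^ 2 : ℝ) : ℂ) • pureDensity ψ := by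
  have h : a * star a = ((‖a‖ ^ 2 : ℝ) : ℂ) := by
    rw [Complex.star_def, Complex.mul_conj, Complex.normSq_eq_norm_sq]
  ext b c
  simp only [pureDensity, Matrix.vecMulVec_apply, Pi.smul_apply, Pi.star_apply, smul_eq_mul,
    star_mul', Matrix.smul_apply, ← h]
  ring

namespace Adversary

/-- The probability of the measured word `c` in the run on the state `X^X Z^Z |lo⟩` with an oracle
that accepts cosets of `hi`, where `(lo, hi)` is `(M₁, M₂)` on blocks for the standard basis and the
dual pair on blocks for the Hadamard basis. -/
def outProb (A : Adversary lam n) (L : LinOp n) (θ : Bases n)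
    (M₁ M₂ : Submodule (ZMod 2) (Vec lam)) (X Z c : Code lam n) : ℝ :=
  (A.frameRun L θ (frameOracle L θ M₂ (perp M₁) X Z)
    (pureDensity (cosetVec (frame θ M₁ (perp M₂)) X Z)) c c).re

end Adversary

/-- `frameDec` for the subspaces `M₁ ≤ M₂` and their duals. -/
def pairDec (θ : Bases n) (M₁ M₂ : Submodule (ZMod 2) (Vec lam)) (w : Code lam n) :
    Option (Phi θ → ZMod 2) :=
  frameDec θ (fun i => if θ i = some 1 then perp M₂ else M₁)
    (fun i => if θ i = some 1 then perp M₁ else M₂) w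

/-- `S_Δ` for the first two components of a key. -/
def Base.hi (b : Base lam) : Submodule (ZMod 2) (Vec lam) :=
  b.1.1 ⊔ Submodule.span (ZMod 2) {b.1.2}

theorem pair_bitsSmul_bitsSmul {D D' : Code lam n} (h : ∀ i, D' i ⬝ᵥ D i = 1)
    (b m : Fin n → ZMod 2) : pair (bitsSmul b D') (bitsSmul m D) = b ⬝ᵥ m := by
  simp only [pair, bitsSmul, smul_dotProduct, dotProduct_smul, h, smul_eq_mul, mul_one]
  exact Finset.sum_congr rfl fun i _ => mul_comm _ _

theorem cosetVec_add_right {W : Submodule (ZMod 2) (Code lam n)} {r : Code lam n}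
    (h : ∀ w ∈ W, pair r w = 0) (X Z : Code lam n) : cosetVec W X (Z + r) = cosetVec W X Z := by
  funext c
  simp only [cosetVec]
  split_ifs with hc
  · rw [add_pair, h _ hc, add_zero]
  · rfl

open Classical in
/-- For fixed `(S, Δ)`, averaging over the pads turns the encoded state into a mixture of encoded
basis states, and these only differ by a shift of the decoded message. -/
theorem sum_pads_eq (L : LinOp n) (θ : Bases n) (f : (Phi θ → ZMod 2) → List (ZMod 2))
    (A : Adversary lam n) (ψ : (Fin n → ZMod 2) → ℂ) (y : Outcome) (b : Base lam) :
    ∑ X, ∑ Z, (Matrix.trace (authProj (frameKey L θ (b, X, Z)) L θ f y *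
        A.run (frameKey L θ (b, X, Z)) (pureDensity (enc (frameKey L θ (b, X, Z)) *ᵥ ψ)))).re =
      ∑ m, ‖(onHadamard θ hadamardGate *ᵥ (basisMap (LinOp.actX L) *ᵥ ψ)) m‖ ^ 2 *
        ∑ X, ∑ Z, ∑ c,
          if (pairDec θ b.1.1 b.hi (c - X)).map (fun e => f (e + restrict θ m)) = y then
            A.outProb L θ b.1.1 b.hi X Z c else 0 := by
  obtain ⟨Δ', hΔ', h1⟩ := (frameKey (n := n) L θ (b, 0, 0)).exists_dual
  -- D holds the logical shifts of the frame code, and D' those of the dual code. Blockwise D' pairs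
  -- to 1 with D, and D' is orthogonal to lo; so a shift of Z by bits a along D' puts the sign
  -- (-1)^{a⬝m} on message m and changes nothing else.
  set D : Code lam n := blend θ (fun _ => b.1.2) (fun _ => Δ') with hD
  set D' : Code lam n := blend θ (fun _ => Δ') (fun _ => b.1.2) with hD'
  set χ := onHadamard θ hadamardGate *ᵥ (basisMap (LinOp.actX L) *ᵥ ψ) with hχ
  set lo : Submodule (ZMod 2) (Code lam n) := frame θ b.1.1 (perp b.hi) with hlo
  let R : Code lam n → Code lam n → Matrix (Code lam n) (Code lam n) ℂ → Code lam n → ℝ :=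
    fun X Z σ c => (A.frameRun L θ (frameOracle L θ b.hi (perp b.1.1) X Z) σ c c).re
  let Φ : Code lam n → Code lam n → Code lam n → ℂ := fun X Z =>
    ∑ m, (χ m * bitSign (pair Z (bitsSmul m D))) • cosetVec lo (X + bitsSmul m D) Z
  have hdec : ∀ X Z c, dec (frameKey L θ (b, X, Z)) L θ (restrict θ c) =
      pairDec θ b.1.1 b.hi (c - X) := by
    intro X Z c
    rw [dec_eq_frameDec]
    change frameDec θ _ _ (c - blend θ (LinOp.actX L (padX L θ X Z))
      (LinOp.actZ L (padZ L θ X Z))) = _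
    rw [actX_padX, actZ_padZ, blend_blend]
    rfl
  have hstart : ∀ X Z, (Matrix.trace (authProj (frameKey L θ (b, X, Z)) L θ f y *
        A.run (frameKey L θ (b, X, Z)) (pureDensity (enc (frameKey L θ (b, X, Z)) *ᵥ ψ)))).re =
      ∑ c, if (pairDec θ b.1.1 b.hi (c - X)).map f = y then
        R X Z (pureDensity (Φ X Z)) c else 0 := by
    intro X Z
    obtain ⟨u, hu, hΦ⟩ := frame_mulVec_enc (frameKey L θ (b, X, Z)) L θ hΔ' h1 ψ (X := X) (Z := Z)
      (D := D) (by
        change _ = blend θ (LinOp.actX L (padX L θ X Z)) (LinOp.actZ L (padZ L θ X Z))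
        rw [actX_padX, actZ_padZ, blend_blend]) (by
        change _ = blend θ (LinOp.actZ L (padZ L θ X Z)) (LinOp.actX L (padX L θ X Z))
        rw [actX_padX, actZ_padZ, blend_blend]) rfl
    rw [Adversary.re_trace_authProj_mul_run]
    simp only [hdec]
    refine Finset.sum_congr rfl fun c _ => ?_
    rw [frameUnitary, ← Matrix.mulVec_mulVec, hΦ, pureDensity_smul hu]
    rfl
  have hDhi : ∀ m, bitsSmul m D ∈ frame θ b.hi (perp b.1.1) := fun m => by
    rw [mem_frame]
    intro i
    refine Submodule.smul_mem _ _ ?_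
    simp only [hD, blend]
    split_ifs
    · exact hΔ'
    · exact (frameKey (n := n) L θ (b, 0, 0)).Δ_mem
  have hD'hi : ∀ m, bitsSmul m D' ∈ frame θ (perp b.1.1) b.hi := fun m => by
    rw [mem_frame]
    intro i
    refine Submodule.smul_mem _ _ ?_
    simp only [hD', blend]
    split_ifs
    · exact (frameKey (n := n) L θ (b, 0, 0)).Δ_mem
    · exact hΔ'
  have hDD : ∀ i, D' i ⬝ᵥ D i = 1 := fun i => by
    simp only [hD, hD', blend]
    split_ifs
    · exact h1
    · rw [dotProduct_comm]; exact h1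
  have hperp : ∀ m, ∀ w ∈ lo, pair (bitsSmul m D') w = 0 := by
    intro m w hw
    rw [hlo, mem_frame] at hw
    refine Finset.sum_eq_zero fun i _ => ?_
    have hi := hw i
    simp only [bitsSmul, hD', blend, smul_dotProduct]
    split_ifs at hi ⊢
    · have e : b.1.2 ⬝ᵥ w i = 0 := hi _ (frameKey (n := n) L θ (b, 0, 0)).Δ_mem
      rw [e, smul_zero]
    · rw [dotProduct_comm, hΔ' _ hi, smul_zero]
  have hR : ∀ X Z (m : Fin n → ZMod 2), R X (Z + bitsSmul m D') = R X Z := by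
    intro X Z m
    have : frameOracle L θ b.hi (perp b.1.1) X (Z + bitsSmul m D') =
        frameOracle L θ b.hi (perp b.1.1) X Z :=
      frameOracle_congr (by rw [sub_self]; exact zero_mem _)
        (by rw [add_sub_cancel_left]; exact hD'hi m)
    simp only [R, this]
  have hRX : ∀ X Z (m : Fin n → ZMod 2), R (X + bitsSmul m D) Z = R X Z := by
    intro X Z m
    have : frameOracle L θ b.hi (perp b.1.1) (X + bitsSmul m D) Z =
        frameOracle L θ b.hi (perp b.1.1) X Z :=
      frameOracle_congr (by rw [add_sub_cancel_left]; exact hDhi m)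
        (by rw [sub_self]; exact zero_mem _)
    simp only [R, this]
  -- The sum over Z is invariant under shifts along D', which neither the oracle nor the states on
  -- lo notice. Averaging over all 2ⁿ shifts leaves the mixture over m with weights |χ_m|².
  have hdephase : ∀ X c, ∑ Z, R X Z (pureDensity (Φ X Z)) c =
      ∑ Z, ∑ m, ‖χ m‖ ^ 2 * R X Z (pureDensity (cosetVec lo (X + bitsSmul m D) Z)) c := by
    intro X c
    have h2 : (2 : ℝ) ^ n ≠ 0 := by positivity
    refine mul_left_cancel₀ h2 ?_
    have hcard : (2 : ℝ) ^ n = ∑ _a : Fin n → ZMod 2, 1 := by simp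
    calc (2 : ℝ) ^ n * ∑ Z, R X Z (pureDensity (Φ X Z)) c
        = ∑ a : Fin n → ZMod 2, ∑ Z, R X (Z + bitsSmul a D')
            (pureDensity (Φ X (Z + bitsSmul a D'))) c := by
          rw [hcard, Finset.sum_mul]
          refine Finset.sum_congr rfl fun a _ => ?_
          rw [one_mul]
          exact (Equiv.sum_comp (Equiv.addRight (bitsSmul a D'))
            fun Z => R X Z (pureDensity (Φ X Z)) c).symm
      _ = ∑ Z, R X Z (∑ a : Fin n → ZMod 2, pureDensity (Φ X (Z + bitsSmul a D'))) c := by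
          rw [Finset.sum_comm]
          refine Finset.sum_congr rfl fun Z _ => ?_
          simp only [hR]
          simp only [R, map_sum, Matrix.sum_apply, Complex.re_sum]
      _ = ∑ Z, R X Z ((2 ^ n : ℂ) • ∑ m, ((‖χ m‖ ^ 2 : ℝ) : ℂ) •
            pureDensity (cosetVec lo (X + bitsSmul m D) Z)) c := by
          refine Finset.sum_congr rfl fun Z _ => ?_
          congr 2
          rw [← Finset.sum_congr rfl fun m _ => pureDensity_smul' (χ m) _]
          have hs : ∀ m, pureDensity (χ m • cosetVec lo (X + bitsSmul m D) Z) =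
              pureDensity ((χ m * bitSign (pair Z (bitsSmul m D))) •
                cosetVec lo (X + bitsSmul m D) Z) := fun m => by
            rw [mul_comm (χ m), mul_smul]
            exact (pureDensity_smul (by rw [star_bitSign, bitSign_mul_self]) _).symm
          rw [Finset.sum_congr rfl fun m _ => hs m, ← sum_pureDensity_bitSign]
          refine Finset.sum_congr rfl fun a _ => ?_
          congr 1
          refine Finset.sum_congr rfl fun m _ => ?_
          rw [cosetVec_add_right (hperp a), add_pair, pair_bitsSmul_bitsSmul hDD, bitSign_add,
            smul_smul]
          congr 1
          ring
      _ = (2 : ℝ) ^ n * ∑ Z, ∑ m, ‖χ m‖ ^ 2 *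
            R X Z (pureDensity (cosetVec lo (X + bitsSmul m D) Z)) c := by
          rw [Finset.mul_sum]
          refine Finset.sum_congr rfl fun Z _ => ?_
          simp only [R, map_sum, map_smul, Matrix.sum_apply, Matrix.smul_apply, smul_eq_mul]
          have e : (2 ^ n : ℂ) = ((2 ^ n : ℝ) : ℂ) := by push_cast; rfl
          rw [e, Complex.re_ofReal_mul, Complex.re_sum]
          simp only [Complex.re_ofReal_mul]
  have hhalf : ∀ i, IsHalf (if θ i = some 1 then perp b.hi else b.1.1)
      (if θ i = some 1 then perp b.1.1 else b.hi) (D i) := by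
    intro i
    simp only [hD, blend]
    split_ifs
    · exact (frameKey (n := n) L θ (b, 0, 0)).isHalf_had hΔ' h1
    · exact (frameKey (n := n) L θ (b, 0, 0)).isHalf_std
  calc _ = ∑ X, ∑ c, ∑ Z, if (pairDec θ b.1.1 b.hi (c - X)).map f = y then
        R X Z (pureDensity (Φ X Z)) c else 0 := by
        refine Finset.sum_congr rfl fun X _ => ?_
        rw [Finset.sum_comm]
        exact Finset.sum_congr rfl fun Z _ => hstart X Z
    _ = ∑ X, ∑ c, ∑ Z, ∑ m, if (pairDec θ b.1.1 b.hi (c - X)).map f = y then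
          ‖χ m‖ ^ 2 * R X Z (pureDensity (cosetVec lo (X + bitsSmul m D) Z)) c else 0 := by
        refine Finset.sum_congr rfl fun X _ => Finset.sum_congr rfl fun c _ => ?_
        split_ifs
        · exact hdephase X c
        · simp
    _ = ∑ m, ∑ X, ∑ Z, ∑ c, if (pairDec θ b.1.1 b.hi (c - X)).map f = y then
          ‖χ m‖ ^ 2 * R X Z (pureDensity (cosetVec lo (X + bitsSmul m D) Z)) c else 0 := by
        rw [Finset.sum_comm (s := Finset.univ (α := Fin n → ZMod 2))]
        refine Finset.sum_congr rfl fun X _ => ?_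
        rw [Finset.sum_comm (s := Finset.univ (α := Fin n → ZMod 2)), Finset.sum_comm]
        refine Finset.sum_congr rfl fun Z _ => ?_
        rw [Finset.sum_comm]
    _ = _ := by
        refine Finset.sum_congr rfl fun m _ => ?_
        rw [Finset.mul_sum]
        refine Fintype.sum_equiv (Equiv.addRight (bitsSmul m D)) _ _ fun X => ?_
        rw [Finset.mul_sum]
        refine Finset.sum_congr rfl fun Z _ => ?_
        rw [Finset.mul_sum]
        refine Finset.sum_congr rfl fun c _ => ?_
        -- The shift mD is absorbed into the pad X: the oracle is unchanged, and the decoded word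
        -- relative to the old pad is the error plus m.
        have hshift : pairDec θ b.1.1 b.hi (c - X) =
            (pairDec θ b.1.1 b.hi (c - (X + bitsSmul m D))).map (· + restrict θ m) := by
          rw [pairDec, pairDec, ← frameDec_add_bitsSmul hhalf]
          congr 1
          abel
        rw [Equiv.coe_addRight, hshift, Option.map_map, mul_ite, mul_zero, ← hRX X Z m]
        rfl

end Mixture

/-! ### The distance to the ideal mixture -/

section Distance

-- The outcome ⊥ and the error e₀ contribute exactly the ideal mixture. Every other error moves mass
-- from `g e₀ m` to `g e m`, which costs at most twice its probability.
open Classical in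
theorem tsum_abs_mixture_le {M E β : Type*} [Fintype M] [Fintype E] {p : M → ℝ}
    (hp : ∀ m, 0 ≤ p m) (hp1 : ∑ m, p m = 1) {P : Option E → ℝ} (hP : ∀ o, 0 ≤ P o)
    (hP1 : ∑ o, P o = 1) (g : E → M → β) (e₀ : E) :
    ∑' y : Option β, |(∑ m, p m * ∑ o : Option E, if o.map (fun e => g e m) = y then P o else 0) -
        ((1 - P none) * (∑ m, if some (g e₀ m) = y then p m else 0) +
          P none * (if y = none then 1 else 0))| ≤
      2 * ∑ e, if e = e₀ then 0 else P (some e) := by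
  set P' : E → ℝ := fun e => if e = e₀ then 0 else P (some e) with hP'
  have hP'0 : ∀ e, 0 ≤ P' e := fun e => by
    simp only [hP']; split_ifs; exacts [le_rfl, hP _]
  -- A summable majorant made of two point masses per wrong error; it handles the infinite set of
  -- outcomes y.
  set B : Option β → ℝ := fun y => ∑ m, ∑ e, p m * P' e *
    ((if y = some (g e m) then 1 else 0) + if y = some (g e₀ m) then 1 else 0) with hB
  have hsumB : HasSum B (∑ m, ∑ e, p m * P' e * (1 + 1)) :=
    hasSum_sum fun m _ => hasSum_sum fun e _ =>
      ((hasSum_ite_eq _ _).add (hasSum_ite_eq _ _)).mul_left _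
  have hle : ∀ y, |(∑ m, p m * ∑ o : Option E, if o.map (fun e => g e m) = y then P o else 0) -
        ((1 - P none) * (∑ m, if some (g e₀ m) = y then p m else 0) +
          P none * (if y = none then 1 else 0))| ≤ B y := by
    intro y
    have h1 : 1 - P none = ∑ e, P (some e) := by
      rw [Fintype.sum_option] at hP1
      linarith
    have e : (∑ m, p m * ∑ o : Option E, if o.map (fun e => g e m) = y then P o else 0) -
        ((1 - P none) * (∑ m, if some (g e₀ m) = y then p m else 0) +
          P none * (if y = none then 1 else 0)) =
        ∑ m, ∑ e, p m * P (some e) *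
          ((if y = some (g e m) then 1 else 0) - if y = some (g e₀ m) then 1 else 0) := by
      have h2 : P none * (if y = none then (1 : ℝ) else 0) =
          ∑ m, p m * (P none * if y = none then (1 : ℝ) else 0) := by
        rw [← Finset.sum_mul, hp1, one_mul]
      rw [h1, h2, Finset.mul_sum, ← Finset.sum_add_distrib, ← Finset.sum_sub_distrib]
      refine Finset.sum_congr rfl fun m _ => ?_
      have hn : (if Option.map (fun e => g e m) none = y then P none else 0) =
          P none * if y = none then (1 : ℝ) else 0 := by
        simp [eq_comm]
      rw [Fintype.sum_option, hn, Finset.sum_mul]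
      simp only [Option.map_some, mul_sub, Finset.sum_sub_distrib, mul_add, Finset.mul_sum]
      have ha : ∀ e, p m * (if some (g e m) = y then P (some e) else 0) =
          p m * P (some e) * if y = some (g e m) then 1 else 0 := fun e => by
        by_cases h : y = some (g e m)
        · simp [h]
        · simp [h, Ne.symm h]
      have hb : ∀ e, P (some e) * (if some (g e₀ m) = y then p m else 0) =
          p m * P (some e) * if y = some (g e₀ m) then 1 else 0 := fun e => by
        by_cases h : y = some (g e₀ m)
        · simp [h, mul_comm]
        · simp [h, Ne.symm h]
      simp only [ha, hb]
      ring
    rw [e]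
    refine (Finset.abs_sum_le_sum_abs _ _).trans (Finset.sum_le_sum fun m _ => ?_)
    refine (Finset.abs_sum_le_sum_abs _ _).trans (Finset.sum_le_sum fun e _ => ?_)
    by_cases he : e = e₀
    · simp [he, hP']
    · have hnn : 0 ≤ p m * P (some e) := mul_nonneg (hp m) (hP _)
      simp only [hP', if_neg he]
      rw [abs_mul, abs_of_nonneg hnn]
      refine mul_le_mul_of_nonneg_left ?_ hnn
      split_ifs <;> norm_num
  have hs := Summable.of_nonneg_of_le (fun y => abs_nonneg _) hle hsumB.summable
  refine (hs.tsum_le_tsum hle hsumB.summable).trans (le_of_eq ?_)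
  rw [hsumB.tsum_eq]
  calc _ = (∑ m, p m) * ∑ e, P' e * (1 + 1) := by
        rw [Finset.sum_mul_sum]
        exact Finset.sum_congr rfl fun m _ => Finset.sum_congr rfl fun e _ => by ring
    _ = _ := by rw [hp1, one_mul, ← Finset.sum_mul]; ring

variable {lam n : ℕ}

theorem sum_norm_sq_cosetVec (W : Submodule (ZMod 2) (Code lam n)) (X Z : Code lam n) :
    ∑ c, ‖cosetVec W X Z c‖ ^ 2 = 1 := by
  classical
  have h : ∀ c, ‖cosetVec W X Z c‖ ^ 2 = if c - X ∈ W then (1 / Nat.card W : ℝ) else 0 := by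
    intro c
    unfold cosetVec
    split_ifs
    · have hb : ‖bitSign (pair Z (c - X))‖ = 1 := by
        unfold bitSign; split_ifs <;> simp
      rw [norm_mul, hb, mul_one, Complex.norm_real, Real.norm_eq_abs, sq_abs, div_pow, one_pow,
        Real.sq_sqrt (Nat.cast_nonneg _)]
    · simp
  have hW : (Nat.card W : ℝ) ≠ 0 := by exact_mod_cast Nat.card_pos.ne'
  calc _ = ∑ w : Code lam n, if w ∈ W then (1 / Nat.card W : ℝ) else 0 :=
        Fintype.sum_equiv (Equiv.subRight X) _ _ h
    _ = 1 := by
        rw [← Finset.sum_filter, Finset.sum_const, nsmul_eq_mul, ← Fintype.card_subtype,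
          ← Nat.card_eq_fintype_card]
        exact mul_one_div_cancel hW

namespace Adversary

variable (A : Adversary lam n) (L : LinOp n) (θ : Bases n)

theorem outProb_nonneg (M₁ M₂ : Submodule (ZMod 2) (Vec lam)) (X Z c : Code lam n) :
    0 ≤ A.outProb L θ M₁ M₂ X Z c :=
  re_diag_nonneg (A.frameRun_posSemidef L θ _ (pureDensity_posSemidef _)) c

theorem sum_outProb (M₁ M₂ : Submodule (ZMod 2) (Vec lam)) (X Z : Code lam n) :
    ∑ c, A.outProb L θ M₁ M₂ X Z c = 1 := by
  have h := A.trace_frameRun L θ (frameOracle L θ M₂ (perp M₁) X Z)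
    (pureDensity (cosetVec (frame θ M₁ (perp M₂)) X Z))
  rw [trace_pureDensity, sum_norm_sq_cosetVec] at h
  have h' := congrArg Complex.re h
  rw [Matrix.trace, Complex.re_sum] at h'
  exact h'.trans (by simp)

open Classical in
/-- The probability that the honest decoding is off by the error `o`, or fails. -/
def errProb (o : Option (Phi θ → ZMod 2)) : ℝ :=
  (∑ b : Base lam, ∑ X, ∑ Z, ∑ c,
    if pairDec θ b.1.1 b.hi (c - X) = o then A.outProb L θ b.1.1 b.hi X Z c else 0) /
    Fintype.card (Key lam n)

theorem errProb_nonneg (o : Option (Phi θ → ZMod 2)) : 0 ≤ A.errProb L θ o := by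
  refine div_nonneg (Finset.sum_nonneg fun b _ => Finset.sum_nonneg fun X _ =>
    Finset.sum_nonneg fun Z _ => Finset.sum_nonneg fun c _ => ?_) (Nat.cast_nonneg _)
  split_ifs
  exacts [A.outProb_nonneg L θ _ _ _ _ _, le_rfl]

end Adversary

theorem card_key (lam n : ℕ) : Fintype.card (Key lam n) =
    Fintype.card (Base lam) * (Fintype.card (Code lam n) * Fintype.card (Code lam n)) := by
  rw [← Fintype.card_congr (frameKey (lam := lam) (n := n) [] fun _ => none), Fintype.card_prod,
    Fintype.card_prod]

theorem card_base_pos (lam : ℕ) : 0 < Fintype.card (Base lam) := by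
  obtain ⟨S, -, hS⟩ := exists_superspace (S := (⊥ : Submodule (ZMod 2) (Vec lam))) (k := lam)
    (by rw [finrank_bot]; omega) (by omega)
  obtain ⟨Δ, hΔ⟩ : ∃ Δ, Δ ∉ S := by
    by_contra! h
    have : S = ⊤ := eq_top_iff.2 fun v _ => h v
    rw [this, finrank_top, Module.finrank_fin_fun] at hS
    omega
  exact Fintype.card_pos_iff.2 ⟨⟨(S, Δ), hS, hΔ⟩⟩

theorem card_key_pos (lam n : ℕ) : (0 : ℝ) < Fintype.card (Key lam n) := by
  rw [card_key]
  have := card_base_pos lam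
  have h2 : 0 < Fintype.card (Code lam n) := Fintype.card_pos
  positivity

namespace Adversary

variable (A : Adversary lam n) (L : LinOp n) (θ : Bases n)

theorem sum_errProb : ∑ o, A.errProb L θ o = 1 := by
  classical
  simp only [errProb]
  rw [← Finset.sum_div, div_eq_one_iff_eq (card_key_pos lam n).ne', Finset.sum_comm, card_key]
  have h : ∀ b : Base lam, ∑ o, ∑ X, ∑ Z, ∑ c, (if pairDec θ b.1.1 b.hi (c - X) = o then
      A.outProb L θ b.1.1 b.hi X Z c else 0) =
      (Fintype.card (Code lam n) : ℝ) * Fintype.card (Code lam n) := by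
    intro b
    rw [Finset.sum_comm]
    have h' : ∀ X : Code lam n, ∑ o, ∑ Z, ∑ c, (if pairDec θ b.1.1 b.hi (c - X) = o then
        A.outProb L θ b.1.1 b.hi X Z c else 0) = Fintype.card (Code lam n) := by
      intro X
      rw [Finset.sum_comm]
      have h'' : ∀ Z : Code lam n, ∑ o, ∑ c, (if pairDec θ b.1.1 b.hi (c - X) = o then
          A.outProb L θ b.1.1 b.hi X Z c else 0) = 1 := by
        intro Z
        rw [Finset.sum_comm]
        simp only [Finset.sum_ite_eq, Finset.mem_univ, if_true]
        exact A.sum_outProb L θ _ _ X Z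
      rw [Finset.sum_congr rfl fun Z _ => h'' Z]
      simp
    rw [Finset.sum_congr rfl fun X _ => h' X]
    simp
  rw [Finset.sum_congr rfl fun b _ => h b]
  simp

-- The input state enters only through the law of m, and the error is drawn independently of m. This
-- is why one ε serves all ψ.
open Classical in
theorem realProb_eq (f : (Phi θ → ZMod 2) → List (ZMod 2)) (ψ : (Fin n → ZMod 2) → ℂ)
    (y : Outcome) : realProb L θ f A ψ y =
      ∑ m, ‖(onHadamard θ hadamardGate *ᵥ (basisMap (LinOp.actX L) *ᵥ ψ)) m‖ ^ 2 *
        ∑ o : Option (Phi θ → ZMod 2),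
          if o.map (fun e => f (e + restrict θ m)) = y then A.errProb L θ o else 0 := by
  rw [realProb, ← Equiv.sum_comp (frameKey L θ), Fintype.sum_prod_type]
  simp only [Fintype.sum_prod_type, sum_pads_eq]
  rw [Finset.sum_comm, Finset.sum_div]
  refine Finset.sum_congr rfl fun m _ => ?_
  rw [← Finset.mul_sum, mul_div_assoc]
  congr 1
  have hinner : ∀ (b : Base lam) (X Z c : Code lam n),
      (if (pairDec θ b.1.1 b.hi (c - X)).map (fun e => f (e + restrict θ m)) = y then
        A.outProb L θ b.1.1 b.hi X Z c else 0) =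
      ∑ o : Option (Phi θ → ZMod 2), if o.map (fun e => f (e + restrict θ m)) = y then
        (if pairDec θ b.1.1 b.hi (c - X) = o then A.outProb L θ b.1.1 b.hi X Z c else 0)
        else 0 := by
    intro b X Z c
    rw [Finset.sum_eq_single (pairDec θ b.1.1 b.hi (c - X))]
    · simp
    · intro o _ ho
      simp [ho.symm]
    · simp
  simp only [errProb, hinner]
  rw [Finset.sum_congr rfl fun b _ => (Finset.sum_congr rfl fun X _ =>
    (Finset.sum_congr rfl fun Z _ => Finset.sum_comm).trans Finset.sum_comm).trans Finset.sum_comm,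
    Finset.sum_comm, Finset.sum_div]
  refine Finset.sum_congr rfl fun o _ => ?_
  split_ifs
  · rfl
  · simp

end Adversary

open Classical in
theorem honestProb_eq (L : LinOp n) (θ : Bases n) (f : (Phi θ → ZMod 2) → List (ZMod 2))
    (ψ : (Fin n → ZMod 2) → ℂ) (y : Outcome) : honestProb L θ f ψ y =
      ∑ m, if some (f (restrict θ m)) = y then
        ‖(onHadamard θ hadamardGate *ᵥ (basisMap (LinOp.actX L) *ᵥ ψ)) m‖ ^ 2 else 0 := by
  have hmove : ∀ H D R : Matrix (Fin n → ZMod 2) (Fin n → ZMod 2) ℂ,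
      (H * D * H * R).trace = (D * (H * R * H)).trace := fun H D R => by
    rw [Matrix.mul_assoc, Matrix.mul_assoc H, Matrix.trace_mul_comm, Matrix.mul_assoc D]
  have hH := onHadamard_conjTranspose θ hadamardGate_conjTranspose
  have h := conjLin_pureDensity (onHadamard θ hadamardGate) (basisMap (LinOp.actX L) *ᵥ ψ)
  rw [conjLin_apply, hH] at h
  rw [honestProb, zxProj, hmove, h, Matrix.trace, Complex.re_sum]
  refine Finset.sum_congr rfl fun m _ => ?_
  rw [Matrix.diag_apply, Matrix.diagonal_mul, pureDensity, Matrix.vecMulVec_apply, Pi.star_apply,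
    Complex.star_def, Complex.mul_conj, Complex.normSq_eq_norm_sq]
  split_ifs
  · simp only [one_mul, Complex.ofReal_re]
  · simp

theorem sum_norm_sq_mulVec {α : Type*} [Fintype α] [DecidableEq α] {U : Matrix α α ℂ}
    (hU : Uᴴ * U = 1) (ψ : α → ℂ) : ∑ a, ‖(U *ᵥ ψ) a‖ ^ 2 = ∑ a, ‖ψ a‖ ^ 2 := by
  have h := trace_conjLin hU (pureDensity ψ)
  rw [conjLin_pureDensity, trace_pureDensity, trace_pureDensity] at h
  exact_mod_cast h

-- The error 0 reproduces the honest outcome, so only nonzero errors separate the experiment from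
-- the mixture.
open Classical in
theorem TV_le (A : Adversary lam n) (L : LinOp n) (θ : Bases n)
    (f : (Phi θ → ZMod 2) → List (ZMod 2)) {ψ : (Fin n → ZMod 2) → ℂ} (hψ : IsState ψ) :
    TV (realProb L θ f A ψ) (mixedProb L θ f (A.errProb L θ none) ψ) ≤
      2 * ∑ e, if e = 0 then 0 else A.errProb L θ (some e) := by
  have h1 : ∑ m, ‖(onHadamard θ hadamardGate *ᵥ (basisMap (LinOp.actX L) *ᵥ ψ)) m‖ ^ 2 = 1 := by
    rw [sum_norm_sq_mulVec, sum_norm_sq_mulVec]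
    · exact hψ
    · exact basisMap_isometry (L.equivX (ZMod 2)).injective
    · rw [onHadamard_conjTranspose θ hadamardGate_conjTranspose,
        onHadamard_mul_self θ hadamardGate_mul_self]
  have h := tsum_abs_mixture_le (fun m => sq_nonneg _) h1 (A.errProb_nonneg L θ)
    (A.sum_errProb L θ) (fun e m => f (e + restrict θ m)) 0
  simp only [zero_add] at h
  simp only [TV, mixedProb, Adversary.realProb_eq, honestProb_eq]
  convert h

end Distance

/-! ### Averaging coset states over the pads -/

section Swap

variable {lam n : ℕ}

open Classical in
theorem sum_indicator_sub_mem {W₀ W : Submodule (ZMod 2) (Code lam n)} (h : W₀ ≤ W)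
    (v : Code lam n) : ∑ s, (if s ∈ W then if v - s ∈ W₀ then (1 : ℂ) else 0 else 0) =
      if v ∈ W then (Nat.card W₀ : ℂ) else 0 := by
  have e : ∀ s, (if s ∈ W then if v - s ∈ W₀ then (1 : ℂ) else 0 else 0) =
      if v ∈ W then if v - s ∈ W₀ then 1 else 0 else 0 := by
    intro s
    by_cases hs : v - s ∈ W₀
    · have : s ∈ W ↔ v ∈ W := by
        have := W.add_mem_iff_right (h hs) (y := s)
        rwa [sub_add_cancel, Iff.comm] at this
      simp [hs, this]
    · simp [hs]
  rw [Finset.sum_congr rfl fun s _ => e s]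
  split_ifs with hv
  · refine (Fintype.sum_equiv (Equiv.subLeft v) _ (fun w => if w ∈ W₀ then (1 : ℂ) else 0)
      fun s => rfl).trans ?_
    rw [← Finset.sum_filter, Finset.sum_const, nsmul_eq_mul, mul_one,
      ← Fintype.card_subtype, ← Nat.card_eq_fintype_card]
  · simp

open Classical in
theorem pureDensity_cosetVec_apply (V : Submodule (ZMod 2) (Code lam n)) (X Z c c' : Code lam n) :
    pureDensity (cosetVec V X Z) c c' =
      if c - X ∈ V ∧ c' - X ∈ V then (1 / Nat.card V : ℂ) * bitSign (pair Z (c - c')) else 0 := by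
  have hN : ((1 / Real.sqrt (Nat.card V) : ℝ) : ℂ) * ((1 / Real.sqrt (Nat.card V) : ℝ) : ℂ) =
      1 / Nat.card V := by
    rw [← Complex.ofReal_mul, div_mul_div_comm, Real.mul_self_sqrt (Nat.cast_nonneg _)]
    simp
  have hb : bitSign (pair Z (c - c')) = bitSign (pair Z (c - X)) * bitSign (pair Z (c' - X)) := by
    rw [← bitSign_add, ← pair_add]
    congr 2
    rw [ZModModule.sub_eq_add, ZModModule.sub_eq_add, ZModModule.sub_eq_add, add_add_add_comm,
      ZModModule.add_self, add_zero]
  simp only [pureDensity, Matrix.vecMulVec_apply, Pi.star_apply, cosetVec]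
  by_cases h1 : c - X ∈ V <;> by_cases h2 : c' - X ∈ V <;>
    simp only [h1, h2, if_true, if_false, and_true, and_false, star_zero, mul_zero, zero_mul]
  rw [hb, ← hN, star_mul', star_bitSign, Complex.star_def, Complex.conj_ofReal]
  ring

-- Averaging the phases over R keeps only the entries with c − c' ∈ R^⊥ = W₀, and averaging the
-- translations over W spreads the diagonal evenly over the coset of W. Either family ends up with
-- the same matrix, the normalization compensating for the size of the subspace.
open Classical in
theorem sum_pureDensity_cosetVec {W₀ W R : Submodule (ZMod 2) (Code lam n)} (h : W₀ ≤ W)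
    (hR : ∀ w, w ∈ W₀ ↔ ∀ r ∈ R, pair r w = 0) (X Z : Code lam n) :
    (∑ s, ∑ r, if s ∈ W then if r ∈ R then
        pureDensity (cosetVec W (X + s) (Z + r)) else 0 else 0) =
      ∑ s, ∑ r, if s ∈ W then if r ∈ R then
        pureDensity (cosetVec W₀ (X + s) (Z + r)) else 0 else 0 := by
  ext c c'
  have hchar := sum_bitSign_submodule R
    { toFun := fun r => pair r (c - c'), map_zero' := zero_pair _,
      map_add' := fun a b => add_pair a b _ }
  simp only [AddMonoidHom.coe_mk, ZeroHom.coe_mk, ← hR] at hchar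
  have key : ∀ V : Submodule (ZMod 2) (Code lam n),
      (∑ s, ∑ r, if s ∈ W then if r ∈ R then
        pureDensity (cosetVec V (X + s) (Z + r)) else 0 else 0) c c' =
      (∑ s, if s ∈ W then if c - X - s ∈ V ∧ c' - X - s ∈ V then (1 : ℂ) else 0 else 0) *
        ((1 / Nat.card V : ℂ) * bitSign (pair Z (c - c')) *
          if c - c' ∈ W₀ then (Nat.card R : ℂ) else 0) := by
    intro V
    rw [← hchar, Finset.sum_mul, Matrix.sum_apply]
    refine Finset.sum_congr rfl fun s _ => ?_
    rw [Matrix.sum_apply, Finset.mul_sum, Finset.mul_sum]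
    refine Finset.sum_congr rfl fun r _ => ?_
    have hz : (0 : Matrix (Code lam n) (Code lam n) ℂ) c c' = 0 := rfl
    by_cases hs : s ∈ W
    · by_cases hr : r ∈ R
      · simp only [hs, hr, if_true, pureDensity_cosetVec_apply, add_pair, bitSign_add, ← sub_sub]
        split_ifs <;> ring
      · simp only [hs, hr, if_true, if_false, hz, mul_zero]
    · simp only [hs, if_false, hz, zero_mul]
  rw [key, key]
  by_cases hc : c - c' ∈ W₀
  · have hW : ∀ V : Submodule (ZMod 2) (Code lam n), W₀ ≤ V → ∀ s,
        (c - X - s ∈ V ∧ c' - X - s ∈ V ↔ c - X - s ∈ V) := by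
      intro V hV s
      refine and_iff_left_of_imp fun h' => ?_
      have := V.sub_mem h' (hV hc)
      convert this using 1
      abel
    have hcard : ∀ V : Submodule (ZMod 2) (Code lam n), (Nat.card V : ℂ) ≠ 0 := fun V => by
      exact_mod_cast Nat.card_pos.ne'
    simp only [hW W h, hW W₀ le_rfl, sum_indicator_sub_mem h, sum_indicator_sub_mem le_rfl]
    split_ifs
    · have h1 := hcard W
      have h2 := hcard W₀
      field_simp
    · ring
  · simp only [hc, if_false, mul_zero]

open Classical in
/-- If `F X Z` only depends on `X` modulo `W` and on `Z` modulo `R`, averaging over the pads does not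
distinguish the coset states of `W` and of `W₀ = R^⊥ ≤ W`. -/
theorem sum_cosetVec_swap {W₀ W R : Submodule (ZMod 2) (Code lam n)} (h : W₀ ≤ W)
    (hR : ∀ w, w ∈ W₀ ↔ ∀ r ∈ R, pair r w = 0)
    (F : Code lam n → Code lam n → Matrix (Code lam n) (Code lam n) ℂ →ₗ[ℂ] ℂ)
    (hF : ∀ X Z, ∀ s ∈ W, ∀ r ∈ R, F (X + s) (Z + r) = F X Z) :
    ∑ X, ∑ Z, F X Z (pureDensity (cosetVec W X Z)) =
      ∑ X, ∑ Z, F X Z (pureDensity (cosetVec W₀ X Z)) := by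
  -- Invariance of F lets each pair of pads be replaced by its average over W × R, where the two
  -- coset states have become equal.
  have key : ∀ V : Submodule (ZMod 2) (Code lam n),
      (Nat.card W : ℂ) * Nat.card R * ∑ X, ∑ Z, F X Z (pureDensity (cosetVec V X Z)) =
        ∑ X, ∑ Z, F X Z (∑ s, ∑ r, if s ∈ W then if r ∈ R then
          pureDensity (cosetVec V (X + s) (Z + r)) else 0 else 0) := by
    intro V
    have hcard : ∀ U : Submodule (ZMod 2) (Code lam n),
        (Nat.card U : ℂ) = ∑ s, if s ∈ U then 1 else 0 := fun U => by
      rw [← Finset.sum_filter, Finset.sum_const, nsmul_eq_mul, mul_one,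
        ← Fintype.card_subtype, ← Nat.card_eq_fintype_card]
    have hsr : ∀ s r, (if s ∈ W then (1 : ℂ) else 0) * (if r ∈ R then 1 else 0) *
        ∑ X, ∑ Z, F X Z (pureDensity (cosetVec V X Z)) =
        ∑ X, ∑ Z, F X Z (if s ∈ W then if r ∈ R then
          pureDensity (cosetVec V (X + s) (Z + r)) else 0 else 0) := by
      intro s r
      by_cases hs : s ∈ W
      · by_cases hr : r ∈ R
        · simp only [hs, hr, if_true, one_mul]
          rw [← Equiv.sum_comp (Equiv.addRight s)]
          refine Finset.sum_congr rfl fun X _ => ?_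
          rw [← Equiv.sum_comp (Equiv.addRight r)]
          refine Finset.sum_congr rfl fun Z _ => ?_
          rw [Equiv.coe_addRight, Equiv.coe_addRight, hF X Z s hs r hr]
        · simp [hr]
      · simp [hs]
    rw [hcard W, hcard R, Finset.sum_mul_sum, Finset.sum_mul]
    simp only [Finset.sum_mul, hsr, map_sum]
    rw [Finset.sum_congr rfl fun s _ => Finset.sum_comm.trans
      (Finset.sum_congr rfl fun X _ => Finset.sum_comm), Finset.sum_comm]
    exact Finset.sum_congr rfl fun X _ => Finset.sum_comm
  have hne : (Nat.card W : ℂ) * Nat.card R ≠ 0 :=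
    mul_ne_zero (by exact_mod_cast Nat.card_pos.ne') (by exact_mod_cast Nat.card_pos.ne')
  refine mul_left_cancel₀ hne ?_
  rw [key, key]
  simp only [sum_pureDensity_cosetVec h hR]

/-- Orthogonality of product spaces is blockwise, tested on words supported on one block. It
supplies the hypothesis W₀ = R^⊥ of the swap. -/
theorem mem_frame_iff_pair {θ : Bases n} {P Q : Submodule (ZMod 2) (Vec lam)} (w : Code lam n) :
    w ∈ frame θ P (perp Q) ↔ ∀ r ∈ frame θ (perp P) Q, pair r w = 0 := by
  constructor
  · intro hw r hr
    rw [mem_frame] at hw hr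
    refine Finset.sum_eq_zero fun i _ => ?_
    have h1 := hw i
    have h2 := hr i
    split_ifs at h1 h2
    · exact h1 _ h2
    · rw [dotProduct_comm]; exact h2 _ h1
  · intro h
    rw [mem_frame]
    intro i
    have hi : ∀ v, v ∈ (if θ i = some 1 then Q else perp P) → v ⬝ᵥ w i = 0 := by
      intro v hv
      have := h (Pi.single i v) (mem_frame.2 fun j => by
        by_cases hj : j = i
        · subst hj; rwa [Pi.single_eq_same]
        · rw [Pi.single_eq_of_ne hj]; exact zero_mem _)
      rw [pair, Finset.sum_eq_single i] at this
      · rwa [Pi.single_eq_same] at this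
      · intro j _ hj; rw [Pi.single_eq_of_ne hj, zero_dotProduct]
      · simp
    split_ifs at hi ⊢
    · exact hi
    · rw [← perp_perp P]; exact hi

end Swap

/-! ### Hiding the subspaces from the adversary -/

section Hiding

variable {lam n : ℕ}

/-- `M₁`, or its counterpart for the dual pair `(M₂^⊥, M₁^⊥)`. -/
def loPart (t : Bool) (M₁ M₂ : Submodule (ZMod 2) (Vec lam)) : Submodule (ZMod 2) (Vec lam) :=
  if t then perp M₂ else M₁

/-- `M₂`, or its counterpart for the dual pair `(M₂^⊥, M₁^⊥)`. -/
def hiPart (t : Bool) (M₁ M₂ : Submodule (ZMod 2) (Vec lam)) : Submodule (ZMod 2) (Vec lam) :=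
  if t then perp M₁ else M₂

theorem loPart_glMap (t : Bool) (g : GL (Fin (2 * lam + 1)) (ZMod 2))
    (M₁ M₂ : Submodule (ZMod 2) (Vec lam)) :
    loPart t (glMap g M₁) (glMap g M₂) = glMap (dualAct t g) (loPart t M₁ M₂) := by
  cases t
  · rfl
  · exact perp_glMap g M₂

theorem hiPart_glMap (t : Bool) (g : GL (Fin (2 * lam + 1)) (ZMod 2))
    (M₁ M₂ : Submodule (ZMod 2) (Vec lam)) :
    hiPart t (glMap g M₁) (glMap g M₂) = glMap (dualAct t g) (hiPart t M₁ M₂) := by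
  cases t
  · rfl
  · exact perp_glMap g M₁

/-- The decoding of `w` is neither `0` nor `⊥`. -/
def IsWrong (θ : Bases n) (M₁ M₂ : Submodule (ZMod 2) (Vec lam)) (w : Code lam n) : Prop :=
  (∃ i : Phi θ, w i ∉ loPart (decide (θ i = some 1)) M₁ M₂) ∧
    ∀ i : Phi θ, w i ∈ hiPart (decide (θ i = some 1)) M₁ M₂

theorem ite_eq_loPart (p : Prop) [Decidable p] (M₁ M₂ : Submodule (ZMod 2) (Vec lam)) :
    (if p then perp M₂ else M₁) = loPart (decide p) M₁ M₂ := by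
  by_cases h : p <;> simp [loPart, h]

theorem isWrong_of_pairDec {θ : Bases n} {M₁ M₂ : Submodule (ZMod 2) (Vec lam)} {w : Code lam n}
    {e : Phi θ → ZMod 2} (he : e ≠ 0) (h : pairDec θ M₁ M₂ w = some e) : IsWrong θ M₁ M₂ w := by
  classical
  simp only [pairDec, frameDec, ite_eq_loPart] at h
  split_ifs at h with hall
  refine ⟨?_, hall⟩
  by_contra! hn
  refine he ?_
  rw [← Option.some.inj h]
  funext i
  exact if_pos (hn i)

/-- The swap of coset states needs an event that depends on X only modulo lo. -/
theorem isWrong_add_iff {θ : Bases n} {M₁ M₂ : Submodule (ZMod 2) (Vec lam)} (hM : M₁ ≤ M₂)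
    {s : Code lam n} (hs : s ∈ frame θ M₁ (perp M₂)) (w : Code lam n) :
    IsWrong θ M₁ M₂ (w + s) ↔ IsWrong θ M₁ M₂ w := by
  rw [mem_frame] at hs
  simp only [ite_eq_loPart] at hs
  have hle : ∀ t, loPart t M₁ M₂ ≤ hiPart t M₁ M₂ := fun t => by
    cases t
    · exact hM
    · exact perp_anti hM
  simp only [IsWrong, Pi.add_apply, fun i : Phi θ => Submodule.add_mem_iff_left _ (hs i) (x := w i),
    fun i : Phi θ => Submodule.add_mem_iff_left _ (hle _ (hs i)) (x := w i)]

/-- The diagonal entry at `c` as a linear functional. -/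
def diagEntry (c : Code lam n) : Matrix (Code lam n) (Code lam n) ℂ →ₗ[ℂ] ℂ where
  toFun σ := σ c c
  map_add' _ _ := rfl
  map_smul' _ _ := rfl

namespace Adversary

variable (A : Adversary lam n) (L : LinOp n) (θ : Bases n)

open Classical in
/-- The joint state of all registers after the first `j` calls of the oracle. -/
def midState (j : ℕ) (M₁ M₂ : Submodule (ZMod 2) (Vec lam)) (X Z : Code lam n) :
    Matrix (Code lam n × A.Aux) (Code lam n × A.Aux) ℂ :=
  evolve (A.oracleMat (frameOracle L θ M₂ (perp M₁) X Z)) (A.rest.take j)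
    (A.prepare L θ (pureDensity (cosetVec (frame θ M₁ (perp M₂)) X Z)))

open Classical in
theorem midState_posSemidef (j : ℕ) (M₁ M₂ : Submodule (ZMod 2) (Vec lam)) (X Z : Code lam n) :
    (A.midState L θ j M₁ M₂ X Z).PosSemidef :=
  evolve_posSemidef _ _ (A.prepare_posSemidef L θ (pureDensity_posSemidef _))

open Classical in
theorem sum_midState (j : ℕ) (M₁ M₂ : Submodule (ZMod 2) (Vec lam)) (X Z : Code lam n) :
    ∑ s, (A.midState L θ j M₁ M₂ X Z s s).re = 1 := by
  have h : (A.midState L θ j M₁ M₂ X Z).trace = 1 := by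
    rw [midState, trace_evolve (A.oracleMat_isometry _), trace_prepare, trace_pureDensity,
      sum_norm_sq_cosetVec, Complex.ofReal_one]
  have h' := congrArg Complex.re h
  rw [Matrix.trace, Complex.re_sum] at h'
  exact h'

/-- The probability of the measured word `c` in the run on `X^X Z^Z |lo⟩`, with `lo` given by
`(M₁, M₂)` and the oracle given by `(N₁, N₂)`. -/
def hybridProb (M₁ M₂ N₁ N₂ : Submodule (ZMod 2) (Vec lam)) (X Z c : Code lam n) : ℝ :=
  (A.frameRun L θ (frameOracle L θ N₂ (perp N₁) X Z)
    (pureDensity (cosetVec (frame θ M₁ (perp M₂)) X Z)) c c).re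

-- The hybrid inequality, with the functional that measures E. The disagreement of the oracles is
-- weighed on states of the run with (M₁, M₂) alone, so (N₁, N₂) can afterwards be randomized
-- without changing these states.
open Classical in
theorem sum_outProb_le_hybrid (M₁ M₂ N₁ N₂ : Submodule (ZMod 2) (Vec lam)) (X Z : Code lam n)
    (E : Code lam n → Prop) {t : ℝ} (ht : 0 < t) :
    ∑ c, (if E c then A.outProb L θ M₁ M₂ X Z c else 0) ≤
      (1 + t) ^ A.numQueries * ∑ c, (if E c then A.hybridProb L θ M₁ M₂ N₁ N₂ X Z c else 0) +
      (1 + t) ^ A.numQueries * (1 + 1 / t) * ∑ j ∈ Finset.range A.numQueries, 4 * ∑ s,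
        if frameOracle L θ M₂ (perp M₁) X Z s.2.1.1 ≠ frameOracle L θ N₂ (perp N₁) X Z s.2.1.1 then
          (A.midState L θ j M₁ M₂ X Z s s).re else 0 := by
  let Λ₀ : Matrix (Code lam n) (Code lam n) ℂ →ₗ[ℂ] ℂ := ∑ c, if E c then diagEntry c else 0
  let Λ := Λ₀ ∘ₗ A.finish θ
  have hΛ₀ : ∀ σ, (Λ₀ σ).re = ∑ c, if E c then (σ c c).re else 0 := fun σ => by
    simp only [Λ₀, LinearMap.sum_apply, Complex.re_sum]
    refine Finset.sum_congr rfl fun c _ => ?_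
    split_ifs
    · rfl
    · simp
  have h := evolve_le_evolve (O := A.oracleMat (frameOracle L θ M₂ (perp M₁) X Z))
    (A.oracleMat_isometry (frameOracle L θ N₂ (perp N₁) X Z)) ht Λ
    (fun ρ hρ => by
      change 0 ≤ (Λ₀ (A.finish θ ρ)).re
      rw [hΛ₀]
      refine Finset.sum_nonneg fun c _ => ?_
      split_ifs
      exacts [re_diag_nonneg (A.finish_posSemidef θ hρ) c, le_rfl])
    (fun ρ hρ => by
      change (Λ₀ (A.finish θ ρ)).re ≤ _
      rw [hΛ₀, ← A.trace_finish θ, Matrix.trace, Complex.re_sum]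
      refine Finset.sum_le_sum fun c _ => ?_
      split_ifs
      exacts [le_rfl, re_diag_nonneg (A.finish_posSemidef θ hρ) c])
    A.rest (A.prepare_posSemidef L θ (pureDensity_posSemidef
      (cosetVec (frame θ M₁ (perp M₂)) X Z)))
  have e1 : ∀ v σ, (Λ (evolve (A.oracleMat v) A.rest (A.prepare L θ σ))).re =
      ∑ c, if E c then (A.frameRun L θ v σ c c).re else 0 := fun v σ => hΛ₀ _
  rw [e1, e1] at h
  refine h.trans (add_le_add le_rfl ?_)
  refine mul_le_mul_of_nonneg_left ?_ (by positivity)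
  refine Finset.sum_le_sum fun j _ => ?_
  exact A.trace_conjLin_oracleMat_sub_le _ _ (A.midState_posSemidef L θ j M₁ M₂ X Z)

-- The oracle for (S₀, T) ignores translations of X along the frame of (S, S'^⊥) and shifts of Z
-- along that of (S₀^⊥, T), which is what the swap requires. Afterwards S and S' occur only in the
-- event, no longer in the adversary's run.
open Classical in
theorem sum_hybridProb_eq {S₀ S S' T : Submodule (ZMod 2) (Vec lam)} (h₀ : S₀ ≤ S) (h : S ≤ S')
    (h' : S' ≤ T) :
    ∑ X, ∑ Z, ∑ c, (if IsWrong θ S S' (c - X) then A.hybridProb L θ S S' S₀ T X Z c else 0) =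
      ∑ X, ∑ Z, ∑ c, if IsWrong θ S S' (c - X) then A.outProb L θ S₀ T X Z c else 0 := by
  let F : Code lam n → Code lam n → Matrix (Code lam n) (Code lam n) ℂ →ₗ[ℂ] ℂ := fun X Z =>
    (∑ c, if IsWrong θ S S' (c - X) then diagEntry c else 0) ∘ₗ
      A.frameRun L θ (frameOracle L θ T (perp S₀) X Z)
  have hF : ∀ X Z σ, (F X Z σ).re = ∑ c, if IsWrong θ S S' (c - X) then
      (A.frameRun L θ (frameOracle L θ T (perp S₀) X Z) σ c c).re else 0 := fun X Z σ => by
    simp only [F, LinearMap.comp_apply, LinearMap.sum_apply, Complex.re_sum]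
    refine Finset.sum_congr rfl fun c _ => ?_
    split_ifs
    · rfl
    · simp
  have key := sum_cosetVec_swap (W₀ := frame θ S₀ (perp T)) (W := frame θ S (perp S'))
    (R := frame θ (perp S₀) T) (frame_mono h₀ (perp_anti h')) mem_frame_iff_pair F
    (fun X Z s hs r hr => by
      have h1 : frameOracle L θ T (perp S₀) (X + s) (Z + r) =
          frameOracle L θ T (perp S₀) X Z :=
        frameOracle_congr
          (by rw [add_sub_cancel_left]; exact frame_mono (h.trans h') (perp_anti (h₀.trans h)) hs)
          (by rw [add_sub_cancel_left]; exact hr)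
      have h2 : ∀ c, IsWrong θ S S' (c - (X + s)) ↔ IsWrong θ S S' (c - X) := fun c => by
        rw [← isWrong_add_iff h hs (c - (X + s))]
        congr! 1
        abel
      simp only [F, h1, h2])
  have key' := congrArg Complex.re key
  simp only [Complex.re_sum, hF] at key'
  exact key'

end Adversary

end Hiding

/-! ### Averaging over the subspaces -/

section Averaging

variable {lam n : ℕ}

theorem loPart_mono (t : Bool) {M₁ M₁' M₂ M₂' : Submodule (ZMod 2) (Vec lam)} (h₁ : M₁ ≤ M₁')
    (h₂ : M₂' ≤ M₂) : loPart t M₁ M₂ ≤ loPart t M₁' M₂' := by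
  cases t
  · exact h₁
  · exact perp_anti h₂

theorem hiPart_mono (t : Bool) {M₁ M₁' M₂ M₂' : Submodule (ZMod 2) (Vec lam)} (h₁ : M₁' ≤ M₁)
    (h₂ : M₂ ≤ M₂') : hiPart t M₁ M₂ ≤ hiPart t M₁' M₂' := by
  cases t
  · exact h₂
  · exact perp_anti h₁

theorem loPart_le_hiPart (t : Bool) {M₁ M₂ : Submodule (ZMod 2) (Vec lam)} (h : M₁ ≤ M₂) :
    loPart t M₁ M₂ ≤ hiPart t M₁ M₂ := by
  cases t
  · exact h
  · exact perp_anti h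

theorem natCard_loPart (t : Bool) {M₁ M₂ : Submodule (ZMod 2) (Vec lam)} {k : ℕ}
    (h₁ : Module.finrank (ZMod 2) M₁ = k) (h₂ : Module.finrank (ZMod 2) M₂ = 2 * lam + 1 - k) :
    Nat.card (loPart t M₁ M₂) = 2 ^ k := by
  have h : k ≤ 2 * lam + 1 := by
    rw [← h₁]; simpa only [Module.finrank_fin_fun] using Submodule.finrank_le M₁
  rw [natCard_submodule]
  congr 1
  cases t
  · exact h₁
  · exact (finrank_perp M₂).trans ((congrArg (2 * lam + 1 - ·) h₂).trans (Nat.sub_sub_self h))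

theorem natCard_hiPart (t : Bool) {M₁ M₂ : Submodule (ZMod 2) (Vec lam)} {k : ℕ}
    (h₁ : Module.finrank (ZMod 2) M₁ = k) (h₂ : Module.finrank (ZMod 2) M₂ = 2 * lam + 1 - k) :
    Nat.card (hiPart t M₁ M₂) = 2 ^ (2 * lam + 1 - k) := by
  rw [natCard_submodule]
  congr 1
  cases t
  · exact h₂
  · exact (finrank_perp M₁).trans (congrArg (2 * lam + 1 - ·) h₁)

/-- The action of the general linear group on pairs `(S, Δ)`. -/
def Base.act (g : GL (Fin (2 * lam + 1)) (ZMod 2)) (b : Base lam) : Base lam :=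
  ⟨(glMap g b.1.1, g.1 *ᵥ b.1.2), (finrank_glMap g _).trans b.2.1, fun h =>
    b.2.2 (by rw [mem_glMap, inv_mulVec_mulVec] at h; exact h)⟩

theorem Base.hi_act (g : GL (Fin (2 * lam + 1)) (ZMod 2)) (b : Base lam) :
    (b.act g).hi = glMap g b.hi := by
  rw [Base.hi, Base.hi, glMap_sup]
  congr 1
  rw [glMap, Submodule.map_span, Set.image_singleton]
  rfl

theorem Base.act_injective (g : GL (Fin (2 * lam + 1)) (ZMod 2)) :
    Function.Injective (Base.act (lam := lam) g) := by
  intro b b' h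
  have h1 : glMap g b.1.1 = glMap g b'.1.1 := congrArg (fun p : Base lam => p.1.1) h
  have h2 : g.1 *ᵥ b.1.2 = g.1 *ᵥ b'.1.2 := congrArg (fun p : Base lam => p.1.2) h
  refine Subtype.ext (Prod.ext ?_ ?_)
  · ext v
    have h3 : g.1 *ᵥ v ∈ glMap g b.1.1 ↔ g.1 *ᵥ v ∈ glMap g b'.1.1 := by rw [h1]
    simpa only [mem_glMap, inv_mulVec_mulVec] using h3
  · rw [← inv_mulVec_mulVec g b.1.2, h2, inv_mulVec_mulVec]

theorem finrank_hi (b : Base lam) : Module.finrank (ZMod 2) b.hi = lam + 1 := by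
  rw [Base.hi, Submodule.finrank_sup_span_singleton b.2.2, b.2.1]

/-- Each g permutes the pairs (S, Δ), so the uniform choice of a pair can be followed by a uniform
g. -/
theorem card_mul_sum_base
    (φ : Submodule (ZMod 2) (Vec lam) → Submodule (ZMod 2) (Vec lam) → ℝ) :
    (Fintype.card (GL (Fin (2 * lam + 1)) (ZMod 2)) : ℝ) * ∑ b : Base lam, φ b.1.1 b.hi =
      ∑ b : Base lam, ∑ g : GL (Fin (2 * lam + 1)) (ZMod 2),
        φ (glMap g b.1.1) (glMap g b.hi) := by
  have h : ∀ g : GL (Fin (2 * lam + 1)) (ZMod 2),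
      ∑ b : Base lam, φ (glMap g b.1.1) (glMap g b.hi) = ∑ b : Base lam, φ b.1.1 b.hi := by
    intro g
    refine Fintype.sum_bijective (Base.act g)
      (Finite.injective_iff_bijective.1 (Base.act_injective g)) _ _ fun b => ?_
    rw [Base.hi_act]
    rfl
  rw [Finset.sum_comm, Finset.sum_congr rfl fun g _ => h g, Finset.sum_const, nsmul_eq_mul]
  rfl

/-- The accepting sets are nested, so a disagreement means that the larger test accepts and the
smaller one rejects. -/
theorem exists_of_frameOracle_ne {L : LinOp n} {θ : Bases n}
    {S₀ S S' T : Submodule (ZMod 2) (Vec lam)} (h₀ : S₀ ≤ S) (h' : S' ≤ T) {X Z : Code lam n}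
    {q : Query lam n}
    (h : frameOracle L θ S' (perp S) X Z q ≠ frameOracle L θ T (perp S₀) X Z q) :
    (∃ i : Phi q.θ, q.c i - (if q.θ i = some 0 then LinOp.actX q.L (padX L θ X Z) i
        else LinOp.actZ q.L (padZ L θ X Z) i) ∉ hiPart (!decide (q.θ i = some 0)) S S') ∧
      ∀ i : Phi q.θ, q.c i - (if q.θ i = some 0 then LinOp.actX q.L (padX L θ X Z) i
        else LinOp.actZ q.L (padZ L θ X Z) i) ∈ hiPart (!decide (q.θ i = some 0)) S₀ T := by
  classical
  have e : ∀ (p : Prop) [Decidable p] (M₁ M₂ : Submodule (ZMod 2) (Vec lam)),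
      (if p then M₂ else perp M₁) = hiPart (!decide p) M₁ M₂ := fun p _ M₁ M₂ => by
    by_cases hp : p <;> simp [hiPart, hp]
  simp only [frameOracle, verSub, e, ne_eq, decide_eq_decide] at h
  by_contra hn
  refine h ⟨fun hr i => hiPart_mono _ h₀ h' (hr i), fun hi => ?_⟩
  by_contra hr
  push Not at hr
  exact hn ⟨hr, hi⟩

/-- The bound on the probability of an undetected error, as a function of the number `q` of
queries, the codimension `d` of the surrogate subspaces and the tradeoff parameter `t`. -/
def wrongBound (lam d q : ℕ) (t : ℝ) : ℝ :=
  (1 + t) ^ q * (2 / 2 ^ d + (1 + 1 / t) * (q * (4 * (2 * 2 ^ d / 2 ^ lam))))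

namespace Adversary

variable (A : Adversary lam n) (L : LinOp n) (θ : Bases n)

-- Here (S₀, T) are the known subspaces and S, S' random between them. A block of a wrong word that
-- avoids `loPart` of (S, S') also avoids `loPart` of (S₀, T), and must hit `hiPart` of (S, S'). The
-- bound is proved for each measured word separately and then summed against its probability.
open Classical in
theorem sum_isWrong_outProb_le {S₀ S S' T : Submodule (ZMod 2) (Vec lam)} {d : ℕ} (hd : d ≤ lam)
    (h₀ : S₀ ≤ S) (h : S ≤ S') (h' : S' ≤ T) (hS : Module.finrank (ZMod 2) S = lam)
    (hS' : Module.finrank (ZMod 2) S' = lam + 1) (hS₀ : Module.finrank (ZMod 2) S₀ = lam - d)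
    (hT : Module.finrank (ZMod 2) T = lam + 1 + d) (X Z : Code lam n) :
    ∑ g : GL (Fin (2 * lam + 1)) (ZMod 2), ∑ c, (if IsWrong θ (glMap g S) (glMap g S') (c - X) then
        A.outProb L θ (glMap g S₀) (glMap g T) X Z c else 0) ≤
      2 / 2 ^ d * Fintype.card (GL (Fin (2 * lam + 1)) (ZMod 2)) := by
  have key : ∀ c : Code lam n, ∑ g : GL (Fin (2 * lam + 1)) (ZMod 2),
      (if IsWrong θ (glMap g S) (glMap g S') (c - X) then
        A.outProb L θ (glMap g S₀) (glMap g T) X Z c else 0) ≤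
      2 / 2 ^ d * ∑ g : GL (Fin (2 * lam + 1)) (ZMod 2),
        A.outProb L θ (glMap g S₀) (glMap g T) X Z c := by
    intro c
    have hle := (h₀.trans h).trans h'
    have hpow : (2 : ℕ) ^ (lam - d) < 2 ^ (lam + 1 + d) :=
      Nat.pow_lt_pow_right (by norm_num) (by omega)
    have hA : ∀ t, Nat.card (loPart t S₀ T) = 2 ^ (lam - d) := fun t =>
      natCard_loPart t hS₀ (by omega)
    have hB : ∀ t, Nat.card (hiPart t S₀ T) = 2 ^ (lam + 1 + d) := fun t => by
      rw [natCard_hiPart t hS₀ (by omega)]; congr 1; omega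
    have hC : ∀ t, Nat.card (hiPart t S S') = 2 ^ (lam + 1) := fun t => by
      rw [natCard_hiPart t hS (by omega)]; congr 1; omega
    have hev := sum_event_le (A := fun t => loPart t S₀ T) (B := fun t => hiPart t S₀ T)
      (C := fun t => hiPart t S S') (M₁ := S₀) (M₂ := T) (r := 2 / 2 ^ d) (by positivity)
      (fun t => loPart_le_hiPart t hle) (fun t => hiPart_mono t h₀ h')
      (fun t => by cases t; exacts [Or.inl le_rfl, Or.inr le_rfl])
      (fun t => by cases t; exacts [Or.inr le_rfl, Or.inl le_rfl])
      loPart hiPart (fun t g => loPart_glMap t g S₀ T) (fun t g => hiPart_glMap t g S₀ T)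
      (fun t => by simp only [hA, hB]; exact hpow)
      (fun t => by
        simp only [hA, hB, hC]
        push_cast
        -- There are at least 2^{λ+d} positions in `hiPart` outside `loPart` of (S₀, T), and
        -- `hiPart` of (S, S') has 2^{λ+1} elements; the ratio is 2/2^d.
        have h1 : (2 : ℝ) ^ (lam - d) ≤ 2 ^ (lam + d) :=
          pow_le_pow_right₀ (by norm_num) (by omega)
        have h2 : (2 : ℝ) ^ (lam + 1 + d) = 2 * 2 ^ (lam + d) := by ring
        have h3 : (2 : ℝ) ^ (lam + 1) = 2 / 2 ^ d * 2 ^ (lam + d) := by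
          rw [pow_add 2 lam d]; field_simp; ring
        rw [h3, h2]
        exact mul_le_mul_of_nonneg_left (by linarith) (by positivity))
      (I := Phi θ) (fun i => (c - X) i) (fun i => decide (θ i = some 1))
      (fun P Q => A.outProb L θ P Q X Z c) (fun P Q => A.outProb_nonneg L θ _ _ _ _ _)
    refine le_trans (Finset.sum_le_sum fun g _ => ?_) hev
    by_cases hw : IsWrong θ (glMap g S) (glMap g S') (c - X)
    · rw [if_pos hw, if_pos]
      obtain ⟨⟨i, hi⟩, hall⟩ := hw
      refine ⟨⟨i, fun hc => hi ?_⟩, fun i => ?_⟩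
      · rw [← loPart_glMap] at hc
        exact loPart_mono _ (glMap_mono g h₀) (glMap_mono g h') hc
      · rw [← hiPart_glMap]
        exact hall i
    · rw [if_neg hw]
      split_ifs
      exacts [A.outProb_nonneg L θ _ _ _ _ _, le_rfl]
  rw [Finset.sum_comm]
  refine (Finset.sum_le_sum fun c _ => key c).trans (le_of_eq ?_)
  rw [← Finset.mul_sum, Finset.sum_comm]
  simp only [A.sum_outProb, Finset.sum_const, nsmul_eq_mul, mul_one]
  rfl

-- Here the roles are reversed: (S, S') are known, they determine the intermediate state for fixed
-- pads, and the larger test spaces are random. A rejected block lies outside `hiPart` of (S, S')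
-- and must fall into `hiPart` of (S₀, T), with no other constraint, so B is the whole space.
open Classical in
theorem sum_frameOracle_ne_le {S₀ S S' T : Submodule (ZMod 2) (Vec lam)} {d : ℕ} (hd : d ≤ lam)
    (hl : 1 ≤ lam) (h₀ : S₀ ≤ S) (h : S ≤ S') (h' : S' ≤ T)
    (hS : Module.finrank (ZMod 2) S = lam) (hS' : Module.finrank (ZMod 2) S' = lam + 1)
    (hS₀ : Module.finrank (ZMod 2) S₀ = lam - d) (hT : Module.finrank (ZMod 2) T = lam + 1 + d)
    (j : ℕ) (X Z : Code lam n) :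
    ∑ g : GL (Fin (2 * lam + 1)) (ZMod 2), ∑ s,
      (if frameOracle L θ (glMap g S') (perp (glMap g S)) X Z s.2.1.1 ≠
          frameOracle L θ (glMap g T) (perp (glMap g S₀)) X Z s.2.1.1 then
        (A.midState L θ j (glMap g S) (glMap g S') X Z s s).re else 0) ≤
      2 * 2 ^ d / 2 ^ lam * Fintype.card (GL (Fin (2 * lam + 1)) (ZMod 2)) := by
  have hnn : ∀ M₁ M₂ s, 0 ≤ (A.midState L θ j M₁ M₂ X Z s s).re := fun M₁ M₂ s =>
    re_diag_nonneg (A.midState_posSemidef L θ j M₁ M₂ X Z) s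
  have key : ∀ s : Code lam n × A.Aux, ∑ g : GL (Fin (2 * lam + 1)) (ZMod 2),
      (if frameOracle L θ (glMap g S') (perp (glMap g S)) X Z s.2.1.1 ≠
          frameOracle L θ (glMap g T) (perp (glMap g S₀)) X Z s.2.1.1 then
        (A.midState L θ j (glMap g S) (glMap g S') X Z s s).re else 0) ≤
      2 * 2 ^ d / 2 ^ lam * ∑ g : GL (Fin (2 * lam + 1)) (ZMod 2),
        (A.midState L θ j (glMap g S) (glMap g S') X Z s s).re := by
    intro s
    have hA : ∀ t, Nat.card (hiPart t S S') = 2 ^ (lam + 1) := fun t => by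
      rw [natCard_hiPart t hS (by omega)]; congr 1; omega
    have hC : ∀ t, Nat.card (hiPart t S₀ T) = 2 ^ (lam + 1 + d) := fun t => by
      rw [natCard_hiPart t hS₀ (by omega)]; congr 1; omega
    have hB : Nat.card (⊤ : Submodule (ZMod 2) (Vec lam)) = 2 ^ (2 * lam + 1) := by
      rw [natCard_submodule, finrank_top, Module.finrank_fin_fun]
    have hev := sum_event_le (A := fun t => hiPart t S S') (B := fun _ => ⊤)
      (C := fun t => hiPart t S₀ T) (M₁ := S) (M₂ := S') (r := 2 * 2 ^ d / 2 ^ lam)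
      (by positivity) (fun t => le_top) (fun t => le_top)
      (fun t => by cases t; exacts [Or.inl h, Or.inl le_rfl])
      (fun t => by cases t; exacts [Or.inl le_rfl, Or.inl (perp_anti h)])
      hiPart (fun _ _ _ => ⊤) (fun t g => hiPart_glMap t g S S') (fun t g => (glMap_top _).symm)
      (fun t => by simp only [hA, hB]; exact Nat.pow_lt_pow_right (by norm_num) (by omega))
      (fun t => by
        simp only [hA, hB, hC]
        push_cast
        -- This uses λ ≥ 1: the known space fills at most half of the whole space.
        have h1 : (2 : ℝ) ^ (lam + 1) ≤ 2 ^ (2 * lam) :=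
          pow_le_pow_right₀ (by norm_num) (by omega)
        have h2 : (2 : ℝ) ^ (2 * lam + 1) = 2 * 2 ^ (2 * lam) := by ring
        have h3 : (2 : ℝ) ^ (lam + 1 + d) = 2 * 2 ^ d / 2 ^ lam * 2 ^ (2 * lam) := by
          rw [two_mul lam, pow_add 2 lam lam]; field_simp; ring
        rw [h3, h2]
        exact mul_le_mul_of_nonneg_left (by linarith) (by positivity))
      (I := Phi s.2.1.1.θ)
      (fun i => s.2.1.1.c i - (if s.2.1.1.θ i = some 0 then
          LinOp.actX s.2.1.1.L (padX L θ X Z) i else LinOp.actZ s.2.1.1.L (padZ L θ X Z) i))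
      (fun i => !decide (s.2.1.1.θ i = some 0))
      (fun P Q => (A.midState L θ j P Q X Z s s).re) (fun P Q => hnn P Q s)
    refine le_trans (Finset.sum_le_sum fun g _ => ?_) hev
    by_cases hw : frameOracle L θ (glMap g S') (perp (glMap g S)) X Z s.2.1.1 ≠
        frameOracle L θ (glMap g T) (perp (glMap g S₀)) X Z s.2.1.1
    · rw [if_pos hw, if_pos]
      have hex := exists_of_frameOracle_ne (glMap_mono g h₀) (glMap_mono g h') hw
      simpa only [hiPart_glMap] using hex
    · rw [if_neg hw]
      split_ifs
      exacts [hnn _ _ _, le_rfl]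
  rw [Finset.sum_comm]
  refine (Finset.sum_le_sum fun s _ => key s).trans (le_of_eq ?_)
  rw [← Finset.mul_sum, Finset.sum_comm]
  simp only [A.sum_midState, Finset.sum_const, nsmul_eq_mul, mul_one]
  rfl

-- The hybrid step combined with both averages: the surrogate run contributes 2/2^d, and each query
-- 4 times the chance of a disagreement.
open Classical in
theorem sum_isWrong_le {S₀ S S' T : Submodule (ZMod 2) (Vec lam)} {d : ℕ} (hd : d ≤ lam)
    (hl : 1 ≤ lam) (h₀ : S₀ ≤ S) (h : S ≤ S') (h' : S' ≤ T)
    (hS : Module.finrank (ZMod 2) S = lam) (hS' : Module.finrank (ZMod 2) S' = lam + 1)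
    (hS₀ : Module.finrank (ZMod 2) S₀ = lam - d) (hT : Module.finrank (ZMod 2) T = lam + 1 + d)
    {t : ℝ} (ht : 0 < t) :
    ∑ g : GL (Fin (2 * lam + 1)) (ZMod 2), ∑ X, ∑ Z, ∑ c,
      (if IsWrong θ (glMap g S) (glMap g S') (c - X) then
        A.outProb L θ (glMap g S) (glMap g S') X Z c else 0) ≤
      wrongBound lam d A.numQueries t * (Fintype.card (GL (Fin (2 * lam + 1)) (ZMod 2)) *
        (Fintype.card (Code lam n) * Fintype.card (Code lam n))) := by
  set G := Fintype.card (GL (Fin (2 * lam + 1)) (ZMod 2))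
  set N := Fintype.card (Code lam n)
  set κ := (1 + t) ^ A.numQueries with hκ
  have hκ0 : 0 ≤ κ := by positivity
  have hμ0 : 0 ≤ κ * (1 + 1 / t) := by positivity
  let D : GL (Fin (2 * lam + 1)) (ZMod 2) → Code lam n → Code lam n → ℕ → ℝ := fun g X Z j =>
    ∑ s, (if frameOracle L θ (glMap g S') (perp (glMap g S)) X Z s.2.1.1 ≠
        frameOracle L θ (glMap g T) (perp (glMap g S₀)) X Z s.2.1.1 then
      (A.midState L θ j (glMap g S) (glMap g S') X Z s s).re else 0)
  let W : GL (Fin (2 * lam + 1)) (ZMod 2) → Code lam n → Code lam n → ℝ := fun g X Z =>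
    ∑ c, (if IsWrong θ (glMap g S) (glMap g S') (c - X) then
      A.outProb L θ (glMap g S₀) (glMap g T) X Z c else 0)
  have hconst : ∀ a : ℝ, ∑ _X : Code lam n, ∑ _Z : Code lam n, a = N * N * a := fun a => by
    simp only [Finset.sum_const, nsmul_eq_mul, Finset.card_univ, N, mul_assoc]
  have hswap : ∀ φ : GL (Fin (2 * lam + 1)) (ZMod 2) → Code lam n → Code lam n → ℝ,
      ∑ g, ∑ X, ∑ Z, φ g X Z = ∑ X, ∑ Z, ∑ g, φ g X Z := fun φ => by
    rw [Finset.sum_comm]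
    exact Finset.sum_congr rfl fun X _ => Finset.sum_comm
  have h1 : ∀ g : GL (Fin (2 * lam + 1)) (ZMod 2), ∑ X, ∑ Z, ∑ c,
      (if IsWrong θ (glMap g S) (glMap g S') (c - X) then
        A.outProb L θ (glMap g S) (glMap g S') X Z c else 0) ≤
      κ * ∑ X, ∑ Z, W g X Z +
        κ * (1 + 1 / t) * ∑ j ∈ Finset.range A.numQueries, 4 * ∑ X, ∑ Z, D g X Z j := by
    intro g
    have hsw : ∑ j ∈ Finset.range A.numQueries, 4 * ∑ X, ∑ Z, D g X Z j =
        ∑ X, ∑ Z, ∑ j ∈ Finset.range A.numQueries, 4 * D g X Z j := by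
      simp only [Finset.mul_sum]
      rw [Finset.sum_comm]
      exact Finset.sum_congr rfl fun X _ => Finset.sum_comm
    -- The coset states are exchanged only after summing over the pads; for fixed pads they are
    -- distinguishable.
    rw [hsw, ← A.sum_hybridProb_eq L θ (glMap_mono g h₀) (glMap_mono g h) (glMap_mono g h')]
    simp only [Finset.mul_sum _ _ κ, Finset.mul_sum _ _ (κ * (1 + 1 / t)),
      ← Finset.sum_add_distrib]
    refine Finset.sum_le_sum fun X _ => Finset.sum_le_sum fun Z _ => ?_
    have := A.sum_outProb_le_hybrid L θ (glMap g S) (glMap g S') (glMap g S₀) (glMap g T) X Z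
      (fun c => IsWrong θ (glMap g S) (glMap g S') (c - X)) ht
    rw [← hκ] at this
    simpa only [D, Finset.mul_sum] using this
  have hW : ∑ g, ∑ X, ∑ Z, W g X Z ≤ N * N * (2 / 2 ^ d * G) := by
    rw [hswap, ← hconst]
    exact Finset.sum_le_sum fun X _ => Finset.sum_le_sum fun Z _ =>
      A.sum_isWrong_outProb_le L θ hd h₀ h h' hS hS' hS₀ hT X Z
  have hD : ∀ j, ∑ g, ∑ X, ∑ Z, D g X Z j ≤ N * N * (2 * 2 ^ d / 2 ^ lam * G) := by
    intro j
    rw [hswap, ← hconst]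
    exact Finset.sum_le_sum fun X _ => Finset.sum_le_sum fun Z _ =>
      A.sum_frameOracle_ne_le L θ hd hl h₀ h h' hS hS' hS₀ hT j X Z
  calc _ ≤ ∑ g, (κ * ∑ X, ∑ Z, W g X Z +
        κ * (1 + 1 / t) * ∑ j ∈ Finset.range A.numQueries, 4 * ∑ X, ∑ Z, D g X Z j) :=
        Finset.sum_le_sum fun g _ => h1 g
    _ = κ * ∑ g, ∑ X, ∑ Z, W g X Z + κ * (1 + 1 / t) *
        ∑ j ∈ Finset.range A.numQueries, 4 * ∑ g, ∑ X, ∑ Z, D g X Z j := by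
        rw [Finset.sum_add_distrib, ← Finset.mul_sum, ← Finset.mul_sum,
          Finset.sum_comm (t := Finset.range A.numQueries)]
        simp only [← Finset.mul_sum _ _ (4 : ℝ)]
    _ ≤ κ * (N * N * (2 / 2 ^ d * G)) + κ * (1 + 1 / t) *
        ∑ j ∈ Finset.range A.numQueries, 4 * ((N : ℝ) * N * (2 * 2 ^ d / 2 ^ lam * G)) := by
        refine add_le_add (mul_le_mul_of_nonneg_left hW hκ0)
          (mul_le_mul_of_nonneg_left (Finset.sum_le_sum fun j _ => ?_) hμ0)
        exact mul_le_mul_of_nonneg_left (hD j) (by norm_num)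
    _ = _ := by
        rw [Finset.sum_const, Finset.card_range, nsmul_eq_mul, wrongBound, ← hκ]
        ring

open Classical in
theorem sum_errProb_le (hl : 1 ≤ lam) {d : ℕ} (hd : d ≤ lam) {t : ℝ} (ht : 0 < t) :
    ∑ e, (if e = 0 then 0 else A.errProb L θ (some e)) ≤ wrongBound lam d A.numQueries t := by
  set φ : Submodule (ZMod 2) (Vec lam) → Submodule (ZMod 2) (Vec lam) → ℝ := fun M₁ M₂ =>
    ∑ X, ∑ Z, ∑ c, if IsWrong θ M₁ M₂ (c - X) then A.outProb L θ M₁ M₂ X Z c else 0 with hφ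
  set G := Fintype.card (GL (Fin (2 * lam + 1)) (ZMod 2)) with hG
  have hG0 : (0 : ℝ) < G := by exact_mod_cast Fintype.card_pos
  have h1 : ∑ e, (if e = 0 then 0 else A.errProb L θ (some e)) ≤
      (∑ b : Base lam, φ b.1.1 b.hi) / Fintype.card (Key lam n) := by
    have e1 : ∀ e : Phi θ → ZMod 2, (if e = 0 then 0 else A.errProb L θ (some e)) =
        (∑ b : Base lam, ∑ X, ∑ Z, ∑ c, if e ≠ 0 ∧ pairDec θ b.1.1 b.hi (c - X) = some e then
          A.outProb L θ b.1.1 b.hi X Z c else 0) / Fintype.card (Key lam n) := by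
      intro e
      by_cases he : e = 0
      · simp [he]
      · simp only [he, if_false, ne_eq, not_false_eq_true, true_and]
        rfl
    rw [Finset.sum_congr rfl fun e _ => e1 e, ← Finset.sum_div]
    refine div_le_div_of_nonneg_right ?_ (Nat.cast_nonneg _)
    rw [Finset.sum_comm]
    refine Finset.sum_le_sum fun b _ => ?_
    rw [Finset.sum_comm]
    refine Finset.sum_le_sum fun X _ => ?_
    rw [Finset.sum_comm]
    refine Finset.sum_le_sum fun Z _ => ?_
    rw [Finset.sum_comm]
    refine Finset.sum_le_sum fun c _ => ?_
    have hp := A.outProb_nonneg L θ b.1.1 b.hi X Z c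
    by_cases hw : ∃ e, e ≠ 0 ∧ pairDec θ b.1.1 b.hi (c - X) = some e
    · obtain ⟨e, he, hdec⟩ := hw
      rw [if_pos (isWrong_of_pairDec he hdec), Finset.sum_eq_single e, if_pos ⟨he, hdec⟩]
      · rintro e' - hne
        rw [if_neg]
        rintro ⟨-, h⟩
        exact hne (Option.some.inj (h.symm.trans hdec))
      · simp
    · rw [Finset.sum_eq_zero fun e _ => if_neg fun h => hw ⟨e, h⟩]
      split_ifs
      exacts [hp, le_rfl]
  refine h1.trans ?_
  rw [div_le_iff₀ (card_key_pos lam n)]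
  refine le_of_mul_le_mul_left ?_ hG0
  -- A uniform linear map is inserted, so that it suffices to bound the average over g for each
  -- fixed pair (S, Δ).
  rw [hG, card_mul_sum_base φ, ← hG]
  calc _ ≤ ∑ _b : Base lam, wrongBound lam d A.numQueries t *
        (G * (Fintype.card (Code lam n) * Fintype.card (Code lam n))) := by
        refine Finset.sum_le_sum fun b _ => ?_
        -- Any choice of surrogates for the pair will do: g moves the whole flag S₀ ≤ S ≤ S_Δ ≤ T
        -- together.
        obtain ⟨S₀, h₀, hS₀⟩ := exists_subspace (S := b.1.1) (k := lam - d) (by rw [b.2.1]; omega)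
        obtain ⟨T, h', hT⟩ := exists_superspace (S := b.hi) (k := lam + 1 + d)
          (by rw [finrank_hi]; omega) (by omega)
        exact A.sum_isWrong_le L θ hd hl h₀ le_sup_left h' b.2.1 (finrank_hi b) hS₀ hT ht
    _ = _ := by
        rw [Finset.sum_const, Finset.card_univ, nsmul_eq_mul, card_key]
        push_cast
        ring

end Adversary

end Averaging

/-! ### Asymptotics -/

section Asymptotics

/-- The tradeoff parameter 1/(q+1), which is defined also for q = 0, keeps the multiplicative loss
of q hybrid steps below e. -/
theorem one_add_inv_pow_le (q : ℕ) : (1 + 1 / ((q : ℝ) + 1)) ^ q ≤ 3 := by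
  have h1 : (1 + 1 / ((q : ℝ) + 1)) ^ q ≤ Real.exp (1 / ((q : ℝ) + 1)) ^ q := by
    refine pow_le_pow_left₀ (by positivity) ?_ q
    rw [add_comm]
    exact Real.add_one_le_exp _
  refine h1.trans ?_
  rw [← Real.exp_nat_mul]
  have h2 : (q : ℝ) * (1 / ((q : ℝ) + 1)) ≤ 1 := by
    rw [mul_one_div, div_le_one (by positivity)]
    linarith
  have h3 := Real.exp_one_lt_d9
  linarith [Real.exp_le_exp.2 h2]

/-- The choice d = ⌊λ/2⌋ balances 2^{-d}, the chance of hitting the hidden subspace, against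
2^{d-λ}, the chance of noticing the surrogate. -/
theorem wrongBound_le {lam q Q : ℕ} (hq : q ≤ Q) :
    2 * wrongBound lam (lam / 2) q (1 / ((q : ℝ) + 1)) ≤
      96 * ((Q : ℝ) + 1) ^ 2 * (2 : ℝ) ^ (-(lam / 2 : ℝ)) := by
  have hqQ : (q : ℝ) ≤ Q := by exact_mod_cast hq
  have hq0 : (0 : ℝ) ≤ q := Nat.cast_nonneg q
  set D : ℝ := 2 ^ (lam / 2) with hD
  have hD0 : 0 < D := by positivity
  have hDD : D / 2 ^ lam ≤ 1 / D := by
    rw [div_le_div_iff₀ (by positivity) hD0, one_mul, hD, ← pow_add]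
    exact pow_le_pow_right₀ (by norm_num) (by omega)
  -- Rounding λ/2 down costs at most a factor 2.
  have hDr : 1 / D ≤ 2 * (2 : ℝ) ^ (-(lam / 2 : ℝ)) := by
    have e1 : (2 : ℝ) ^ (-(lam / 2 : ℝ)) = 1 / (2 : ℝ) ^ (lam / 2 : ℝ) := by
      rw [Real.rpow_neg (by norm_num), one_div]
    rw [e1, mul_one_div, div_le_div_iff₀ hD0 (by positivity), one_mul, hD, ← pow_succ',
      ← Real.rpow_natCast]
    refine Real.rpow_le_rpow_of_exponent_le (by norm_num) ?_
    have h2 : lam ≤ 2 * (lam / 2 + 1) := by omega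
    have h3 : (lam : ℝ) ≤ 2 * ((lam / 2 + 1 : ℕ) : ℝ) := by exact_mod_cast h2
    linarith
  have hin : (2 : ℝ) / D + (1 + 1 / (1 / ((q : ℝ) + 1))) * (q * (4 * (2 * D / 2 ^ lam))) ≤
      8 * ((Q : ℝ) + 1) ^ 2 * (1 / D) := by
    rw [one_div_one_div]
    calc _ = 2 * (1 / D) + 8 * ((q + 2) * q) * (D / 2 ^ lam) := by ring
      _ ≤ 2 * (1 / D) + 8 * ((q + 2) * q) * (1 / D) := by gcongr
      _ = (2 + 8 * ((q + 2) * q)) * (1 / D) := by ring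
      _ ≤ 8 * ((Q : ℝ) + 1) ^ 2 * (1 / D) := by
        refine mul_le_mul_of_nonneg_right ?_ (by positivity)
        have : ((q : ℝ) + 1) ^ 2 ≤ ((Q : ℝ) + 1) ^ 2 := by gcongr
        nlinarith
  calc 2 * wrongBound lam (lam / 2) q (1 / ((q : ℝ) + 1))
      ≤ 2 * (3 * (8 * ((Q : ℝ) + 1) ^ 2 * (1 / D))) := by
        refine mul_le_mul_of_nonneg_left ?_ (by norm_num)
        exact mul_le_mul (one_add_inv_pow_le q) hin (by positivity) (by norm_num)
    _ = 48 * ((Q : ℝ) + 1) ^ 2 * (1 / D) := by ring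
    _ ≤ 48 * ((Q : ℝ) + 1) ^ 2 * (2 * (2 : ℝ) ^ (-(lam / 2 : ℝ))) :=
        mul_le_mul_of_nonneg_left hDr (by positivity)
    _ = _ := by ring

theorem exists_polynomial_le_rpow (p : Polynomial ℝ) :
    ∃ x₀ : ℕ, ∀ x : ℕ, x₀ ≤ x → p.eval (x : ℝ) ≤ (2 : ℝ) ^ (x / 4 : ℝ) := by
  have hl : 0 < Real.log 2 := Real.log_pos (by norm_num)
  -- The argument is rescaled so that 2^{x/4} becomes a plain exponential at x log 2 / 4.
  have h := (p.comp (Polynomial.C (4 / Real.log 2) * Polynomial.X)).tendsto_div_exp_atTop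
  have h' := h.comp ((tendsto_natCast_atTop_atTop (R := ℝ)).atTop_mul_const
    (show 0 < Real.log 2 / 4 by positivity))
  obtain ⟨x₀, hx⟩ := Filter.eventually_atTop.1 (h'.eventually (gt_mem_nhds zero_lt_one))
  refine ⟨x₀, fun x hxx => ?_⟩
  have h1 := hx x hxx
  simp only [Function.comp_apply, Polynomial.eval_comp, Polynomial.eval_mul, Polynomial.eval_C,
    Polynomial.eval_X] at h1
  rw [div_lt_one (Real.exp_pos _)] at h1
  have e1 : 4 / Real.log 2 * (x * (Real.log 2 / 4)) = x := by field_simp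
  have e2 : (2 : ℝ) ^ (x / 4 : ℝ) = Real.exp (x * (Real.log 2 / 4)) := by
    rw [Real.rpow_def_of_pos (by norm_num)]
    congr 1
    ring
  rw [e1] at h1
  rw [e2]
  exact h1.le

end Asymptotics

end CosetQAS

end

theorem mainTheorem2 :
    ∃ a : ℝ, 0 < a ∧ ∀ q : Polynomial ℕ, ∃ lam₀ : ℕ, ∀ lam : ℕ, lam₀ ≤ lam →
      ∀ (n : ℕ) (L : LinOp n) (θ : Bases n) (f : (Phi θ → ZMod 2) → List (ZMod 2))
        (A : Adversary lam n), A.numQueries ≤ q.eval lam →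
      ∃ ε : ℝ, 0 ≤ ε ∧ ε ≤ 1 ∧ ∀ ψ : (Fin n → ZMod 2) → ℂ, IsState ψ →
        TV (realProb L θ f A ψ) (mixedProb L θ f ε ψ) ≤ (2 : ℝ) ^ (-(a * lam)) := by
  -- Half of the exponent λ/2 is spent on absorbing the polynomial in the number of queries.
  refine ⟨1 / 4, by norm_num, fun q => ?_⟩
  obtain ⟨x₀, hx₀⟩ := exists_polynomial_le_rpow
    (Polynomial.C 96 * (q.map (Nat.castRingHom ℝ) + 1) ^ 2)
  -- The extra 1 guarantees λ ≥ 1. The witness ε is the probability of ⊥, chosen before ψ; it is at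
  -- most 1 because it is one value of the probability distribution `errProb`.
  refine ⟨x₀ + 1, fun lam hlam n L θ f A hA => ⟨A.errProb L θ none, A.errProb_nonneg L θ none, ?_,
    fun ψ hψ => ?_⟩⟩
  · rw [← A.sum_errProb L θ]
    exact Finset.single_le_sum (fun o _ => A.errProb_nonneg L θ o) (Finset.mem_univ _)
  · classical
    have hpoly : 96 * (((q.eval lam : ℕ) : ℝ) + 1) ^ 2 ≤ (2 : ℝ) ^ (lam / 4 : ℝ) := by
      have h := hx₀ lam (by omega)
      have e : (q.map (Nat.castRingHom ℝ)).eval (lam : ℝ) = ((q.eval lam : ℕ) : ℝ) :=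
        Polynomial.eval_natCast_map (Nat.castRingHom ℝ) q lam
      simpa only [Polynomial.eval_mul, Polynomial.eval_C, Polynomial.eval_pow,
        Polynomial.eval_add, Polynomial.eval_one, e] using h
    calc TV (realProb L θ f A ψ) (mixedProb L θ f (A.errProb L θ none) ψ)
        ≤ 2 * ∑ e, if e = 0 then 0 else A.errProb L θ (some e) := by
          convert TV_le A L θ f hψ
      _ ≤ 2 * wrongBound lam (lam / 2) A.numQueries (1 / ((A.numQueries : ℝ) + 1)) := by
          refine mul_le_mul_of_nonneg_left ?_ (by norm_num)
          have h := A.sum_errProb_le L θ (by omega) (Nat.div_le_self lam 2)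
            (show 0 < 1 / ((A.numQueries : ℝ) + 1) by positivity)
          convert h
      _ ≤ 96 * (((q.eval lam : ℕ) : ℝ) + 1) ^ 2 * (2 : ℝ) ^ (-(lam / 2 : ℝ)) := wrongBound_le hA
      _ ≤ (2 : ℝ) ^ (lam / 4 : ℝ) * (2 : ℝ) ^ (-(lam / 2 : ℝ)) :=
          mul_le_mul_of_nonneg_right hpoly (by positivity)
      _ = (2 : ℝ) ^ (-(1 / 4 * lam) : ℝ) := by
          rw [← Real.rpow_add (by norm_num)]
          congr 1
          ring
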